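/- **Setting.** Let $G$ be a finite connected simple graph drawn in the plane: each edge is a curve joining its endpoints with no vertex in its interior, at each crossing exactly two curve strands cross, transversally, and there are finitely many crossings. (Edges may cross repeatedly, and edges with a common endpoint may cross; an edge is even allowed to cross itself.) The planarization $G^\times$ is the plane graph obtained by inserting a dummy-vertex at each crossing; the planarization $e^\times$ of an edge $e$ is the walk in $G^\times$ into which $e$ is subdivided. The radial graph $R(G)$ is the bipartite graph whose vertices are the vertices of $G^\times$ and one face-vertex per face of $G^\times$, each face-vertex being adjacent to all vertices of $G^\times$ on the boundary of its face. The face-distance of two vertices is the number of face-vertices on a shortest path between them in $R(G)$, and the ball $\mathcal B(c,r)$ is the subgraph of $G^\times$ induced by the vertices of face-distance at most $r$ from $c$. A ribbon of a crossing $c$ of $e_1$ and $e_2$ is a path in $G$ that begins with $e_1$ and ends with $e_2$ (so if $e_1=e_2=e$, it is the path consisting of $e$). For a crossing $c$ let $\mu(c)$ be the smallest $r$ such that, for some ribbon of $c$, the planarizations of all its edges lie in $\mathcal B(c,r)$; for all other vertices $v$ of $G^\times$ let $\mu(v)=0$. The ribbon radius of the embedded graph is $\mu(G)=1+\max_{v\in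 V(G^\times)}\mu(v)$. **Proposition.** There is an algorithm that, given an embedded graph $G$ with $n$ vertices and $q$ crossings in the form of the planarization $G^\times$ (with its dummy-vertices marked) and its rotation system, computes the ribbon radius $\mu(G)$ in time $$O\bigl(1+q\,(n+q)\,\log\mu(G)\bigr),$$ that is, in time $O(q(n+q)\log \mu(G))$ if $q\ge 1$, and in time $O(1)$ if $q=0$ (where $\mu(G)=1$). Time is measured on a unit-cost RAM with addition and subtraction whose words have $O(\log (n+q+1))$ bits; the program and the implied constants are the same for all inputs, and the numbers $n$, $q$ and the number of edge-ends of $G^\times$ are part of the input. -/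

import Mathlib

/-! ## Embedded graphs -/

/-- A drawing in the plane of a connected simple graph `G`, given by its planarization `G^×`
together with a planar rotation system.

`V` is the set of vertices of `G`, `X` the set of crossings (dummy vertices), so that the vertices
of `G^×` are `V ⊕ X`, and `D` is the set of darts: every edge-segment (edge of `G^×`) is a pair
`{d, rev d}` of opposite darts. Edges of `G` may cross repeatedly, edges with a common endpoint may
cross, and self-crossings are not excluded. -/
structure EmbeddedGraph (V X D : Type) where
  /-- the graph that is drawn -/
  graph : SimpleGraph V
  connected : graph.Connected
  /-- the vertex of `G^×` at which a dart starts -/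
  tail : D → V ⊕ X
  /-- the same edge-segment, traversed the other way -/
  rev : Equiv.Perm D
  rev_rev : ∀ d, rev (rev d) = d
  rev_ne : ∀ d, rev d ≠ d
  /-- the next dart in the clockwise order around the vertex where the dart starts -/
  rot : Equiv.Perm D
  tail_eq_iff : ∀ d d', tail d = tail d' ↔ rot.SameCycle d d'
  /-- exactly four darts start at a crossing -/
  exists_dart : ∀ x : X, ∃ d, tail d = Sum.inr x
  four_darts : ∀ (x : X) (d : D), tail d = Sum.inr x → (rot ^ 4) d = d ∧ (rot ^ 2) d ≠ d
  /-- the parent-edge of the edge-segment of a dart, in the direction of the dart -/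
  parent : D → graph.Dart
  parent_rev : ∀ d, parent (rev d) = (parent d).symm
  /-- the curves cross transversally: after a crossing, an edge goes on with the opposite dart -/
  parent_straight : ∀ (x : X) (d : D),
    tail (rev d) = Sum.inr x → parent (rot (rot (rev d))) = parent d
  /-- a dart that starts at a vertex of `G` belongs to an edge at this vertex, and every edge
  leaves each of its endpoints exactly once -/
  parent_fst : ∀ (v : V) (d : D), tail d = Sum.inl v → (parent d).fst = v
  existsUnique_start : ∀ a : graph.Dart, ∃! d, tail d = Sum.inl a.fst ∧ parent d = a
  /-- following the edge straight ahead from any edge-segment, one arrives at a vertex of `G` -/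
  arrives : ∀ d, ∃ k : ℕ, ∃ v : V, tail (rev ((fun d => rot (rot (rev d)))^[k] d)) = Sum.inl v
  /-- Euler's formula `|V| + |X| + #faces = #segments + 2` for the connected plane graph `G^×`, the
  faces being the orbits of `d ↦ rot (rev d)`, which walks along the boundary of a face.
  (Without darts, the graph is a single vertex.) -/
  euler : Nonempty D →
    2 * (Nat.card V + Nat.card X +
      Nat.card (Quotient (Equiv.Perm.SameCycle.setoid (rot * rev)))) = Nat.card D + 4

namespace EmbeddedGraph

variable {V X D : Type}

/-- The faces of `G^×`, as the orbits of darts under walking along the boundary. -/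
abbrev Face (E : EmbeddedGraph V X D) : Type :=
  Quotient (Equiv.Perm.SameCycle.setoid (E.rot * E.rev))

/-- The face on whose boundary walk the dart lies. -/
def faceOf (E : EmbeddedGraph V X D) (d : D) : E.Face :=
  Quotient.mk (Equiv.Perm.SameCycle.setoid (E.rot * E.rev)) d

/-- The radial graph `R(G)`: vertices of `G^×` and face-vertices, each face-vertex being adjacent
to all vertices of `G^×` on the boundary of the face. -/
def radialGraph (E : EmbeddedGraph V X D) : SimpleGraph ((V ⊕ X) ⊕ E.Face) :=
  SimpleGraph.fromRel fun a b =>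
    ∃ d : D, a = Sum.inl (E.tail d) ∧ b = Sum.inr (E.faceOf d)

/-- The face-distance: the number of face-vertices on a shortest path in the radial graph. -/
noncomputable def faceDist (E : EmbeddedGraph V X D) (a b : (V ⊕ X) ⊕ E.Face) : ℕ :=
  sInf {k | ∃ p : E.radialGraph.Walk a b,
    p.length = E.radialGraph.dist a b ∧ p.support.countP (fun z => z.isRight) = k}

/-- The vertex set of the ball `B(c, r)`: the vertices of `G^×` at face-distance at most `r`. The
ball is the subgraph of `G^×` that it induces. -/
def ball (E : EmbeddedGraph V X D) (c : V ⊕ X) (r : ℕ) : Set (V ⊕ X) :=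
  {z | E.faceDist (Sum.inl c) (Sum.inl z) ≤ r}

/-- The vertices of the planarization `e^×` of an edge `e`. -/
def edgeVerts (E : EmbeddedGraph V X D) (e : Sym2 V) : Set (V ⊕ X) :=
  {z | ∃ d : D, (E.parent d).edge = e ∧ E.tail d = z}

/-- A ribbon of the crossing `c`: a path in `G` that begins with one of the edges that cross at `c`
and ends with the other. (Around `c`, the darts belong alternatingly to the two edges.) -/
def IsRibbon (E : EmbeddedGraph V X D) (c : X) {u v : V} (p : E.graph.Walk u v) : Prop :=
  p.IsPath ∧ ∃ d : D, E.tail d = Sum.inr c ∧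
    p.edges.head? = some (E.parent d).edge ∧
    p.edges.getLast? = some (E.parent (E.rot d)).edge

/-- `μ(c)` of a crossing `c`: the least `r` such that the ball `B(c, r)` contains a planarized
ribbon of `c`. -/
noncomputable def crossingRadius (E : EmbeddedGraph V X D) (c : X) : ℕ :=
  sInf {r | ∃ (u v : V) (p : E.graph.Walk u v), E.IsRibbon c p ∧
    ∀ e ∈ p.edges, E.edgeVerts e ⊆ E.ball (Sum.inr c) r}

/-- `μ(z)` of a vertex `z` of `G^×`; it is `0` if `z` is not a crossing. -/
noncomputable def vertexRadius (E : EmbeddedGraph V X D) : V ⊕ X → ℕ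
  | Sum.inl _ => 0
  | Sum.inr c => E.crossingRadius c

/-- The ribbon radius `μ(G) = 1 + max_z μ(z)`, over all vertices `z` of `G^×`. -/
noncomputable def ribbonRadius [Fintype V] [Fintype X] (E : EmbeddedGraph V X D) : ℕ :=
  1 + Finset.univ.sup E.vertexRadius

end EmbeddedGraph

/-! ## The machine model: a word RAM with unit costs -/

namespace RAM

/-- A state: registers, and random-access memory in the form of arrays. A program uses only
finitely many registers and arrays, as it names them by constants. -/
structure State where
  reg : ℕ → ℕ
  arr : ℕ → ℕ → ℕ

/-- Expressions: constants, registers, memory reads, addition and truncated subtraction. -/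
inductive Expr where
  | const (k : ℕ)
  | reg (r : ℕ)
  | load (a : ℕ) (i : Expr)
  | add (x y : Expr)
  | sub (x y : Expr)

/-- The value of an expression. -/
def Expr.eval (s : State) : Expr → ℕ
  | const k => k
  | reg r => s.reg r
  | load a i => s.arr a (i.eval s)
  | add x y => x.eval s + y.eval s
  | sub x y => x.eval s - y.eval s

/-- Every value that occurs when the expression is evaluated (addresses and intermediate results
included) fits into a machine word, i.e. is less than `W`. -/
def Expr.Fits (W : ℕ) (s : State) : Expr → Prop
  | const k => k < W
  | reg r => s.reg r < W
  | load a i => i.Fits W s ∧ s.arr a (i.eval s) < W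
  | add x y => x.Fits W s ∧ y.Fits W s ∧ x.eval s + y.eval s < W
  | sub x y => x.Fits W s ∧ y.Fits W s

/-- The number of elementary operations for evaluating an expression. -/
def Expr.cost : Expr → ℕ
  | const _ => 1
  | reg _ => 1
  | load _ i => 1 + i.cost
  | add x y => 1 + x.cost + y.cost
  | sub x y => 1 + x.cost + y.cost

/-- Programs. Branches and loops test whether an expression is nonzero. -/
inductive Prog where
  | skip
  | assign (r : ℕ) (e : Expr)
  | store (a : ℕ) (i e : Expr)
  | seq (p q : Prog)
  | branch (e : Expr) (p q : Prog)
  | loop (e : Expr) (p : Prog)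

/-- Assign a value to a register. -/
def State.setReg (s : State) (r v : ℕ) : State :=
  { s with reg := Function.update s.reg r v }

/-- Write a value into a cell of an array. -/
def State.setArr (s : State) (a i v : ℕ) : State :=
  { s with arr := Function.update s.arr a (Function.update (s.arr a) i v) }

/-- `Exec W p s s' t`: on a machine whose words hold the numbers less than `W`, the program `p`
started in state `s` halts in state `s'` after exactly `t` elementary steps, without any overflow.
(There is no derivation for a run that overflows or does not halt.) -/
inductive Exec (W : ℕ) : Prog → State → State → ℕ → Prop where
  | skip (s : State) : Exec W Prog.skip s s 1
  | assign (s : State) (r : ℕ) (e : Expr) (he : e.Fits W s) :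
      Exec W (Prog.assign r e) s (s.setReg r (e.eval s)) (1 + e.cost)
  | store (s : State) (a : ℕ) (i e : Expr) (hi : i.Fits W s) (he : e.Fits W s) :
      Exec W (Prog.store a i e) s (s.setArr a (i.eval s) (e.eval s)) (1 + i.cost + e.cost)
  | seq (p q : Prog) (s s' s'' : State) (t t' : ℕ) (hp : Exec W p s s' t)
      (hq : Exec W q s' s'' t') : Exec W (Prog.seq p q) s s'' (t + t')
  | branch_true (e : Expr) (p q : Prog) (s s' : State) (t : ℕ) (he : e.Fits W s)
      (h : e.eval s ≠ 0) (hp : Exec W p s s' t) :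
      Exec W (Prog.branch e p q) s s' (1 + e.cost + t)
  | branch_false (e : Expr) (p q : Prog) (s s' : State) (t : ℕ) (he : e.Fits W s)
      (h : e.eval s = 0) (hq : Exec W q s s' t) :
      Exec W (Prog.branch e p q) s s' (1 + e.cost + t)
  | loop_done (e : Expr) (p : Prog) (s : State) (he : e.Fits W s) (h : e.eval s = 0) :
      Exec W (Prog.loop e p) s s (1 + e.cost)
  | loop_step (e : Expr) (p : Prog) (s s' s'' : State) (t t' : ℕ) (he : e.Fits W s)
      (h : e.eval s ≠ 0) (hp : Exec W p s s' t) (hl : Exec W (Prog.loop e p) s' s'' t') :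
      Exec W (Prog.loop e p) s s'' (1 + e.cost + t + t')

end RAM

/-- The array of length `k` with the given entries, in a memory that is `0` elsewhere. -/
def RAM.ofFin {k : ℕ} (f : Fin k → ℕ) (i : ℕ) : ℕ :=
  if h : i < k then f ⟨i, h⟩ else 0

/-- The initial state for an embedded graph with `n` vertices, `q` crossings and `k` darts. The
input is the planarization with its rotation system: registers `0`, `1`, `2` hold `n`, `q`, `k`,
and arrays `0`, `1`, `2` hold, for every dart, its starting vertex (the vertices of `G` being
numbered `0, …, n - 1`, the crossings `n, …, n + q - 1`), the next dart clockwise around this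
vertex, and the opposite dart. All else is `0`. -/
def EmbeddedGraph.input {n q k : ℕ} (E : EmbeddedGraph (Fin n) (Fin q) (Fin k)) : RAM.State where
  reg := fun r => if r = 0 then n else if r = 1 then q else if r = 2 then k else 0
  arr := fun a =>
    if a = 0 then RAM.ofFin fun d => Sum.elim (fun v : Fin n => (v : ℕ)) (fun x => n + x) (E.tail d)
    else if a = 1 then RAM.ofFin fun d => (E.rot d : ℕ)
    else if a = 2 then RAM.ofFin fun d => (E.rev d : ℕ)
    else fun _ => 0

namespace RAM

/-! ## A program logic with time bounds -/

/-! The bound suggests testing candidate radii by a binary or exponential search, but none is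
needed: μ(c) is a bottleneck value and can be computed directly in time O(n + q) for each crossing
c. The total is O(q(n + q)). If there is a crossing, then μ(G) ≥ 2 (`two_le_ribbonRadius`), so the
logarithm in the claimed bound is at least 1.

Size. Let k be the number of darts. As G is simple, a face of length 1 or 2 contains a dart at a
crossing or at a vertex of degree one. With Euler's formula this gives k ≤ 10n + 22q
(`card_darts_le`), so it suffices to work in time linear in n + q + k.

Distances. The radial graph is bipartite, so the face-distance is half of its graph distance
(`two_mul_faceDist`), and it is at most n + q + k (`faceDist_le`). Keys are therefore small
integers, and a shortest-path search with buckets takes linear time (`Tot.searchProg`). To have only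
two arcs at each node, the search runs on darts: one arc rotates around a vertex or a face, the
other changes between vertex and face and costs 1 when it enters a face.

Ribbons. The same search, with the maximal face-distance from c along a walk as key, starts from a
dart `d₀` at c and follows the edges of G: straight on at crossings, into any edge at vertices. A
walk of key at most r gets from one vertex of G to another only along edges that lie in the ball of
radius r. Hence, if both edges that cross at c lie in this ball, the dart `rot d₀` of the second
edge is reached at level r just if the two edges are connected by edges inside the ball; and then
some path begins with the one and ends with the other (`RibbonArcs.exists_ribbon_iff`,
`exists_path_head_getLast`). So μ(c) is the maximum of this level and of the face-distances on the
two edges. The latter are collected by walking from c in four directions to the ends of the edges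
(`edgeVerts_subset_iff`, `tot_back`).

Programs are verified for total correctness and running time at once: by weakest preconditions for
loop-free code (`Tot.of_wp`) and by a decreasing bound for loops (`Tot.loop`). -/

@[simp] theorem State.setReg_reg (s : State) (r v r' : ℕ) :
    (s.setReg r v).reg r' = if r' = r then v else s.reg r' := by
  simp [State.setReg, Function.update_apply]

@[simp] theorem State.setReg_arr (s : State) (r v : ℕ) : (s.setReg r v).arr = s.arr := rfl

@[simp] theorem State.setArr_reg (s : State) (a i v : ℕ) : (s.setArr a i v).reg = s.reg := rfl

@[simp] theorem State.setArr_arr (s : State) (a i v a' : ℕ) :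
    (s.setArr a i v).arr a' = if a' = a then Function.update (s.arr a) i v else s.arr a' := by
  by_cases h : a' = a
  · subst h; simp [State.setArr]
  · simp [State.setArr, h]

/-- The program `p` started in `s` halts within `T` steps, without overflow, in a state with `Q`. -/
def Tot (W : ℕ) (p : Prog) (s : State) (T : ℕ) (Q : State → Prop) : Prop :=
  ∃ s' t, Exec W p s s' t ∧ t ≤ T ∧ Q s'

theorem Tot.mono {W p s T T'} {Q Q' : State → Prop} (h : Tot W p s T Q) (hT : T ≤ T')
    (hQ : ∀ s', Q s' → Q' s') : Tot W p s T' Q' := by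
  obtain ⟨s', t, h1, h2, h3⟩ := h
  exact ⟨s', t, h1, h2.trans hT, hQ _ h3⟩

theorem Tot.seq {W p q s T₁ T₂} {R Q : State → Prop} (h₁ : Tot W p s T₁ R)
    (h₂ : ∀ s', R s' → Tot W q s' T₂ Q) : Tot W (.seq p q) s (T₁ + T₂) Q := by
  obtain ⟨s', t, h1, h2, h3⟩ := h₁
  obtain ⟨s'', t', h1', h2', h3'⟩ := h₂ s' h3
  exact ⟨s'', t + t', .seq _ _ _ _ _ _ _ h1 h1', by omega, h3'⟩

/-- The weakest precondition of a loop-free program. -/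
def wp (W : ℕ) : Prog → (State → Prop) → State → Prop
  | .skip, Q, s => Q s
  | .assign r e, Q, s => e.Fits W s ∧ Q (s.setReg r (e.eval s))
  | .store a i e, Q, s => i.Fits W s ∧ e.Fits W s ∧ Q (s.setArr a (i.eval s) (e.eval s))
  | .seq p q, Q, s => wp W p (wp W q Q) s
  | .branch e p q, Q, s =>
      e.Fits W s ∧ (e.eval s ≠ 0 → wp W p Q s) ∧ (e.eval s = 0 → wp W q Q s)
  | .loop _ _, _, _ => False

theorem wp_mono {W p} : ∀ {Q Q' : State → Prop} {s}, (∀ s, Q s → Q' s) → wp W p Q s → wp W p Q' s := by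
  induction p with
  | skip => exact fun h hs => h _ hs
  | assign r e => exact fun h hs => ⟨hs.1, h _ hs.2⟩
  | store a i e => exact fun h hs => ⟨hs.1, hs.2.1, h _ hs.2.2⟩
  | seq p q hp hq => exact fun h hs => hp (fun _ => hq h) hs
  | branch e p q hp hq =>
    exact fun h hs => ⟨hs.1, fun he => hp h (hs.2.1 he), fun he => hq h (hs.2.2 he)⟩
  | loop e p => exact fun h hs => hs.elim

/-- A bound on the running time of a loop-free program. -/
def Prog.bound : Prog → ℕ
  | .skip => 1
  | .assign _ e => 1 + e.cost
  | .store _ i e => 1 + i.cost + e.cost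
  | .seq p q => p.bound + q.bound
  | .branch e p q => 1 + e.cost + (p.bound + q.bound)
  -- A default value that is never used as a bound: `wp` is `False` for loops.
  | .loop _ _ => 0

theorem Tot.of_wp {W p} : ∀ {s} {Q : State → Prop}, wp W p Q s → Tot W p s p.bound Q := by
  induction p with
  | skip => exact fun h => ⟨_, _, .skip _, le_rfl, h⟩
  | assign r e => exact fun h => ⟨_, _, .assign _ _ _ h.1, le_rfl, h.2⟩
  | store a i e => exact fun h => ⟨_, _, .store _ _ _ _ h.1 h.2.1, le_rfl, h.2.2⟩
  | seq p q hp hq => exact fun h => Tot.seq (hp h) fun s' h' => hq h'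
  | branch e p q hp hq =>
    intro s Q h
    by_cases he : e.eval s = 0
    · obtain ⟨s', t, h1, h2, h3⟩ := hq (h.2.2 he)
      exact ⟨s', _, .branch_false _ _ _ _ _ _ h.1 he h1, by simp only [Prog.bound]; omega, h3⟩
    · obtain ⟨s', t, h1, h2, h3⟩ := hp (h.2.1 he)
      exact ⟨s', _, .branch_true _ _ _ _ _ _ h.1 he h1, by simp only [Prog.bound]; omega, h3⟩
  | loop e p => exact fun h => h.elim

/-- The registers that a program may change. -/
def Prog.writesReg : Prog → ℕ → Prop
  | .skip, _ => False
  | .assign r _, r' => r' = r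
  | .store _ _ _, _ => False
  | .seq p q, r => p.writesReg r ∨ q.writesReg r
  | .branch _ p q, r => p.writesReg r ∨ q.writesReg r
  | .loop _ p, r => p.writesReg r

/-- The arrays that a program may change. -/
def Prog.writesArr : Prog → ℕ → Prop
  | .skip, _ => False
  | .assign _ _, _ => False
  | .store a _ _, a' => a' = a
  | .seq p q, a => p.writesArr a ∨ q.writesArr a
  | .branch _ p q, a => p.writesArr a ∨ q.writesArr a
  | .loop _ p, a => p.writesArr a

/-- The two states differ only in registers and arrays that the program may change. -/
structure Agree (p : Prog) (s s' : State) : Prop where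
  reg : ∀ r, ¬ p.writesReg r → s'.reg r = s.reg r
  arr : ∀ a, ¬ p.writesArr a → s'.arr a = s.arr a

theorem Agree.refl (p : Prog) (s : State) : Agree p s s := ⟨fun _ _ => rfl, fun _ _ => rfl⟩

theorem Agree.trans {p : Prog} {s s' s'' : State} (h : Agree p s s') (h' : Agree p s' s'') :
    Agree p s s'' :=
  ⟨fun r hr => (h'.reg r hr).trans (h.reg r hr), fun r hr => (h'.arr r hr).trans (h.arr r hr)⟩

theorem Exec.agree {W p s s' t} (h : Exec W p s s' t) : Agree p s s' := by
  induction h with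
  | skip s => exact .refl _ _
  | assign s r e he =>
    exact ⟨fun r' hr => by simp [show r' ≠ r from hr], fun a _ => rfl⟩
  | store s a i e hi he =>
    exact ⟨fun r' hr => rfl, fun a' ha => by simp [show a' ≠ a from ha]⟩
  | seq p q s s' s'' t t' hp hq ihp ihq =>
    refine ⟨fun r hr => ?_, fun r hr => ?_⟩
    · rw [ihq.reg r fun h => hr (.inr h), ihp.reg r fun h => hr (.inl h)]
    · rw [ihq.arr r fun h => hr (.inr h), ihp.arr r fun h => hr (.inl h)]
  | branch_true e p q s s' t he h hp ih =>
    exact ⟨fun r hr => ih.reg r fun h => hr (.inl h), fun r hr => ih.arr r fun h => hr (.inl h)⟩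
  | branch_false e p q s s' t he h hp ih =>
    exact ⟨fun r hr => ih.reg r fun h => hr (.inr h), fun r hr => ih.arr r fun h => hr (.inr h)⟩
  | loop_done e p s he h => exact .refl _ _
  | loop_step e p s s' s'' t t' he h hp hl ihp ihl =>
    exact ⟨fun r hr => by rw [ihl.reg r hr, ihp.reg r hr],
      fun r hr => by rw [ihl.arr r hr, ihp.arr r hr]⟩

/-- Invariants need to mention only what a program changes; the rest is carried over by the
syntactic sets of written registers and arrays. -/
theorem Tot.frame {W p s T} {Q : State → Prop} (h : Tot W p s T Q) :
    Tot W p s T fun s' => Q s' ∧ Agree p s s' := by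
  obtain ⟨s', t, h1, h2, h3⟩ := h
  exact ⟨s', t, h1, h2, h3, h1.agree⟩

/-- The rule for loops: the number `μ` in the invariant decreases in each pass. -/
theorem Tot.loop {W e p B} {s₀ : State} {I : ℕ → State → Prop}
    (step : ∀ μ s, Agree p s₀ s → I μ s → e.Fits W s ∧
      (e.eval s ≠ 0 → Tot W p s B fun s' => ∃ μ' < μ, I μ' s'))
    {μ : ℕ} (h₀ : I μ s₀) :
    Tot W (.loop e p) s₀ ((μ + 1) * (1 + e.cost + B))
      fun s' => e.eval s' = 0 ∧ Agree p s₀ s' ∧ ∃ μ, I μ s' := by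
  suffices H : ∀ μ s, Agree p s₀ s → I μ s → Tot W (.loop e p) s ((μ + 1) * (1 + e.cost + B))
      fun s' => e.eval s' = 0 ∧ Agree p s₀ s' ∧ ∃ μ, I μ s' from H μ s₀ (.refl _ _) h₀
  intro μ
  induction μ using Nat.strong_induction_on with
  | _ μ ih =>
    intro s ha hI
    obtain ⟨hf, hb⟩ := step μ s ha hI
    by_cases he : e.eval s = 0
    · exact ⟨s, _, .loop_done _ _ _ hf he, by nlinarith [Nat.zero_le (μ * (1 + e.cost + B))],
        he, ha, μ, hI⟩
    · obtain ⟨s', t, h1, h2, μ', hμ, hI'⟩ := hb he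
      obtain ⟨s'', t', h1', h2', h3'⟩ := ih μ' hμ s' (ha.trans h1.agree) hI'
      refine ⟨s'', _, .loop_step _ _ _ _ _ _ _ hf he h1 h1', ?_, h3'⟩
      have : (μ' + 1) * (1 + e.cost + B) ≤ μ * (1 + e.cost + B) := Nat.mul_le_mul_right _ hμ
      have : (μ + 1) * (1 + e.cost + B) = μ * (1 + e.cost + B) + (1 + e.cost + B) := by ring
      omega

/-- Counting the register `i` up to the value of the register `N`. -/
def Prog.forUpto (i N : ℕ) (p : Prog) : Prog :=
  .seq (.assign i (.const 0)) (.loop (.sub (.reg N) (.reg i)) (.seq p (.assign i (.add (.reg i) (.const 1)))))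

theorem Tot.forUpto {W i N p B} {s₀ : State} {I : ℕ → State → Prop} (hiN : N ≠ i)
    (hpi : ¬ p.writesReg i) (hpN : ¬ p.writesReg N) (hW : s₀.reg N + 1 < W)
    (h₀ : I 0 (s₀.setReg i 0))
    (step : ∀ j s, Agree (.seq p (.assign i (.const 0))) s₀ s → s.reg i = j → j < s₀.reg N →
      I j s → Tot W p s B fun s' => I (j + 1) (s'.setReg i (j + 1))) :
    Tot W (.forUpto i N p) s₀ ((s₀.reg N + 1) * (B + 12))
      fun s' => I (s₀.reg N) s' := by
  have h1 : Tot W (.assign i (.const 0)) s₀ 2 fun s' => s' = s₀.setReg i 0 :=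
    (Tot.of_wp (Q := fun s' => s' = s₀.setReg i 0)
      (show wp W (.assign i (.const 0)) _ s₀ from ⟨show 0 < W by omega, rfl⟩))
  refine (Tot.seq (T₂ := (s₀.reg N + 1) * (8 + B)) h1 ?_).mono
    (by nlinarith [Nat.zero_le (s₀.reg N * B)]) (fun s' h => h)
  rintro s' rfl
  have hagree : ∀ s, Agree (.seq p (.assign i (.add (.reg i) (.const 1)))) (s₀.setReg i 0) s →
      Agree (.seq p (.assign i (.const 0))) s₀ s := by
    intro s h
    refine ⟨fun r hr => ?_, fun a ha => h.arr a ha⟩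
    have : r ≠ i := fun h => hr (.inr h)
    rw [h.reg r hr, State.setReg_reg, if_neg this]
  refine (Tot.loop (B := B + 4) (s₀ := s₀.setReg i 0)
    (I := fun μ s => ∃ j, s.reg i = j ∧ μ + j = s₀.reg N ∧ I j s) ?_ (μ := s₀.reg N)
    ⟨0, by simp, by simp, h₀⟩).mono ?_ ?_
  · rintro μ s ha ⟨j, hj, hμ, hI⟩
    have hN : s.reg N = s₀.reg N := (hagree s ha).reg N (by
      rintro (h | h)
      exacts [hpN h, hiN h])
    refine ⟨⟨by simp [Expr.Fits, hN]; omega, by simp [Expr.Fits, hj]; omega⟩, fun he => ?_⟩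
    simp only [Expr.eval, hN, hj] at he
    refine (Tot.seq (step j s (hagree s ha) hj (by omega) hI).frame (T₂ := 4) ?_)
    rintro s' ⟨h1, h2⟩
    have hi' : s'.reg i = j := by rw [h2.reg i hpi, hj]
    refine Tot.of_wp (p := .assign i (.add (.reg i) (.const 1))) ⟨?_, ?_⟩
    · simp [Expr.Fits, Expr.eval, hi']; omega
    · refine ⟨s₀.reg N - (j + 1), by omega, j + 1, ?_, by omega, ?_⟩
      · simp [Expr.eval, hi']
      · simpa [Expr.eval, hi'] using h1
  · simp only [Expr.cost]
    refine Nat.mul_le_mul_left _ (by omega)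
  · rintro s ⟨he, ha, μ, j, hj, hμ, hI⟩
    have hN : s.reg N = s₀.reg N := (hagree s ha).reg N (by
      rintro (h | h)
      exacts [hpN h, hiN h])
    simp only [Expr.eval, hN, hj] at he
    obtain rfl : j = s₀.reg N := by omega
    exact hI

end RAM

namespace RAM

/-! ## Monotone search with bucket lists -/

/-- A graph on natural numbers with two arcs `x → s₁ x` and `x → s₂ x` from each node. Along a walk
from `src`, the key starts with `0`; it is increased by `A x` on a second arc, and raised to
`b y` at each node `y`. `Deriv r x` says that some walk ends in `x` with key `r`. -/
inductive Deriv (s₁ s₂ A b : ℕ → ℕ) (src : ℕ) : ℕ → ℕ → Prop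
  | src : Deriv s₁ s₂ A b src 0 src
  | left {r x : ℕ} (h : Deriv s₁ s₂ A b src r x) :
      Deriv s₁ s₂ A b src (max r (b (s₁ x))) (s₁ x)
  | right {r x : ℕ} (h : Deriv s₁ s₂ A b src r x) :
      Deriv s₁ s₂ A b src (max (r + A x) (b (s₂ x))) (s₂ x)

/-- `Chain nx nd m h L`: the linked list that starts with the item `h` has the entries `L`, and its
items are at most `m`. -/
def Chain (nx nd : ℕ → ℕ) (m : ℕ) : ℕ → List ℕ → Prop
  | h, [] => h = 0
  | h, y :: L => h ≠ 0 ∧ h ≤ m ∧ nd h = y ∧ Chain nx nd m (nx h) L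

theorem Chain.le {nx nd : ℕ → ℕ} {m h : ℕ} {L : List ℕ} (H : Chain nx nd m h L) : h ≤ m := by
  cases L with
  | nil => simp only [Chain] at H; omega
  | cons y L => exact H.2.1

/-- A new item gets the fresh address `m + 1`, and all existing items have addresses up to `m`, so
no list is disturbed. -/
theorem Chain.push {nx nd : ℕ → ℕ} {m h : ℕ} {L : List ℕ} (H : Chain nx nd m h L) (v y : ℕ) :
    Chain (Function.update nx (m + 1) v) (Function.update nd (m + 1) y) (m + 1) h L := by
  induction L generalizing h with
  | nil => exact H
  | cons z L ih =>
    obtain ⟨h1, h2, h3, h4⟩ := H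
    have : h ≠ m + 1 := by omega
    refine ⟨h1, by omega, by rwa [Function.update_of_ne this], ?_⟩
    rw [Function.update_of_ne this]
    exact ih h4

/-- The linked lists with heads `hd j`, `j ≤ K`, have the entries `B j`. -/
def Buckets (K : ℕ) (nx nd hd : ℕ → ℕ) (m : ℕ) (B : ℕ → List ℕ) : Prop :=
  ∀ j ≤ K, Chain nx nd m (hd j) (B j)

theorem Buckets.push {K : ℕ} {nx nd hd : ℕ → ℕ} {m : ℕ} {B : ℕ → List ℕ}
    (H : Buckets K nx nd hd m B) {j : ℕ} (hj : j ≤ K) (y : ℕ) :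
    Buckets K (Function.update nx (m + 1) (hd j)) (Function.update nd (m + 1) y)
      (Function.update hd j (m + 1)) (m + 1) (Function.update B j (y :: B j)) := by
  intro i hi
  by_cases h : i = j
  · subst h
    simp only [Function.update_self]
    refine ⟨by omega, le_rfl, by simp, ?_⟩
    rw [Function.update_self]
    exact (H i hi).push _ _
  · rw [Function.update_of_ne h, Function.update_of_ne h]
    exact (H i hi).push _ _

theorem Buckets.pop {K : ℕ} {nx nd hd : ℕ → ℕ} {m : ℕ} {B : ℕ → List ℕ}
    (H : Buckets K nx nd hd m B) {j : ℕ} (hj : j ≤ K) (h0 : hd j ≠ 0) :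
    ∃ L, B j = nd (hd j) :: L ∧
      Buckets K nx nd (Function.update hd j (nx (hd j))) m (Function.update B j L) := by
  have := H j hj
  cases hB : B j with
  | nil => rw [hB] at this; exact absurd this h0
  | cons y L =>
    rw [hB] at this
    obtain ⟨h1, h2, h3, h4⟩ := this
    refine ⟨L, by rw [h3], fun i hi => ?_⟩
    by_cases h : i = j
    · subst h; simpa using h4
    · rw [Function.update_of_ne h, Function.update_of_ne h]
      exact H i hi

section Search

variable (s₁ s₂ A b : ℕ → ℕ) (src N K : ℕ)

/-- The node `y` has been reached with key at most `j`, or it waits in bucket `j`. -/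
def Covered (val : ℕ → ℕ) (B : ℕ → List ℕ) (j y : ℕ) : Prop :=
  (val y ≠ 0 ∧ val y ≤ j + 1) ∨ y ∈ B j

/-- The invariant of the search, at level `r`; the arcs from reached nodes other than those in
`P` have been followed. -/
structure SearchInv (val : ℕ → ℕ) (B : ℕ → List ℕ) (r : ℕ) (P₁ P₂ : ℕ → Prop) : Prop where
  sound : ∀ x < N, val x ≠ 0 → val x ≤ r + 1 ∧ val x ≤ K ∧ Deriv s₁ s₂ A b src (val x - 1) x
  bucket : ∀ j ≤ K, ∀ y ∈ B j, y < N ∧ Deriv s₁ s₂ A b src j y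
  empty : ∀ j < r, B j = []
  left : ∀ x < N, val x ≠ 0 → ¬ P₁ x → Covered val B (max (val x - 1) (b (s₁ x))) (s₁ x)
  right : ∀ x < N, val x ≠ 0 → ¬ P₂ x → Covered val B (max (val x - 1 + A x) (b (s₂ x))) (s₂ x)
  src : Covered val B 0 src

variable {s₁ s₂ A b src N K} {val : ℕ → ℕ} {B : ℕ → List ℕ} {r : ℕ} {P₁ P₂ : ℕ → Prop}

theorem Covered.push {j y : ℕ} (h : Covered val B j y) (i z : ℕ) :
    Covered val (Function.update B i (z :: B i)) j y := by
  rcases h with h | h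
  · exact .inl h
  · right
    by_cases hij : j = i
    · subst hij; simp [h]
    · rwa [Function.update_of_ne hij]

/-- Keys that are pushed are never below the current level, so the finished buckets stay empty. -/
theorem SearchInv.push (H : SearchInv s₁ s₂ A b src N K val B r P₁ P₂) {i z : ℕ}
    (hr : r ≤ i) (hz : z < N) (hd : Deriv s₁ s₂ A b src i z) :
    SearchInv s₁ s₂ A b src N K val (Function.update B i (z :: B i)) r P₁ P₂ where
  sound := H.sound
  bucket j hj y hy := by
    by_cases h : j = i
    · subst h
      rw [Function.update_self, List.mem_cons] at hy
      rcases hy with rfl | hy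
      exacts [⟨hz, hd⟩, H.bucket j hj y hy]
    · rw [Function.update_of_ne h] at hy
      exact H.bucket j hj y hy
  empty j hj := by
    rw [Function.update_of_ne (by omega)]
    exact H.empty j hj
  left x hx h1 h2 := (H.left x hx h1 h2).push _ _
  right x hx h1 h2 := (H.right x hx h1 h2).push _ _
  src := H.src.push _ _

/-- Following the first arc of the node `x`. -/
theorem SearchInv.pushLeft {x : ℕ} (H : SearchInv s₁ s₂ A b src N K val B r (· = x) P₂)
    (hx : x < N) (hs : s₁ x < N) (hv : val x = r + 1) :
    SearchInv s₁ s₂ A b src N K val (Function.update B (max r (b (s₁ x)))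
      (s₁ x :: B (max r (b (s₁ x))))) r (fun _ => False) P₂ := by
  have hD := (H.sound x hx (by omega)).2.2
  rw [hv, Nat.add_sub_cancel] at hD
  have H' := H.push (le_max_left r (b (s₁ x))) hs hD.left
  refine { H' with left := fun y hy h1 _ => ?_ }
  by_cases h : y = x
  · subst h
    right
    rw [hv, Nat.add_sub_cancel, Function.update_self]
    simp
  · exact H'.left y hy h1 h

/-- Following the second arc of the node `x`. -/
theorem SearchInv.pushRight {x : ℕ} (H : SearchInv s₁ s₂ A b src N K val B r P₁ (· = x))
    (hx : x < N) (hs : s₂ x < N) (hv : val x = r + 1) :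
    SearchInv s₁ s₂ A b src N K val (Function.update B (max (r + A x) (b (s₂ x)))
      (s₂ x :: B (max (r + A x) (b (s₂ x))))) r P₁ (fun _ => False) := by
  have hD := (H.sound x hx (by omega)).2.2
  rw [hv, Nat.add_sub_cancel] at hD
  have H' := H.push ((Nat.le_add_right r (A x)).trans (le_max_left _ (b (s₂ x)))) hs hD.right
  refine { H' with right := fun y hy h1 _ => ?_ }
  by_cases h : y = x
  · subst h
    right
    rw [hv, Nat.add_sub_cancel, Function.update_self]
    simp
  · exact H'.right y hy h1 h

/-- Removing a node that has been reached before. -/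
theorem SearchInv.pop (H : SearchInv s₁ s₂ A b src N K val B r P₁ P₂) {x : ℕ} {L : List ℕ}
    (hr : r ≤ K) (hB : B r = x :: L) (hv : val x ≠ 0) :
    SearchInv s₁ s₂ A b src N K val (Function.update B r L) r P₁ P₂ := by
  have hx : x < N := (H.bucket r hr x (by simp [hB])).1
  have hc : ∀ j y, Covered val B j y → Covered val (Function.update B r L) j y := by
    rintro j y (h | h)
    · exact .inl h
    · by_cases hj : j = r
      · subst hj
        rw [hB, List.mem_cons] at h
        rcases h with rfl | h
        -- The removed entry is redundant: its node has been reached with a key that is at most the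
        -- current level.
        · exact .inl ⟨hv, (H.sound y hx hv).1⟩
        · right; simpa using h
      · right; rwa [Function.update_of_ne hj]
  refine ⟨H.sound, fun j hj y hy => ?_, fun j hj => ?_, fun x hx h1 h2 => hc _ _ (H.left x hx h1 h2),
    fun x hx h1 h2 => hc _ _ (H.right x hx h1 h2), hc _ _ H.src⟩
  · by_cases h : j = r
    · subst h
      rw [Function.update_self] at hy
      exact H.bucket j hj y (by simp [hB, hy])
    · rw [Function.update_of_ne h] at hy
      exact H.bucket j hj y hy
  · rw [Function.update_of_ne (by omega)]
    exact H.empty j hj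

/-- Reaching a node for the first time. -/
theorem SearchInv.settle
    (H : SearchInv s₁ s₂ A b src N K val B r (fun _ => False) (fun _ => False)) {x : ℕ}
    (hr : r < K) (hx : x ∈ B r) (hv : val x = 0) :
    SearchInv s₁ s₂ A b src N K (Function.update val x (r + 1)) B r (· = x) (· = x) := by
  have hc : ∀ j y, Covered val B j y → Covered (Function.update val x (r + 1)) B j y := by
    rintro j y (h | h)
    · left; rwa [Function.update_of_ne (by rintro rfl; exact h.1 hv)]
    · exact .inr h
  refine ⟨fun y hy h => ?_, H.bucket, H.empty, fun y hy h h' => ?_, fun y hy h h' => ?_, hc _ _ H.src⟩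
  · by_cases hxy : y = x
    · subst hxy
      rw [Function.update_self]
      exact ⟨le_rfl, hr, (H.bucket r hr.le y hx).2⟩
    · rw [Function.update_of_ne hxy] at h ⊢
      exact H.sound y hy h
  · rw [Function.update_of_ne h'] at h ⊢
    exact hc _ _ (H.left y hy h not_false)
  · rw [Function.update_of_ne h'] at h ⊢
    exact hc _ _ (H.right y hy h not_false)

theorem SearchInv.advance (H : SearchInv s₁ s₂ A b src N K val B r P₁ P₂) (hB : B r = []) :
    SearchInv s₁ s₂ A b src N K val B (r + 1) P₁ P₂ :=
  { H with
    sound := fun x hx h => ⟨(H.sound x hx h).1.trans (by omega), (H.sound x hx h).2⟩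
    empty := fun j hj => by
      rcases Nat.lt_succ_iff_lt_or_eq.1 hj with h | rfl
      exacts [H.empty j h, hB] }

/-- What the search computes. -/
theorem SearchInv.final (H : SearchInv s₁ s₂ A b src N K val B K (fun _ => False) (fun _ => False))
    (hsrc : src < N) (h₁ : ∀ x < N, s₁ x < N) (h₂ : ∀ x < N, s₂ x < N) {d x : ℕ}
    (hd : Deriv s₁ s₂ A b src d x) (hdK : d < K) : x < N ∧ val x ≠ 0 ∧ val x ≤ d + 1 := by
  have hc : ∀ j y, j < K → Covered val B j y → val y ≠ 0 ∧ val y ≤ j + 1 := by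
    rintro j y hj (h | h)
    · exact h
    · rw [H.empty j hj] at h; simp at h
  -- Keys never decrease along a walk, so all earlier nodes have keys below `K` too. The buckets
  -- below `K` are empty, so that a covered node must have been reached.
  induction hd with
  | src => exact ⟨hsrc, hc _ _ hdK H.src⟩
  | @left r x hd ih =>
    obtain ⟨hx, h3, h4⟩ := ih (lt_of_le_of_lt (le_max_left _ _) hdK)
    obtain ⟨h5, h6⟩ := hc _ _ (by omega) (H.left x hx h3 not_false)
    exact ⟨h₁ x hx, h5, by omega⟩
  | @right r x hd ih =>
    obtain ⟨hx, h3, h4⟩ := ih (by omega)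
    obtain ⟨h5, h6⟩ := hc _ _ (by omega) (H.right x hx h3 not_false)
    exact ⟨h₂ x hx, h5, by omega⟩

end Search

/-- The number of nodes below `N` with entry `0`. -/
def zeros (N : ℕ) (val : ℕ → ℕ) : ℕ := ((Finset.range N).filter fun x => val x = 0).card

theorem zeros_update {N x v : ℕ} {val : ℕ → ℕ} (hx : x < N) (h0 : val x = 0) (hv : v ≠ 0) :
    zeros N (Function.update val x v) + 1 = zeros N val := by
  have : ((Finset.range N).filter fun y => Function.update val x v y = 0) =
      ((Finset.range N).filter fun y => val y = 0).erase x := by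
    ext y
    by_cases h : y = x
    · subst h; simp [hv]
    · simp [h]
  rw [zeros, this, zeros]
  exact Finset.card_erase_add_one (by simp [hx, h0])

/-- The number of entries of the buckets up to `K`. -/
def entries (K : ℕ) (B : ℕ → List ℕ) : ℕ := ∑ j ∈ Finset.range (K + 1), (B j).length

theorem entries_update {K j : ℕ} (B : ℕ → List ℕ) (hj : j ≤ K) (L : List ℕ) :
    entries K (Function.update B j L) + (B j).length = entries K B + L.length := by
  have hj' : j ∈ Finset.range (K + 1) := by simp; omega
  rw [entries, entries, ← Finset.add_sum_erase _ _ hj', ← Finset.add_sum_erase _ _ hj',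
    Finset.sum_congr rfl fun i hi => by rw [Function.update_of_ne (Finset.ne_of_mem_erase hi)]]
  rw [Function.update_self]
  omega

end RAM

namespace RAM

/-! ## The program for the search

The registers `4`, `10`, `11` hold the source, the number `N` of nodes and the number `K` of levels.
The arrays `3`, `4`, `5`, `6` hold the keys found (increased by `1`), the heads of the buckets, and
the links and entries of the list items. -/

/-- Put the node in register `14` into a bucket; register `15` holds a lower bound for the key. -/
def pushProg (b : ℕ) : Prog :=
  .seq (.assign 15 (.add (.reg 15) (.sub (.load b (.reg 14)) (.reg 15)))) <|
  .seq (.assign 13 (.add (.reg 13) (.const 1))) <|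
  .seq (.store 6 (.reg 13) (.reg 14)) <|
  .seq (.store 5 (.reg 13) (.load 4 (.reg 15)))
    (.store 4 (.reg 15) (.reg 13))

/-- Settle the node in register `17` and follow its arcs. -/
def settleProg (a₁ a₂ A b : ℕ) : Prog :=
  .seq (.store 3 (.reg 17) (.add (.reg 12) (.const 1))) <|
  .seq (.assign 14 (.load a₁ (.reg 17))) <|
  .seq (.assign 15 (.reg 12)) <|
  .seq (pushProg b) <|
  .seq (.assign 14 (.load a₂ (.reg 17))) <|
  .seq (.assign 15 (.add (.reg 12) (.load A (.reg 17))))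
    (pushProg b)

/-- One step of the search. -/
def stepProg (a₁ a₂ A b : ℕ) : Prog :=
  .branch (.load 4 (.reg 12))
    (.seq (.assign 17 (.load 6 (.load 4 (.reg 12)))) <|
     .seq (.store 4 (.reg 12) (.load 5 (.load 4 (.reg 12)))) <|
     .branch (.load 3 (.reg 17)) .skip (settleProg a₁ a₂ A b))
    (.assign 12 (.add (.reg 12) (.const 1)))

/-- The search, after the keys and the buckets have been cleared. -/
def initProg : Prog :=
  .seq (.assign 13 (.const 1)) <|
  .seq (.assign 12 (.const 0)) <|
  .seq (.store 6 (.const 1) (.reg 4)) <|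
  .seq (.store 5 (.const 1) (.const 0))
    (.store 4 (.const 0) (.const 1))

def clearProg (a N : ℕ) : Prog := .forUpto 16 N (.store a (.reg 16) (.const 0))

/-- The search. -/
def searchProg (a₁ a₂ A b : ℕ) : Prog :=
  .seq (clearProg 3 10) <|
  .seq (.assign 18 (.add (.reg 11) (.const 1))) <|
  .seq (clearProg 4 18) <|
  .seq initProg
    (.loop (.sub (.reg 11) (.reg 12)) (stepProg a₁ a₂ A b))

/-- The invariant of the search, where `c` more items may be pushed before the next node is settled,
and `μ` bounds the number of steps. -/
def StepInv (s₁ s₂ A b : ℕ → ℕ) (src N K c μ : ℕ) (P₁ P₂ : ℕ → Prop) (s : State) : Prop :=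
  ∃ B, Buckets K (s.arr 5) (s.arr 6) (s.arr 4) (s.reg 13) B ∧
    SearchInv s₁ s₂ A b src N K (s.arr 3) B (s.reg 12) P₁ P₂ ∧ s.reg 12 ≤ K ∧
    -- One item is made for the source and two for each node that is settled; this bounds the
    -- addresses of items.
    s.reg 13 + 2 * zeros N (s.arr 3) + c ≤ 2 * N + 1 ∧
    -- Settling a node adds two entries, so the weight 3 makes the potential fall when a node is
    -- settled; discarding an entry or going on to the next level also lowers it.
    3 * zeros N (s.arr 3) + entries K B + (K - s.reg 12) + c ≤ μ

theorem add_sub_eq_max (r b : ℕ) : r + (b - r) = max r b := by omega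

variable {W : ℕ} {s₁ s₂ A b : ℕ → ℕ} {src N K : ℕ} {a₁ a₂ aA ab : ℕ}

theorem wp_pushProg {s : State} {j y : ℕ} {Q : State → Prop}
    (hy : s.reg 14 = y) (hj : s.reg 15 = j) (hyW : y < W) (hj2 : max j (s.arr ab y) < W)
    (hmW : s.reg 13 + 1 < W) (hhd : s.arr 4 (max j (s.arr ab y)) ≤ s.reg 13)
    (H : ∀ s' : State, (∀ ρ, ρ ≠ 13 → ρ ≠ 15 → s'.reg ρ = s.reg ρ) → s'.reg 13 = s.reg 13 + 1 →
      (∀ a, a ≠ 4 → a ≠ 5 → a ≠ 6 → s'.arr a = s.arr a) →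
      s'.arr 6 = Function.update (s.arr 6) (s.reg 13 + 1) y →
      s'.arr 5 = Function.update (s.arr 5) (s.reg 13 + 1) (s.arr 4 (max j (s.arr ab y))) →
      s'.arr 4 = Function.update (s.arr 4) (max j (s.arr ab y)) (s.reg 13 + 1) → Q s') :
    wp W (pushProg ab) Q s := by
  have hj3 : j < W ∧ s.arr ab y < W := by omega
  simp only [pushProg, wp, Expr.Fits, Expr.eval, State.setReg_reg, State.setReg_arr, State.setArr_reg,
    State.setArr_arr, hy, hj, add_sub_eq_max]
  refine ⟨⟨by simpa using hj3.1, ⟨⟨by simpa using hyW, by simpa using hj3.2⟩, by simpa using hj3.1⟩, by simpa using hj2⟩, ⟨by simpa using (by omega), by omega, by simpa using hmW⟩,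
    by simpa using hmW, by simpa [hy] using hyW, by simpa using hmW,
    ⟨by simpa using hj2, by simp; omega⟩, by simpa using hj2, by simpa using hmW, ?_⟩
  refine H _ ?_ ?_ ?_ ?_ ?_ ?_
  · intro ρ h1 h2; simp [h1, h2]
  · simp
  · intro a h1 h2 h3; simp [h1, h2, h3]
  · simp
  · simp
  · simp

/-- One unit of `c` pays for the new item, both in the address bound and in the potential. -/
theorem StepInv.push_left {c μ : ℕ} {P₂ : ℕ → Prop} {s s' : State} {x : ℕ}
    (H : StepInv s₁ s₂ A b src N K (c + 1) μ (· = x) P₂ s)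
    (hx : x < N) (hs : s₁ x < N) (hb : b (s₁ x) ≤ K) (hv : s.arr 3 x = s.reg 12 + 1)
    (hr : s'.reg 12 = s.reg 12) (hm : s'.reg 13 = s.reg 13 + 1) (h3 : s'.arr 3 = s.arr 3)
    (h6 : s'.arr 6 = Function.update (s.arr 6) (s.reg 13 + 1) (s₁ x))
    (h5 : s'.arr 5 = Function.update (s.arr 5) (s.reg 13 + 1)
      (s.arr 4 (max (s.reg 12) (b (s₁ x)))))
    (h4 : s'.arr 4 = Function.update (s.arr 4) (max (s.reg 12) (b (s₁ x))) (s.reg 13 + 1)) :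
    StepInv s₁ s₂ A b src N K c μ (fun _ => False) P₂ s' := by
  obtain ⟨B, h1, h2, hrK, hm', hμ⟩ := H
  have hj : max (s.reg 12) (b (s₁ x)) ≤ K := by omega
  have he := entries_update B hj (s₁ x :: B (max (s.reg 12) (b (s₁ x))))
  simp only [List.length_cons] at he
  refine ⟨Function.update B (max (s.reg 12) (b (s₁ x))) (s₁ x :: B (max (s.reg 12) (b (s₁ x)))),
    ?_, ?_, by omega, by rw [hm, h3]; omega, ?_⟩
  · rw [h4, h5, h6, hm]; exact h1.push hj _
  · rw [h3, hr]; exact h2.pushLeft hx hs hv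
  · rw [h3, hr]; omega

theorem StepInv.push_right {c μ : ℕ} {P₁ : ℕ → Prop} {s s' : State} {x : ℕ}
    (H : StepInv s₁ s₂ A b src N K (c + 1) μ P₁ (· = x) s)
    (hx : x < N) (hs : s₂ x < N) (hb : b (s₂ x) ≤ K) (hA : s.reg 12 + A x ≤ K)
    (hv : s.arr 3 x = s.reg 12 + 1)
    (hr : s'.reg 12 = s.reg 12) (hm : s'.reg 13 = s.reg 13 + 1) (h3 : s'.arr 3 = s.arr 3)
    (h6 : s'.arr 6 = Function.update (s.arr 6) (s.reg 13 + 1) (s₂ x))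
    (h5 : s'.arr 5 = Function.update (s.arr 5) (s.reg 13 + 1)
      (s.arr 4 (max (s.reg 12 + A x) (b (s₂ x)))))
    (h4 : s'.arr 4 = Function.update (s.arr 4) (max (s.reg 12 + A x) (b (s₂ x))) (s.reg 13 + 1)) :
    StepInv s₁ s₂ A b src N K c μ P₁ (fun _ => False) s' := by
  obtain ⟨B, h1, h2, hrK, hm', hμ⟩ := H
  have hj : max (s.reg 12 + A x) (b (s₂ x)) ≤ K := by omega
  have he := entries_update B hj (s₂ x :: B (max (s.reg 12 + A x) (b (s₂ x))))
  simp only [List.length_cons] at he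
  refine ⟨Function.update B (max (s.reg 12 + A x) (b (s₂ x)))
    (s₂ x :: B (max (s.reg 12 + A x) (b (s₂ x)))), ?_, ?_, by omega, by rw [hm, h3]; omega, ?_⟩
  · rw [h4, h5, h6, hm]; exact h1.push hj _
  · rw [h3, hr]; exact h2.pushRight hx hs hv
  · rw [h3, hr]; omega

/-- The graph on which the search runs is in the memory. -/
structure GraphIn (W : ℕ) (s₁ s₂ A b : ℕ → ℕ) (N K a₁ a₂ aA ab : ℕ) (s : State) : Prop where
  reg_N : s.reg 10 = N
  reg_K : s.reg 11 = K
  arr₁ : s.arr a₁ = s₁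
  arr₂ : s.arr a₂ = s₂
  arrA : s.arr aA = A
  arrb : s.arr ab = b
  s₁_lt : ∀ x < N, s₁ x < N
  s₂_lt : ∀ x < N, s₂ x < N
  A_le : ∀ x < N, A x ≤ 1
  b_le : ∀ x < N, b x ≤ K
  word : 2 * N + K + 5 < W
  ha₁ : 10 ≤ a₁
  ha₂ : 10 ≤ a₂
  haA : 10 ≤ aA
  hab : 10 ≤ ab

/-- The hypothesis `hI` anticipates the key that is about to be stored, with both arcs of `x` still
to be followed. The drop of `zeros` by one pays for the two pushes and leaves one unit of the
potential. -/
theorem wp_settleProg {s : State} {x μ : ℕ} (G : GraphIn W s₁ s₂ A b N K a₁ a₂ aA ab s)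
    (hxr : s.reg 17 = x) (hx : x < N) (hr : s.reg 12 < K) (hv : s.arr 3 x = 0)
    {B : ℕ → List ℕ}
    (hB : Buckets K (s.arr 5) (s.arr 6) (s.arr 4) (s.reg 13) B)
    (hI : SearchInv s₁ s₂ A b src N K (Function.update (s.arr 3) x (s.reg 12 + 1)) B (s.reg 12)
      (· = x) (· = x))
    (hm : s.reg 13 + 2 * zeros N (s.arr 3) ≤ 2 * N + 1)
    (hμ : 3 * zeros N (s.arr 3) + entries K B + (K - s.reg 12) ≤ μ) :
    wp W (settleProg a₁ a₂ aA ab)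
      (fun s' => StepInv s₁ s₂ A b src N K 0 (μ - 1) (fun _ => False) (fun _ => False) s') s := by
  have hW := G.word
  have hz := zeros_update (v := s.reg 12 + 1) hx hv (by omega)
  have hs₁ := G.s₁_lt x hx
  have hs₂ := G.s₂_lt x hx
  have hA := G.A_le x hx
  have hb₁ := G.b_le _ hs₁
  have hb₂ := G.b_le _ hs₂
  have ha₁ := G.ha₁
  have ha₂ := G.ha₂
  have haA := G.haA
  have hab := G.hab
  have n1 : a₁ ≠ 3 := by omega
  have n2 : a₂ ≠ 3 := by omega
  have n3 : aA ≠ 3 := by omega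
  have n4 : ab ≠ 3 := by omega
  set s1 := ((s.setArr 3 x (s.reg 12 + 1)).setReg 14 (s₁ x)).setReg 15 (s.reg 12) with hs1
  have key : wp W (pushProg ab) (wp W (.seq (.assign 14 (.load a₂ (.reg 17))) <|
      .seq (.assign 15 (.add (.reg 12) (.load aA (.reg 17)))) (pushProg ab))
      (fun s' => StepInv s₁ s₂ A b src N K 0 (μ - 1) (fun _ => False) (fun _ => False) s')) s1 := by
    have i1 : StepInv s₁ s₂ A b src N K 2 (μ - 1) (· = x) (· = x) s1 := by
      refine ⟨B, by simpa [hs1] using hB, by simpa [hs1] using hI, by simp [hs1]; omega, ?_, ?_⟩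
      · simp [hs1]; omega
      · simp [hs1]; omega
    have e1 : s1.arr ab = b := by simp [hs1, n4, G.arrb]
    refine wp_pushProg (j := s.reg 12) (y := s₁ x) (by simp [hs1]) (by simp [hs1]) (by omega)
      (by rw [e1]; omega) (by simp [hs1]; omega) ?_ ?_
    · rw [e1]; simpa [hs1] using (hB _ (show max (s.reg 12) (b (s₁ x)) ≤ K by omega)).le
    · rw [e1]
      intro s' f1 f2 f3 f4 f5 f6
      have i2 : StepInv s₁ s₂ A b src N K 1 (μ - 1) (fun _ => False) (· = x) s' :=
        i1.push_left hx hs₁ hb₁ (by simp [hs1]) (f1 _ (by simp) (by simp)) f2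
          (f3 _ (by simp) (by simp) (by simp)) f4 (by simpa [hs1] using f5) (by simpa [hs1] using f6)
      have g12 : s'.reg 12 = s.reg 12 := by rw [f1 _ (by simp) (by simp)]; simp [hs1]
      have g17 : s'.reg 17 = x := by rw [f1 _ (by simp) (by simp)]; simp [hs1, hxr]
      have e2 : s'.arr a₂ = s₂ := by
        rw [f3 _ (by omega) (by omega) (by omega)]; simp [hs1, n2, G.arr₂]
      have eA : s'.arr aA = A := by
        rw [f3 _ (by omega) (by omega) (by omega)]; simp [hs1, n3, G.arrA]
      have eb : s'.arr ab = b := by rw [f3 _ (by omega) (by omega) (by omega), e1]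
      have e3 : s'.arr 3 x = s.reg 12 + 1 := by
        rw [f3 _ (by omega) (by omega) (by omega)]; simp [hs1]
      refine ⟨⟨by simp [Expr.Fits, g17]; omega, by simp [Expr.eval, g17, e2]; omega⟩,
        ⟨by simp [Expr.Fits, g12]; omega, ⟨by simp [Expr.Fits, g17]; omega, ?_⟩, ?_⟩, ?_⟩
      · simp [Expr.eval, g17, eA]; omega
      · simp [Expr.eval, g12, g17, eA]; omega
      simp only [Expr.eval, State.setReg_reg, State.setReg_arr, g17, g12, e2, eA]
      norm_num only [if_true, if_false, g12, g17, eA]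
      set s2 := (s'.setReg 14 (s₂ x)).setReg 15 (s.reg 12 + A x) with hs2
      have i2c := i2
      obtain ⟨B', h1, -, -, hm', -⟩ := i2c
      have e4 : s2.arr ab = b := by simp [hs2, eb]
      refine wp_pushProg (j := s.reg 12 + A x) (y := s₂ x) (by simp [hs2]) (by simp [hs2])
        (by omega) (by rw [e4]; omega) (by simp [hs2]; omega) ?_ ?_
      · rw [e4]; simpa [hs2] using (h1 _ (show max (s.reg 12 + A x) (b (s₂ x)) ≤ K by omega)).le
      · rw [e4]
        intro s'' f1 f2 f3 f4 f5 f6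
        have i2' : StepInv s₁ s₂ A b src N K 1 (μ - 1) (fun _ => False) (· = x) s2 := by
          simpa [StepInv, hs2] using i2
        refine i2'.push_right hx hs₂ hb₂ (by simp [hs2, g12]; omega) (by simp [hs2, g12, e3])
          (f1 _ (by simp) (by simp)) f2 (f3 _ (by simp) (by simp) (by simp)) f4 ?_ ?_
        · simpa [hs2, g12] using f5
        · simpa [hs2, g12] using f6
  have hm2 : s.reg 13 < W := by omega
  simp only [settleProg, wp, Expr.Fits, Expr.eval, State.setReg_reg, State.setReg_arr, State.setArr_reg,
    State.setArr_arr, hxr]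
  norm_num only [n1, if_true, if_false, G.arr₁]
  refine ⟨?_, ?_, ⟨?_, ?_⟩, ?_, ?_⟩
  iterate 5 all_goals first | omega | skip
  exact key

end RAM

/-! ### Correctness and running time of the search -/

namespace RAM

variable {W : ℕ} {s₁ s₂ A b : ℕ → ℕ} {src N K : ℕ} {a₁ a₂ aA ab : ℕ}

theorem Tot.stepProg {s : State} {μ : ℕ} (G : GraphIn W s₁ s₂ A b N K a₁ a₂ aA ab s)
    (hr : s.reg 12 < K)
    (H : StepInv s₁ s₂ A b src N K 0 μ (fun _ => False) (fun _ => False) s) :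
    Tot W (stepProg a₁ a₂ aA ab) s (stepProg a₁ a₂ aA ab).bound fun s' =>
      ∃ μ' < μ, StepInv s₁ s₂ A b src N K 0 μ' (fun _ => False) (fun _ => False) s' := by
  refine Tot.of_wp ?_
  obtain ⟨B, h1, h2, h3, h4, h5⟩ := H
  have hW := G.word
  have hhd := (h1 _ hr.le).le
  refine ⟨?_, fun he => ?_, fun he => ?_⟩
  · simp only [Expr.Fits, Expr.eval]; omega
  · simp only [Expr.eval] at he
    obtain ⟨L, hL, hB⟩ := h1.pop hr.le he
    have hc := hB _ hr.le
    rw [Function.update_self, Function.update_self] at hc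
    set h := s.arr 4 (s.reg 12) with hh
    set x := s.arr 6 h with hx
    obtain ⟨hxN, hxD⟩ := h2.bucket _ hr.le x (by simp [hL])
    have hnx : s.arr 5 h ≤ s.reg 13 := hc.le
    have hnx' : s.arr 5 (s.arr 4 (s.reg 12)) ≤ s.reg 13 := hc.le
    have hent := entries_update B hr.le L
    rw [hL, List.length_cons] at hent
    simp only [wp, Expr.Fits, Expr.eval, State.setReg_reg, State.setReg_arr, State.setArr_reg,
      State.setArr_arr, ← hh, ← hx]
    norm_num only [if_true, if_false]
    refine ⟨by omega, by omega, by omega, ⟨by omega, ?_⟩, fun hv => ?_, fun hv => ?_⟩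
    · by_cases hv : s.arr 3 x = 0
      · omega
      · have := (h2.sound x hxN hv).2.1; omega
    · refine ⟨μ - 1, by omega, Function.update B (s.reg 12) L, by simpa using hB,
        by simpa using h2.pop hr.le hL hv, by simpa using h3, by simpa using h4, by simp; omega⟩
    · set t := (s.setReg 17 x).setArr 4 (s.reg 12) (s.arr 5 h) with ht
      have G' : GraphIn W s₁ s₂ A b N K a₁ a₂ aA ab t := by
        have n1 : a₁ ≠ 4 := by have := G.ha₁; omega
        have n2 : a₂ ≠ 4 := by have := G.ha₂; omega
        have n3 : aA ≠ 4 := by have := G.haA; omega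
        have n4 : ab ≠ 4 := by have := G.hab; omega
        exact { G with
          reg_N := by simp [ht, G.reg_N]
          reg_K := by simp [ht, G.reg_K]
          arr₁ := by simp [ht, n1, G.arr₁]
          arr₂ := by simp [ht, n2, G.arr₂]
          arrA := by simp [ht, n3, G.arrA]
          arrb := by simp [ht, n4, G.arrb] }
      -- The node is settled while its entry is still in the bucket; afterwards the entry is removed
      -- as that of a reached node.
      have h2' := (h2.settle hr (by simp [hL]) hv).pop (L := L) hr.le hL (by simp)
      have hwp := wp_settleProg (src := src) (s := t) (x := x) (μ := μ - 1)
        (B := Function.update B (s.reg 12) L) G' (by simp [ht]) hxN (by simpa [ht] using hr)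
        (by simpa [ht] using hv) (by simpa [ht] using hB) (by simpa [ht] using h2')
        (by simpa [ht] using h4) (by simp [ht]; omega)
      exact wp_mono (fun s' hs' => ⟨_, by omega, hs'⟩) hwp
  · simp only [Expr.eval] at he
    have hB : B (s.reg 12) = [] := by
      have := h1 _ hr.le
      rw [he] at this
      cases hB : B (s.reg 12) with
      | nil => rfl
      | cons y L => rw [hB] at this; exact absurd rfl this.1
    refine ⟨⟨by simp only [Expr.Fits]; omega, by simp only [Expr.Fits]; omega,
      by simp only [Expr.eval]; omega⟩, μ - 1, by omega, B, by simpa [Expr.eval] using h1,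
      by simpa [Expr.eval] using h2.advance hB, by simp [Expr.eval]; omega,
      by simpa [Expr.eval] using h4, by simp [Expr.eval]; omega⟩

theorem Tot.clearProg {a M : ℕ} {s : State} (hM : M ≠ 16) (hW : s.reg M + 1 < W) :
    Tot W (clearProg a M) s (15 * (s.reg M + 1)) fun s' => ∀ x < s.reg M, s'.arr a x = 0 := by
  refine (Tot.forUpto (B := 3) (I := fun j s' => ∀ x < j, s'.arr a x = 0) hM (by simp [Prog.writesReg])
    (by simp [Prog.writesReg]) hW (by simp) ?_).mono (by omega) (fun s' h => h)
  intro j s' _ hj hjM hI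
  refine Tot.of_wp (p := .store a (.reg 16) (.const 0)) ⟨?_, ?_, ?_⟩
  · simp [Expr.Fits, hj]; omega
  · simp [Expr.Fits]; omega
  · intro x hx
    simp only [Expr.eval, State.setReg_arr, State.setArr_arr, if_true, hj, Function.update_apply]
    split_ifs with h
    · rfl
    · exact hI x (by omega)

theorem GraphIn.congr {s s' : State} (G : GraphIn W s₁ s₂ A b N K a₁ a₂ aA ab s)
    (h10 : s'.reg 10 = s.reg 10) (h11 : s'.reg 11 = s.reg 11)
    (ha : ∀ a, 10 ≤ a → s'.arr a = s.arr a) : GraphIn W s₁ s₂ A b N K a₁ a₂ aA ab s' :=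
  { G with
    reg_N := h10.trans G.reg_N
    reg_K := h11.trans G.reg_K
    arr₁ := (ha _ G.ha₁).trans G.arr₁
    arr₂ := (ha _ G.ha₂).trans G.arr₂
    arrA := (ha _ G.haA).trans G.arrA
    arrb := (ha _ G.hab).trans G.arrb }

/-- The search computes, increased by `1`, the least keys of all nodes for which these are less
than `K`. -/
theorem Tot.searchProg {s : State} (G : GraphIn W s₁ s₂ A b N K a₁ a₂ aA ab s)
    (hsrc : s.reg 4 = src) (hsN : src < N) :
    Tot W (searchProg a₁ a₂ aA ab) s (1000 * (N + K + 1)) fun s' =>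
      (∀ x < N, s'.arr 3 x ≤ K) ∧
      (∀ x < N, s'.arr 3 x ≠ 0 → Deriv s₁ s₂ A b src (s'.arr 3 x - 1) x) ∧
      ∀ d x, Deriv s₁ s₂ A b src d x → d < K → x < N ∧ s'.arr 3 x ≠ 0 ∧ s'.arr 3 x ≤ d + 1 := by
  have hW := G.word
  have hN := G.reg_N
  have hK := G.reg_K
  refine (Tot.seq (Tot.clearProg (a := 3) (M := 10) (by simp) (by omega)).frame
    (T₂ := 4 + (15 * (K + 2) + (13 + (3 * N + 2 + K) * (4 + (RAM.stepProg a₁ a₂ aA ab).bound)))) ?_).mono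
    ?_ (fun s' h => h)
  rotate_left
  · rw [hN, show (RAM.stepProg a₁ a₂ aA ab).bound = 80 from rfl]
    omega
  rintro t1 ⟨c1, g1⟩
  have G1 : GraphIn W s₁ s₂ A b N K a₁ a₂ aA ab t1 :=
    G.congr (g1.reg _ (by simp [RAM.clearProg, Prog.forUpto, Prog.writesReg]))
      (g1.reg _ (by simp [RAM.clearProg, Prog.forUpto, Prog.writesReg]))
      (fun a ha => g1.arr _ (by simp [RAM.clearProg, Prog.forUpto, Prog.writesArr]; omega))
  have r4 : t1.reg 4 = src :=
    (g1.reg _ (by simp [RAM.clearProg, Prog.forUpto, Prog.writesReg])).trans hsrc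
  rw [hN] at c1
  -- There are `K + 1` buckets: from a level below `K`, an arc of cost at most 1 may still lead into
  -- bucket `K`, which is never processed.
  refine Tot.seq (T₁ := 4) (R := fun s' => s' = t1.setReg 18 (K + 1)) (Tot.of_wp
    (p := .assign 18 (.add (.reg 11) (.const 1))) ⟨?_, ?_⟩) ?_
  · simp [Expr.Fits, Expr.eval, G1.reg_K]; omega
  · simp [Expr.eval, G1.reg_K]
  rintro t2 rfl
  set t2 := t1.setReg 18 (K + 1) with ht2
  have t218 : t2.reg 18 = K + 1 := by simp [ht2]
  refine Tot.seq (T₁ := 15 * (K + 2)) ((Tot.clearProg (a := 4) (M := 18) (s := t2) (by simp)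
    (by omega)).frame.mono (by omega) (fun _ h => h)) ?_
  rintro t3 ⟨c3, g3⟩
  rw [t218] at c3
  have G3 : GraphIn W s₁ s₂ A b N K a₁ a₂ aA ab t3 :=
    G1.congr ((g3.reg _ (by simp [RAM.clearProg, Prog.forUpto, Prog.writesReg])).trans
        (by simp [ht2]))
      ((g3.reg _ (by simp [RAM.clearProg, Prog.forUpto, Prog.writesReg])).trans (by simp [ht2]))
      (fun a ha => g3.arr _ (by simp [RAM.clearProg, Prog.forUpto, Prog.writesArr]; omega))
  have r43 : t3.reg 4 = src :=
    (g3.reg _ (by simp [RAM.clearProg, Prog.forUpto, Prog.writesReg])).trans (by simp [ht2, r4])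
  have c13 : ∀ x < N, t3.arr 3 x = 0 := by
    intro x hx
    rw [g3.arr _ (by simp [RAM.clearProg, Prog.forUpto, Prog.writesArr])]
    exact c1 x hx
  have hz : zeros N (t3.arr 3) = N := by
    rw [zeros, Finset.filter_true_of_mem (by simpa using c13), Finset.card_range]
  refine Tot.seq (T₁ := 13) (R := fun s' => GraphIn W s₁ s₂ A b N K a₁ a₂ aA ab s' ∧
    StepInv s₁ s₂ A b src N K 0 (3 * N + 1 + K) (fun _ => False) (fun _ => False) s')
    (Tot.of_wp (p := initProg) ?_) ?_
  · simp only [initProg, wp, Expr.Fits, Expr.eval, State.setReg_reg, r43]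
    norm_num only [if_true, if_false]
    refine ⟨by omega, by omega, by omega, by omega, by omega, by omega, by omega, by omega,
      G3.congr (by simp) (by simp) ?_, Function.update (fun _ => []) 0 [src], ?_, ?_, ?_, ?_, ?_⟩
    · intro a ha
      have h4 : a ≠ 4 := by omega
      have h5 : a ≠ 5 := by omega
      have h6 : a ≠ 6 := by omega
      simp [h4, h5, h6]
    · intro j hj
      by_cases h : j = 0
      · subst h; simp [Chain]
      · simp [h, Chain, c3 j (by omega)]
    · refine ⟨fun x hx h => ?_, fun j hj y hy => ?_, fun j hj => ?_, fun x hx h => ?_,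
        fun x hx h => ?_, .inr (by simp)⟩
      · simp [c13 x hx] at h
      · by_cases h : j = 0
        · subst h
          simp at hy
          subst hy
          exact ⟨hsN, .src⟩
        · simp [h] at hy
      · simp at hj
      · simp [c13 x hx] at h
      · simp [c13 x hx] at h
    · simp
    · simp [hz]; omega
    · have := entries_update (K := K) (fun _ => []) (Nat.zero_le K) [src]
      simp [entries] at this
      simp [hz, entries, this]
  rintro t4 ⟨G4, I4⟩
  refine (Tot.loop (s₀ := t4) (e := .sub (.reg 11) (.reg 12)) (p := RAM.stepProg a₁ a₂ aA ab)
    (I := fun μ s => StepInv s₁ s₂ A b src N K 0 μ (fun _ => False) (fun _ => False) s) ?_ I4).mono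
    (by simp only [Expr.cost]; rw [show 3 * N + 1 + K + 1 = 3 * N + 2 + K by ring]) ?_
  · intro μ s ha hI
    have hG : GraphIn W s₁ s₂ A b N K a₁ a₂ aA ab s :=
      G4.congr (ha.reg _ (by simp [RAM.stepProg, settleProg, pushProg, Prog.writesReg]))
        (ha.reg _ (by simp [RAM.stepProg, settleProg, pushProg, Prog.writesReg]))
        (fun a h => ha.arr _ (by simp [RAM.stepProg, settleProg, pushProg, Prog.writesArr]; omega))
    refine ⟨⟨?_, ?_⟩, fun he => Tot.stepProg hG ?_ hI⟩
    · simp only [Expr.Fits, hG.reg_K]; omega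
    · obtain ⟨-, -, -, h, -⟩ := hI
      simp only [Expr.Fits]; omega
    · simp only [Expr.eval, hG.reg_K] at he; omega
  · rintro s' ⟨he, ha, μ, B, -, h2, h3, -, -⟩
    have hK' : s'.reg 11 = K :=
      (ha.reg _ (by simp [RAM.stepProg, settleProg, pushProg, Prog.writesReg])).trans G4.reg_K
    simp only [Expr.eval, hK'] at he
    have h12 : s'.reg 12 = K := by omega
    rw [h12] at h2
    refine ⟨fun x hx => ?_, fun x hx h => (h2.sound x hx h).2.2,
      fun d x hd hdK => h2.final hsN G.s₁_lt G.s₂_lt hd hdK⟩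
    by_cases h : s'.arr 3 x = 0
    · omega
    · exact (h2.sound x hx h).2.1

end RAM

namespace EmbeddedGraph

variable {V X D : Type} (E : EmbeddedGraph V X D)

/-! ## The number of darts -/

theorem tail_rot (d : D) : E.tail (E.rot d) = E.tail d :=
  (E.tail_eq_iff _ _).2 (Equiv.Perm.sameCycle_apply_left.2 (Equiv.Perm.SameCycle.refl _ _))

theorem faceOf_rot_rev (d : D) : E.faceOf (E.rot (E.rev d)) = E.faceOf d :=
  Quotient.sound (s := Equiv.Perm.SameCycle.setoid (E.rot * E.rev))
    (Equiv.Perm.sameCycle_apply_left (f := E.rot * E.rev) |>.2 (Equiv.Perm.SameCycle.refl _ _))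

theorem start_unique {v : V} {d d' : D} (h : E.tail d = Sum.inl v) (h' : E.tail d' = Sum.inl v)
    (hp : E.parent d = E.parent d') : d = d' := by
  refine (E.existsUnique_start (E.parent d)).unique ⟨?_, rfl⟩ ⟨?_, hp.symm⟩
  · rw [E.parent_fst v d h, h]
  · rw [E.parent_fst v d h, h']

/-- A dart that starts at a crossing, or is the only one that starts at its vertex. -/
def Special (d : D) : Prop := (∃ x, E.tail d = Sum.inr x) ∨ ∃ v, E.tail d = Sum.inl v ∧ E.rot d = d

/-- Each crossing has four darts, and a dart fixed by the rotation is alone at its vertex. -/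
theorem card_special_le {n q k : ℕ} (E : EmbeddedGraph (Fin n) (Fin q) (Fin k)) [DecidablePred E.Special] :
    (Finset.univ.filter E.Special).card ≤ 4 * q + n := by
  classical
  have h1 : (Finset.univ.filter fun d => ∃ x, E.tail d = Sum.inr x).card ≤ 4 * q := by
    have : (Finset.univ.filter fun d => ∃ x, E.tail d = Sum.inr x) ⊆
        Finset.univ.biUnion fun x : Fin q =>
          (Finset.range 4).image fun i => (E.rot ^ i) (E.exists_dart x).choose := by
      intro d hd
      simp only [Finset.mem_filter, Finset.mem_univ, true_and] at hd
      obtain ⟨x, hx⟩ := hd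
      have hc := (E.exists_dart x).choose_spec
      set c := (E.exists_dart x).choose with hc'
      simp only [Finset.mem_biUnion, Finset.mem_univ, true_and]
      refine ⟨x, ?_⟩
      obtain ⟨i, hi⟩ : ∃ i : ℕ, (E.rot ^ i) c = d := by
        obtain ⟨i, -, hi⟩ := ((E.tail_eq_iff c d).1 (by rw [hc, hx])).exists_pow_eq'
        exact ⟨i, hi⟩
      have h4 := (E.four_darts x c hc).1
      rw [Finset.mem_image]
      refine ⟨i % 4, by simp [Nat.mod_lt], ?_⟩
      rw [← hc', ← hi]
      conv_rhs => rw [← Nat.mod_add_div i 4, pow_add, pow_mul, Equiv.Perm.mul_apply]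
      congr 1
      have : ∀ m : ℕ, ((E.rot ^ 4) ^ m) c = c := by
        intro m
        induction m with
        | zero => rfl
        | succ m ih => rw [pow_succ, Equiv.Perm.mul_apply, h4, ih]
      exact (this _).symm
    refine (Finset.card_le_card this).trans (Finset.card_biUnion_le.trans ?_)
    refine (Finset.sum_le_card_nsmul _ _ 4 fun x _ => Finset.card_image_le.trans (by simp)).trans ?_
    simp [mul_comm]
  have h2 : (Finset.univ.filter fun d => ∃ v, E.tail d = Sum.inl v ∧ E.rot d = d).card ≤ n := by
    refine (Finset.card_le_card_of_injOn (t := (Finset.univ : Finset (Fin n)).image Sum.inl) E.tail ?_ ?_).trans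
      (Finset.card_image_le.trans (by simp))
    · intro d hd
      simp only [Finset.coe_filter, Finset.mem_univ, true_and, Set.mem_ofPred_eq] at hd
      obtain ⟨v, hv, -⟩ := hd
      simp [hv]
    · intro d hd d' hd' h
      simp only [Finset.coe_filter, Finset.mem_univ, true_and, Set.mem_ofPred_eq] at hd
      obtain ⟨v, hv, hr⟩ := hd
      obtain ⟨i, hi⟩ := (E.tail_eq_iff _ _).1 h
      rw [← hi]
      exact (Equiv.Perm.zpow_apply_eq_self_of_apply_eq_self hr i).symm
  have : Finset.univ.filter E.Special ⊆ (Finset.univ.filter fun d => ∃ x, E.tail d = Sum.inr x) ∪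
      (Finset.univ.filter fun d => ∃ v, E.tail d = Sum.inl v ∧ E.rot d = d) := by
    intro d hd
    simpa [Special] using hd
  exact (Finset.card_le_card this).trans ((Finset.card_union_le _ _).trans (by omega))

/-- A face without special darts is bounded by uncrossed edges of a simple graph. Its length is not
1, since there are no loops. If its length were 2, its second dart and `rev d` would start at the
same vertex and belong to the same edge, since there are no parallel edges. They would coincide, and
the second dart would be fixed by the rotation. -/
theorem special_or_three (d : D) :
    (∃ d', E.faceOf d' = E.faceOf d ∧ E.Special d') ∨
      ∃ d₁ d₂, E.faceOf d₁ = E.faceOf d ∧ E.faceOf d₂ = E.faceOf d ∧ d ≠ d₁ ∧ d ≠ d₂ ∧ d₁ ≠ d₂ := by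
  by_cases hS : ∃ d', E.faceOf d' = E.faceOf d ∧ E.Special d'
  · exact .inl hS
  right
  push Not at hS
  have hV : ∀ d', E.faceOf d' = E.faceOf d → ∃ v, E.tail d' = Sum.inl v := by
    intro d' h
    cases ht : E.tail d' with
    | inl v => exact ⟨v, rfl⟩
    | inr x => exact absurd (.inl ⟨x, ht⟩) (hS d' h)
  have hne : ∀ d', E.faceOf d' = E.faceOf d → E.rot (E.rev d') ≠ d' := by
    intro d' h he
    obtain ⟨v, hv⟩ := hV d' h
    have h1 : E.tail (E.rev d') = Sum.inl v := by rw [← hv, ← E.tail_rot (E.rev d'), he]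
    have h2 := E.parent_fst v _ h1
    rw [E.parent_rev] at h2
    have h3 := E.parent_fst v _ hv
    exact (E.parent d').adj.ne (h3.trans h2.symm)
  have f1 := E.faceOf_rot_rev d
  have f2 := (E.faceOf_rot_rev (E.rot (E.rev d))).trans f1
  refine ⟨E.rot (E.rev d), E.rot (E.rev (E.rot (E.rev d))), f1, f2, (hne d rfl).symm, ?_,
    (hne _ f1).symm⟩
  intro he
  set d' := E.rot (E.rev d) with hd'
  obtain ⟨u, hu⟩ := hV d rfl
  obtain ⟨v, hv⟩ := hV d' f1
  have h1 : E.tail (E.rev d) = Sum.inl v := by rw [← hv, hd', E.tail_rot]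
  have h2 : E.tail (E.rev d') = Sum.inl u := by rw [← hu]; conv_rhs => rw [he, E.tail_rot]
  have p1 := E.parent_fst _ _ hu
  have p2 := E.parent_fst _ _ hv
  have p3 := E.parent_fst _ _ h1
  have p4 := E.parent_fst _ _ h2
  have hp : E.parent d' = E.parent (E.rev d) := by
    rw [E.parent_rev] at p3 p4 ⊢
    ext
    · exact p2.trans p3.symm
    · exact p4.trans p1.symm
  have hr := E.start_unique hv h1 hp
  exact hS d' f1 (.inr ⟨v, hv, by conv_lhs => rw [hr, ← hd']⟩)

/-- The planarization has linearly many darts. -/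
theorem card_darts_le {n q k : ℕ} (E : EmbeddedGraph (Fin n) (Fin q) (Fin k)) :
    k ≤ 10 * n + 22 * q := by
  classical
  rcases Nat.eq_zero_or_pos k with rfl | hk
  · exact Nat.zero_le _
  have heu := E.euler ⟨⟨0, hk⟩⟩
  have : Fintype E.Face := Fintype.ofFinite _
  -- Each face has at least three darts if its special darts are counted three times. Combined with
  -- Euler's formula this bounds `k`.
  have hF : 3 * Fintype.card E.Face ≤ k + 2 * (4 * q + n) := by
    have h1 : ∀ f : E.Face, 3 ≤ (Finset.univ.filter fun d => E.faceOf d = f).card +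
        2 * ((Finset.univ.filter E.Special).filter fun d => E.faceOf d = f).card := by
      intro f
      obtain ⟨d, rfl⟩ := Quotient.exists_rep f
      change 3 ≤ (Finset.univ.filter fun d' => E.faceOf d' = E.faceOf d).card +
        2 * ((Finset.univ.filter E.Special).filter fun d' => E.faceOf d' = E.faceOf d).card
      have hd : 0 < (Finset.univ.filter fun d' => E.faceOf d' = E.faceOf d).card :=
        Finset.card_pos.2 ⟨d, by simp⟩
      rcases E.special_or_three d with ⟨d', h1, h2⟩ | ⟨d₁, d₂, h1, h2, h3, h4, h5⟩
      · have : 0 < ((Finset.univ.filter E.Special).filter fun d' => E.faceOf d' = E.faceOf d).card :=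
          Finset.card_pos.2 ⟨d', by simp [h1, h2]⟩
        omega
      · have : ({d, d₁, d₂} : Finset (Fin k)).card ≤
            (Finset.univ.filter fun d' => E.faceOf d' = E.faceOf d).card := by
          refine Finset.card_le_card fun x hx => ?_
          simp only [Finset.mem_insert, Finset.mem_singleton] at hx
          rcases hx with rfl | rfl | rfl <;> simp [h1, h2]
        rw [Finset.card_eq_three.2 ⟨d, d₁, d₂, h3, h4, h5, rfl⟩] at this
        omega
    have h2 := Finset.sum_le_sum fun f (_ : f ∈ (Finset.univ : Finset E.Face)) => h1 f
    rw [Finset.sum_add_distrib, ← Finset.mul_sum, Finset.sum_const, Finset.card_univ,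
      ← Finset.card_eq_sum_card_fiberwise (fun _ _ => Finset.mem_coe.2 (Finset.mem_univ _)),
      ← Finset.card_eq_sum_card_fiberwise (fun _ _ => Finset.mem_coe.2 (Finset.mem_univ _)),
      Finset.card_univ, Fintype.card_fin, smul_eq_mul] at h2
    have := E.card_special_le
    omega
  rw [show Nat.card (Quotient (Equiv.Perm.SameCycle.setoid (E.rot * E.rev))) = Fintype.card E.Face
    from Nat.card_eq_fintype_card, Nat.card_fin, Nat.card_fin, Nat.card_fin] at heu
  omega

end EmbeddedGraph

namespace EmbeddedGraph

variable {V X D : Type} (E : EmbeddedGraph V X D)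

/-! ## Edges as walks in the planarization -/

/-- The dart `d` lies on the walk straight ahead from the dart `s`, and all starting points up to
that of `d` lie in `B`. -/
inductive OnWalk (B : Set (V ⊕ X)) (s : D) : D → Prop
  | refl (h : E.tail s ∈ B) : OnWalk B s s
  | step {d : D} {x : X} (h : OnWalk B s d) (hx : E.tail (E.rev d) = Sum.inr x)
      (hB : Sum.inr x ∈ B) : OnWalk B s (E.rot (E.rot (E.rev d)))

variable {E}

theorem OnWalk.tail_mem {B : Set (V ⊕ X)} {s d : D} (h : E.OnWalk B s d) : E.tail d ∈ B := by
  cases h with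
  | refl h => exact h
  | step h hx hB => rwa [E.tail_rot, E.tail_rot, hx]

theorem OnWalk.start_mem {B : Set (V ⊕ X)} {s d : D} (h : E.OnWalk B s d) : E.tail s ∈ B := by
  induction h with
  | refl h => exact h
  | step h hx hB ih => exact ih

theorem OnWalk.parent_eq {B : Set (V ⊕ X)} {s d : D} (h : E.OnWalk B s d) :
    E.parent d = E.parent s := by
  induction h with
  | refl h => rfl
  | step h hx hB ih => rw [E.parent_straight _ _ hx, ih]

/-- A walk straight ahead is continued only at crossings, so it can meet a vertex of `G` only where
it starts. -/
theorem OnWalk.eq_of_tail {B : Set (V ⊕ X)} {s d : D} {v : V} (h : E.OnWalk B s d)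
    (hv : E.tail d = Sum.inl v) : d = s := by
  cases h with
  | refl h => rfl
  | step h hx hB => rw [E.tail_rot, E.tail_rot, hx] at hv; exact absurd hv (by simp)

theorem OnWalk.upgrade {B B' : Set (V ⊕ X)} {s g : D} (h : E.OnWalk B' s g)
    (hB : ∀ g', E.parent g' = E.parent s → E.tail g' ∈ B) : E.OnWalk B s g := by
  induction h with
  | refl h => exact .refl (hB _ rfl)
  | @step d x h hx hB' ih =>
    refine ih.step hx ?_
    have := hB (E.rot (E.rot (E.rev d))) (by rw [E.parent_straight _ _ hx, h.parent_eq])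
    rwa [E.tail_rot, E.tail_rot, hx] at this

/-- The inductive definition extends a walk at its end; here it is taken apart at its beginning. -/
theorem OnWalk.head {B : Set (V ⊕ X)} {d g : D} (h : E.OnWalk B d g) :
    g = d ∨ ∃ x, E.tail (E.rev d) = Sum.inr x ∧ E.OnWalk B (E.rot (E.rot (E.rev d))) g := by
  induction h with
  | refl h => exact .inl rfl
  | @step d' x h hx hB ih =>
    right
    rcases ih with rfl | ⟨y, hy, h'⟩
    · exact ⟨x, hx, .refl (by rwa [E.tail_rot, E.tail_rot, hx])⟩
    · exact ⟨y, hy, h'.step hx hB⟩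

theorem rot_four (E : EmbeddedGraph V X D) {x : X} {d : D} (h : E.tail d = Sum.inr x) :
    E.rot (E.rot (E.rot (E.rot d))) = d := (E.four_darts x d h).1

theorem parent_rot_rot (E : EmbeddedGraph V X D) {x : X} {d : D} (h : E.tail d = Sum.inr x) :
    E.parent (E.rot (E.rot d)) = (E.parent d).symm := by
  have := E.parent_straight x (E.rev d) (by rwa [E.rev_rev])
  rw [E.rev_rev, E.parent_rev] at this
  exact this

/-- Every edge-segment lies on the walk from the first edge-segment of its edge. -/
theorem exists_start (E : EmbeddedGraph V X D) (g : D) :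
    ∃ s v, E.tail s = Sum.inl v ∧ E.parent s = E.parent g ∧ E.OnWalk Set.univ s g := by
  obtain ⟨m, v, hm⟩ := E.arrives (E.rev g)
  induction m generalizing g with
  | zero =>
    rw [Function.iterate_zero, id, E.rev_rev] at hm
    exact ⟨g, v, hm, rfl, .refl trivial⟩
  | succ m ih =>
    cases hg : E.tail g with
    | inl w => exact ⟨g, w, hg, rfl, .refl trivial⟩
    | inr x =>
      rw [Function.iterate_succ_apply, E.rev_rev] at hm
      obtain ⟨s, w, h1, h2, h3⟩ := ih (E.rev (E.rot (E.rot g))) (by rwa [E.rev_rev])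
      have ht : E.tail (E.rev (E.rev (E.rot (E.rot g)))) = Sum.inr x := by
        rw [E.rev_rev, E.tail_rot, E.tail_rot, hg]
      have h4 := h3.step ht trivial
      rw [E.rev_rev, E.rot_four hg] at h4
      exact ⟨s, w, h1, h4.parent_eq.symm, h4⟩

/-- Both darts lie on one walk: either `g` comes no later than the last segments known to be in `B`,
or it lies ahead of `d`. -/
theorem OnWalk.compare {B : Set (V ⊕ X)} {s d g : D} (hd : E.OnWalk B s d)
    (hg : E.OnWalk Set.univ s g) :
    (E.tail g ∈ B ∧ E.tail (E.rev g) ∈ B) ∨ E.OnWalk Set.univ d g := by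
  induction hd with
  | refl h => exact .inr hg
  | @step d x h hx hB ih =>
    rcases ih with h' | h'
    · exact .inl h'
    · rcases h'.head with rfl | ⟨y, -, h''⟩
      · exact .inl ⟨h.tail_mem, by rwa [hx]⟩
      · exact .inr h''

/-- If the walk arrives at a vertex inside `B`, then the whole edge lies in `B`. -/
theorem OnWalk.edgeVerts_subset {B : Set (V ⊕ X)} {s d : D} {v w : V} (hd : E.OnWalk B s d)
    (hv : E.tail s = Sum.inl v) (hw : E.tail (E.rev d) = Sum.inl w) (hB : Sum.inl w ∈ B) :
    E.edgeVerts (E.parent s).edge ⊆ B := by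
  have key : ∀ g, E.parent g = E.parent s → E.tail g ∈ B ∧ E.tail (E.rev g) ∈ B := by
    intro g hg
    obtain ⟨s', v', h1, h2, h3⟩ := E.exists_start g
    -- An edge has only one first segment in each direction, so the walk to `g` also starts with
    -- `s`.
    have hs : s' = s := by
      refine E.start_unique (v := v) ?_ hv (h2.trans hg)
      rw [h1, ← E.parent_fst _ _ h1, ← E.parent_fst _ _ hv, h2, hg]
    subst hs
    rcases hd.compare h3 with h | h
    · exact h
    · rcases h.head with rfl | ⟨y, hy, -⟩
      · exact ⟨hd.tail_mem, by rwa [hw]⟩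
      · rw [hw] at hy; exact absurd hy (by simp)
  rintro z ⟨g, hg, rfl⟩
  rcases SimpleGraph.dart_edge_eq_iff _ _ |>.1 hg with h | h
  · exact (key g h).1
  · have := (key (E.rev g) (by rw [E.parent_rev, h, SimpleGraph.Dart.symm_symm])).2
    rwa [E.rev_rev] at this

/-- The walk from `s'` to `h` is traversed backwards, as a continuation of the walk that arrives
with `rev h`. -/
theorem OnWalk.extend {B : Set (V ⊕ X)} {s s' h : D} (hs : E.OnWalk B s (E.rev h))
    (hh : E.OnWalk B s' h) : ∃ d, E.OnWalk B s d ∧ E.tail (E.rev d) = E.tail s' := by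
  induction hh with
  | refl h => exact ⟨_, hs, by rw [E.rev_rev]⟩
  | @step d x h hx hB ih =>
    refine ih ?_
    have := hs.step (x := x) (by rw [E.rev_rev, E.tail_rot, E.tail_rot, hx]) hB
    rwa [E.rev_rev, E.rot_four hx] at this

/-- The part of an edge up to the starting point of the dart `d` lies in `B`. -/
def Back (E : EmbeddedGraph V X D) (B : Set (V ⊕ X)) (d : D) : Prop :=
  ∃ s v, E.tail s = Sum.inl v ∧ E.OnWalk B s d

/-- The recursion behind `backProg`: the dart `rev (rot (rot d))` is the one before `d` on its edge.
-/
theorem back_crossing {B : Set (V ⊕ X)} {d : D} {x : X} (hd : E.tail d = Sum.inr x) :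
    E.Back B d ↔ E.tail d ∈ B ∧ E.Back B (E.rev (E.rot (E.rot d))) := by
  constructor
  · rintro ⟨s, v, hs, h⟩
    refine ⟨h.tail_mem, s, v, hs, ?_⟩
    cases h with
    | refl h => rw [hs] at hd; exact absurd hd (by simp)
    | step h hx hB => rwa [E.rot_four hx, E.rev_rev]
  · rintro ⟨hB, s, v, hs, h⟩
    refine ⟨s, v, hs, ?_⟩
    have := h.step (x := x) (by rw [E.rev_rev, E.tail_rot, E.tail_rot, hd]) (by rwa [← hd])
    rwa [E.rev_rev, E.rot_four hd] at this

theorem back_vertex {B : Set (V ⊕ X)} {d : D} {v : V} (hd : E.tail d = Sum.inl v) :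
    E.Back B d ↔ E.tail d ∈ B := by
  constructor
  · rintro ⟨s, v, hs, h⟩; exact h.tail_mem
  · exact fun h => ⟨d, v, hd, .refl h⟩

theorem Back.tail_mem {B : Set (V ⊕ X)} {d : D} (h : E.Back B d) : E.tail d ∈ B := by
  obtain ⟨s, v, -, h⟩ := h
  exact h.tail_mem

/-- A passage through a crossing cuts the edge into two pieces. Following the edge back from `d`
covers one piece, and from the opposite dart the other. This remains true if the edge crosses
itself. -/
theorem edgeVerts_subset_iff {B : Set (V ⊕ X)} {d : D} {x : X} (hd : E.tail d = Sum.inr x) :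
    E.edgeVerts (E.parent d).edge ⊆ B ↔ E.Back B d ∧ E.Back B (E.rot (E.rot d)) := by
  constructor
  · intro h
    have key : ∀ d', (E.parent d').edge = (E.parent d).edge → E.Back B d' := by
      intro d' hd'
      obtain ⟨s, v, h1, h2, h3⟩ := E.exists_start d'
      exact ⟨s, v, h1, h3.upgrade fun g hg => h ⟨g, by rw [hg, h2, hd'], rfl⟩⟩
    refine ⟨key _ rfl, key _ ?_⟩
    rw [E.parent_rot_rot hd, SimpleGraph.Dart.edge_symm]
  · rintro ⟨⟨s, v, hs, h⟩, h'⟩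
    obtain ⟨-, s', v', hs', h''⟩ := (back_crossing (by rw [E.tail_rot, E.tail_rot, hd])).1 h'
    rw [E.rot_four hd] at h''
    obtain ⟨g, hg, hgt⟩ := OnWalk.extend (h := E.rev d) (by rwa [E.rev_rev]) h''
    rw [← h.parent_eq.symm]
    exact hg.edgeVerts_subset hs (by rw [hgt, hs']) (by rw [← hs']; exact h''.start_mem)

/-! ## The radial graph -/

theorem radialGraph_adj_inl {z : V ⊕ X} {w : (V ⊕ X) ⊕ E.Face} :
    E.radialGraph.Adj (Sum.inl z) w ↔ ∃ d, z = E.tail d ∧ w = Sum.inr (E.faceOf d) := by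
  rw [radialGraph, SimpleGraph.fromRel_adj]
  constructor
  · rintro ⟨-, ⟨d, h1, h2⟩ | ⟨d, h1, h2⟩⟩
    · exact ⟨d, Sum.inl_injective h1, h2⟩
    · simp at h2
  · rintro ⟨d, rfl, rfl⟩
    exact ⟨by simp, .inl ⟨d, rfl, rfl⟩⟩

theorem radialGraph_adj_inr {f : E.Face} {w : (V ⊕ X) ⊕ E.Face} :
    E.radialGraph.Adj (Sum.inr f) w ↔ ∃ d, f = E.faceOf d ∧ w = Sum.inl (E.tail d) := by
  rw [radialGraph, SimpleGraph.fromRel_adj]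
  constructor
  · rintro ⟨-, ⟨d, h1, h2⟩ | ⟨d, h1, h2⟩⟩
    · simp at h1
    · exact ⟨d, Sum.inr_injective h2, h1⟩
  · rintro ⟨d, rfl, rfl⟩
    exact ⟨by simp, .inr ⟨d, rfl, rfl⟩⟩

/-- The radial graph is bipartite, so every second node of a walk is a face-vertex; the two ends
give the correction. -/
theorem two_mul_countP {a b : (V ⊕ X) ⊕ E.Face} (p : E.radialGraph.Walk a b) :
    2 * p.support.countP (fun z => z.isRight) = p.length + a.isRight.toNat + b.isRight.toNat := by
  induction p with
  | nil => cases h : Sum.isRight _ <;> simp [h]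
  | @cons u v w h p ih =>
    rw [SimpleGraph.Walk.support_cons, List.countP_cons, SimpleGraph.Walk.length_cons, mul_add, ih]
    have : u.isRight.toNat + v.isRight.toNat = 1 := by
      cases u with
      | inl z => obtain ⟨d, -, rfl⟩ := radialGraph_adj_inl.1 h; rfl
      | inr f => obtain ⟨d, -, rfl⟩ := radialGraph_adj_inr.1 h; rfl
    cases u <;> cases v <;> (simp at this ⊢; try omega)

theorem radialGraph_reachable_rev (E : EmbeddedGraph V X D) (d : D) :
    E.radialGraph.Reachable (Sum.inl (E.tail d)) (Sum.inl (E.tail (E.rev d))) := by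
  refine (radialGraph_adj_inl.2 ⟨d, rfl, rfl⟩).reachable.trans ?_
  refine (radialGraph_adj_inr.2 ⟨E.rot (E.rev d), (E.faceOf_rot_rev d).symm, ?_⟩).reachable
  rw [E.tail_rot]

theorem OnWalk.reachable {B : Set (V ⊕ X)} {s d : D} (h : E.OnWalk B s d) :
    E.radialGraph.Reachable (Sum.inl (E.tail s)) (Sum.inl (E.tail d)) := by
  induction h with
  | refl h => exact .refl _
  | @step d x h hx hB ih =>
    rw [E.tail_rot, E.tail_rot]
    exact ih.trans (E.radialGraph_reachable_rev d)

theorem exists_end (E : EmbeddedGraph V X D) (d : D) : ∃ s, E.tail s = Sum.inl (E.parent d).snd ∧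
    E.parent s = (E.parent d).symm ∧ E.OnWalk Set.univ s (E.rev d) := by
  obtain ⟨s, v, h1, h2, h3⟩ := E.exists_start (E.rev d)
  rw [E.parent_rev] at h2
  refine ⟨s, ?_, h2, h3⟩
  rw [h1, ← E.parent_fst _ _ h1, h2]
  rfl

theorem radialGraph_reachable_inl (E : EmbeddedGraph V X D) (u v : V) :
    E.radialGraph.Reachable (Sum.inl (Sum.inl u)) (Sum.inl (Sum.inl v)) := by
  obtain ⟨p⟩ := E.connected.preconnected u v
  induction p with
  | nil => exact .refl _
  | @cons u v w h p ih =>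
    refine SimpleGraph.Reachable.trans ?_ ih
    obtain ⟨s, ⟨h1, h2⟩, -⟩ := E.existsUnique_start ⟨(u, v), h⟩
    obtain ⟨s', h1', -, h3⟩ := E.exists_end s
    have h4 := h3.reachable.trans (E.radialGraph_reachable_rev (E.rev s))
    rw [E.rev_rev, h1', h1, h2] at h4
    exact h4.symm

/-- This excludes the default value 0 of `dist` and of the infimum in `faceDist`. -/
theorem radialGraph_reachable (E : EmbeddedGraph V X D) (a b : V ⊕ X) :
    E.radialGraph.Reachable (Sum.inl a) (Sum.inl b) := by
  have key : ∀ a : V ⊕ X, ∃ v : V, E.radialGraph.Reachable (Sum.inl (Sum.inl v)) (Sum.inl a) := by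
    rintro (v | x)
    · exact ⟨v, .refl _⟩
    · obtain ⟨d, hd⟩ := E.exists_dart x
      obtain ⟨s, v, h1, -, h3⟩ := E.exists_start d
      have := h3.reachable
      rw [h1, hd] at this
      exact ⟨v, this⟩
  obtain ⟨u, hu⟩ := key a
  obtain ⟨v, hv⟩ := key b
  exact hu.symm.trans ((E.radialGraph_reachable_inl u v).trans hv)

theorem two_mul_faceDist (E : EmbeddedGraph V X D) (a b : V ⊕ X) :
    2 * E.faceDist (Sum.inl a) (Sum.inl b) = E.radialGraph.dist (Sum.inl a) (Sum.inl b) := by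
  have key : ∀ k, k ∈ {k | ∃ p : E.radialGraph.Walk (Sum.inl a) (Sum.inl b),
      p.length = E.radialGraph.dist (Sum.inl a) (Sum.inl b) ∧
      p.support.countP (fun z => z.isRight) = k} →
      2 * k = E.radialGraph.dist (Sum.inl a) (Sum.inl b) := by
    rintro k ⟨p, h1, h2⟩
    have := two_mul_countP p
    simp only [Sum.isRight_inl, Bool.toNat_false, add_zero] at this
    rw [← h2, ← h1, this]
  refine key _ (Nat.sInf_mem ?_)
  obtain ⟨p, hp⟩ := (E.radialGraph_reachable a b).exists_walk_length_eq_dist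
  exact ⟨_, p, hp, rfl⟩

theorem faceDist_self (E : EmbeddedGraph V X D) (a : V ⊕ X) :
    E.faceDist (Sum.inl a) (Sum.inl a) = 0 := by
  have := E.two_mul_faceDist a a
  rw [SimpleGraph.dist_self] at this
  omega

theorem faceDist_pos (E : EmbeddedGraph V X D) {a b : V ⊕ X} (h : a ≠ b) :
    0 < E.faceDist (Sum.inl a) (Sum.inl b) := by
  have h1 := E.two_mul_faceDist a b
  have h2 := (E.radialGraph_reachable a b).pos_dist_of_ne (by simpa using h)
  omega

/-- A shortest path repeats no node, and there are at most `k` faces. This bound determines how many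
levels the searches need. -/
theorem faceDist_le {n q k : ℕ} (E : EmbeddedGraph (Fin n) (Fin q) (Fin k)) (a b : Fin n ⊕ Fin q) :
    E.faceDist (Sum.inl a) (Sum.inl b) ≤ n + q + k := by
  classical
  have : Fintype E.Face := Fintype.ofFinite _
  have hF : Fintype.card E.Face ≤ k := by
    simpa using Fintype.card_le_of_surjective (fun d : Fin k => E.faceOf d) Quotient.exists_rep
  have h1 := E.two_mul_faceDist a b
  obtain ⟨p, hp, hl⟩ := (E.radialGraph_reachable a b).exists_path_of_dist
  have := hp.length_lt
  simp only [Fintype.card_sum, Fintype.card_fin] at this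
  omega

end EmbeddedGraph

namespace EmbeddedGraph

open RAM (Deriv)

/-! ## The search in the radial graph -/

/-- The arcs of the search in the radial graph: the node `d` stands for the starting vertex of the
dart `d`, and `k + d` for its face. -/
structure RadialArcs {n q k : ℕ} (E : EmbeddedGraph (Fin n) (Fin q) (Fin k))
    (s₁ s₂ A b : ℕ → ℕ) : Prop where
  s₁_vertex : ∀ d : Fin k, s₁ d = E.rot d
  s₁_face : ∀ d : Fin k, s₁ (k + d) = k + E.rot (E.rev d)
  s₂_vertex : ∀ d : Fin k, s₂ d = k + d
  s₂_face : ∀ d : Fin k, s₂ (k + d) = d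
  A_vertex : ∀ d : Fin k, A d = 1
  A_face : ∀ d : Fin k, A (k + d) = 0
  b_zero : ∀ x, b x = 0

variable {n q k : ℕ} {E : EmbeddedGraph (Fin n) (Fin q) (Fin k)} {s₁ s₂ A b : ℕ → ℕ} {d₀ : Fin k}

/-- First arcs stay at the same vertex or face. Second arcs are steps in the radial graph, and those
into faces cost 1, so a key `r` means `2 * r` steps at a vertex and `2 * r - 1` at a face. -/
theorem RadialArcs.sound (R : E.RadialArcs s₁ s₂ A b) {r x : ℕ} (h : Deriv s₁ s₂ A b d₀ r x) :
    (∃ d : Fin k, x = d ∧ ∃ p : E.radialGraph.Walk (Sum.inl (E.tail d₀)) (Sum.inl (E.tail d)),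
      p.length = 2 * r) ∨
    (∃ d : Fin k, x = k + d ∧ ∃ p : E.radialGraph.Walk (Sum.inl (E.tail d₀)) (Sum.inr (E.faceOf d)),
      p.length + 1 = 2 * r) := by
  induction h with
  | src => exact .inl ⟨d₀, rfl, .nil, rfl⟩
  | @left r x h ih =>
    rw [R.b_zero, Nat.max_zero]
    rcases ih with ⟨d, rfl, p, hp⟩ | ⟨d, rfl, p, hp⟩
    · exact .inl ⟨E.rot d, R.s₁_vertex d, p.copy rfl (by rw [E.tail_rot]), by simpa using hp⟩
    · exact .inr ⟨E.rot (E.rev d), R.s₁_face d, p.copy rfl (by rw [E.faceOf_rot_rev]),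
        by simpa using hp⟩
  | @right r x h ih =>
    rw [R.b_zero, Nat.max_zero]
    rcases ih with ⟨d, rfl, p, hp⟩ | ⟨d, rfl, p, hp⟩
    · refine .inr ⟨d, R.s₂_vertex d, p.concat (radialGraph_adj_inl.2 ⟨d, rfl, rfl⟩), ?_⟩
      rw [SimpleGraph.Walk.length_concat, R.A_vertex, hp]; ring
    · refine .inl ⟨d, R.s₂_face d, p.concat (radialGraph_adj_inr.2 ⟨d, rfl, rfl⟩), ?_⟩
      rw [SimpleGraph.Walk.length_concat, R.A_face, hp]; ring

theorem RadialArcs.vertex (R : E.RadialArcs s₁ s₂ A b) {r : ℕ} {d d' : Fin k}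
    (h : Deriv s₁ s₂ A b d₀ r d) (hd : E.tail d = E.tail d') : Deriv s₁ s₂ A b d₀ r d' := by
  obtain ⟨i, -, rfl⟩ := ((E.tail_eq_iff _ _).1 hd).exists_pow_eq'
  clear hd
  induction i with
  | zero => exact h
  | succ i ih =>
    have := ih.left
    rwa [R.b_zero, Nat.max_zero, R.s₁_vertex, ← Equiv.Perm.mul_apply, ← pow_succ'] at this

theorem RadialArcs.face (R : E.RadialArcs s₁ s₂ A b) {r : ℕ} {d d' : Fin k}
    (h : Deriv s₁ s₂ A b d₀ r (k + d)) (hd : E.faceOf d = E.faceOf d') :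
    Deriv s₁ s₂ A b d₀ r (k + d') := by
  have hd' : (E.rot * E.rev).SameCycle d d' := Quotient.exact hd
  obtain ⟨i, -, rfl⟩ := hd'.exists_pow_eq'
  clear hd hd'
  induction i with
  | zero => exact h
  | succ i ih =>
    have := ih.left
    rw [R.b_zero, Nat.max_zero, R.s₁_face] at this
    rwa [pow_succ', Equiv.Perm.mul_apply, Equiv.Perm.mul_apply]

/-- The walk leads towards the source, so that taking off its first step fits the search, which
extends walks at the far end. -/
theorem RadialArcs.complete (R : E.RadialArcs s₁ s₂ A b) {z w : (Fin n ⊕ Fin q) ⊕ E.Face}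
    (p : E.radialGraph.Walk z w) (hw : w = Sum.inl (E.tail d₀)) :
    (∀ d : Fin k, z = Sum.inl (E.tail d) → ∃ r, 2 * r = p.length ∧ Deriv s₁ s₂ A b d₀ r d) ∧
    (∀ d : Fin k, z = Sum.inr (E.faceOf d) →
      ∃ r, 2 * r = p.length + 1 ∧ Deriv s₁ s₂ A b d₀ r (k + d)) := by
  induction p with
  | nil =>
    subst hw
    refine ⟨fun d hd => ⟨0, rfl, R.vertex .src (Sum.inl_injective hd)⟩, fun d hd => ?_⟩
    simp at hd
  | @cons u v w h p ih =>
    obtain ⟨ih1, ih2⟩ := ih hw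
    constructor
    · rintro d rfl
      obtain ⟨d', hd', hv⟩ := radialGraph_adj_inl.1 h
      obtain ⟨r, hr, hD⟩ := ih2 d' hv
      have := hD.right
      rw [R.b_zero, R.A_face, R.s₂_face, Nat.max_zero] at this
      exact ⟨r, hr, R.vertex this hd'.symm⟩
    · rintro d rfl
      obtain ⟨d', hd', hv⟩ := radialGraph_adj_inr.1 h
      obtain ⟨r, hr, hD⟩ := ih1 d' hv
      have := hD.right
      rw [R.b_zero, R.A_vertex, R.s₂_vertex, Nat.max_zero] at this
      refine ⟨r + 1, ?_, R.face this hd'.symm⟩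
      rw [SimpleGraph.Walk.length_cons]
      omega

/-- The search in the radial graph finds the face-distances. -/
theorem RadialArcs.deriv_faceDist (R : E.RadialArcs s₁ s₂ A b) (d : Fin k) :
    Deriv s₁ s₂ A b d₀ (E.faceDist (Sum.inl (E.tail d₀)) (Sum.inl (E.tail d))) d := by
  obtain ⟨p, hp⟩ := (E.radialGraph_reachable (E.tail d₀) (E.tail d)).exists_walk_length_eq_dist
  obtain ⟨r, hr, hD⟩ := (R.complete (d₀ := d₀) p.reverse rfl).1 d rfl
  have := E.two_mul_faceDist (E.tail d₀) (E.tail d)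
  rw [SimpleGraph.Walk.length_reverse, hp, ← this] at hr
  rwa [← Nat.eq_of_mul_eq_mul_left two_pos hr]

theorem RadialArcs.faceDist_le_of_deriv (R : E.RadialArcs s₁ s₂ A b) {r : ℕ} {d : Fin k}
    (h : Deriv s₁ s₂ A b d₀ r d) : E.faceDist (Sum.inl (E.tail d₀)) (Sum.inl (E.tail d)) ≤ r := by
  have h2 := E.two_mul_faceDist (E.tail d₀) (E.tail d)
  rcases R.sound h with ⟨d', hd, p, hp⟩ | ⟨d', hd, -⟩
  · obtain rfl := Fin.ext hd
    have := SimpleGraph.dist_le p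
    omega
  · have := d.isLt; omega

/-! ## The search for ribbons -/

/-- The arcs of the search for ribbons: at a vertex of `G`, one may proceed to the next dart; along
an edge, one proceeds straight ahead, and turns around when a vertex of `G` is reached. The node `y`
costs its face-distance from `c`. -/
structure RibbonArcs (E : EmbeddedGraph (Fin n) (Fin q) (Fin k)) (c : Fin q)
    (s₁ s₂ A b : ℕ → ℕ) : Prop where
  s₁_vertex : ∀ (d : Fin k) (v : Fin n), E.tail d = Sum.inl v → s₁ d = E.rot d
  s₁_crossing : ∀ (d : Fin k) (x : Fin q), E.tail d = Sum.inr x → s₁ d = d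
  s₂_vertex : ∀ (d : Fin k) (v : Fin n), E.tail (E.rev d) = Sum.inl v → s₂ d = E.rev d
  s₂_crossing : ∀ (d : Fin k) (x : Fin q), E.tail (E.rev d) = Sum.inr x →
    s₂ d = E.rot (E.rot (E.rev d))
  A_zero : ∀ x, A x = 0
  b_eq : ∀ d : Fin k, b d = E.faceDist (Sum.inl (Sum.inr c)) (Sum.inl (E.tail d))

variable {c : Fin q}

/-- The dart is reached by the search at level `r`. -/
def Reached (s₁ s₂ A b : ℕ → ℕ) (d₀ : Fin k) (r : ℕ) (d : Fin k) : Prop :=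
  ∃ r' ≤ r, Deriv s₁ s₂ A b d₀ r' d

theorem RibbonArcs.mem_ball_iff (R : E.RibbonArcs c s₁ s₂ A b) {r : ℕ} {d : Fin k} :
    E.tail d ∈ E.ball (Sum.inr c) r ↔ b d ≤ r := by
  rw [R.b_eq]; rfl

/-- The key is raised to the face-distance at each node, and at the source this distance is 0. -/
theorem RibbonArcs.reached_mem (R : E.RibbonArcs c s₁ s₂ A b) (h₀ : E.tail d₀ = Sum.inr c) {r : ℕ}
    {d : Fin k} (h : Reached s₁ s₂ A b d₀ r d) : E.tail d ∈ E.ball (Sum.inr c) r := by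
  obtain ⟨r', hr, h⟩ := h
  rw [R.mem_ball_iff]
  have : ∀ x, Deriv s₁ s₂ A b d₀ r' x → b x ≤ r' := by
    intro x h
    cases h with
    | src => rw [R.b_eq, h₀, faceDist_self]
    | left h => exact le_max_right _ _
    | right h => exact le_max_right _ _
  exact (this _ h).trans hr

theorem RibbonArcs.reached_ahead (R : E.RibbonArcs c s₁ s₂ A b) {r : ℕ} {d : Fin k}
    (h : Reached s₁ s₂ A b d₀ r d) (hB : E.tail (E.rev d) ∈ E.ball (Sum.inr c) r) :
    (∀ v, E.tail (E.rev d) = Sum.inl v → Reached s₁ s₂ A b d₀ r (E.rev d)) ∧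
    ∀ x, E.tail (E.rev d) = Sum.inr x → Reached s₁ s₂ A b d₀ r (E.rot (E.rot (E.rev d))) := by
  obtain ⟨r', hr, h⟩ := h
  have h' := h.right
  rw [R.A_zero, add_zero] at h'
  constructor
  · intro v hv
    rw [R.s₂_vertex d v hv] at h'
    exact ⟨_, max_le hr (R.mem_ball_iff.1 hB), h'⟩
  · intro v hv
    rw [R.s₂_crossing d v hv] at h'
    refine ⟨_, max_le hr (R.mem_ball_iff.1 ?_), h'⟩
    rwa [E.tail_rot, E.tail_rot]

theorem RibbonArcs.reached_vertex (R : E.RibbonArcs c s₁ s₂ A b) (h₀ : E.tail d₀ = Sum.inr c) {r : ℕ}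
    {d d' : Fin k} {v : Fin n} (h : Reached s₁ s₂ A b d₀ r d) (hd : E.tail d = Sum.inl v)
    (hd' : E.tail d' = Sum.inl v) : Reached s₁ s₂ A b d₀ r d' := by
  obtain ⟨i, -, rfl⟩ := ((E.tail_eq_iff _ _).1 (hd.trans hd'.symm)).exists_pow_eq'
  clear hd'
  induction i with
  | zero => exact h
  | succ i ih =>
    obtain ⟨r', hr, h'⟩ := ih
    have ht : E.tail ((E.rot ^ i) d) = Sum.inl v := by
      rw [← hd]
      exact (E.tail_eq_iff _ _).2 (Equiv.Perm.sameCycle_pow_left.2 (.refl _ _))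
    have h'' := h'.left
    rw [R.s₁_vertex _ v ht] at h''
    rw [pow_succ', Equiv.Perm.mul_apply]
    refine ⟨_, max_le hr (R.mem_ball_iff.1 ?_), h''⟩
    rw [E.tail_rot]
    exact R.reached_mem h₀ ⟨r', hr, h'⟩

/-- As the whole edge lies in the ball, the search gets to its end at the same level and turns
around there, into `s`. -/
theorem RibbonArcs.reached_end (R : E.RibbonArcs c s₁ s₂ A b) {r : ℕ} {d : Fin k}
    (h : Reached s₁ s₂ A b d₀ r d)
    (hB : E.edgeVerts (E.parent d).edge ⊆ E.ball (Sum.inr c) r) :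
    ∃ s v, E.tail s = Sum.inl v ∧ E.parent s = (E.parent d).symm ∧ Reached s₁ s₂ A b d₀ r s := by
  obtain ⟨m, v, hm⟩ := E.arrives d
  induction m generalizing d with
  | zero =>
    rw [Function.iterate_zero, id] at hm
    refine ⟨_, v, hm, E.parent_rev d, (R.reached_ahead h (hB ⟨E.rev d, ?_, rfl⟩)).1 v hm⟩
    rw [E.parent_rev, SimpleGraph.Dart.edge_symm]
  | succ m ih =>
    have h' := R.reached_ahead h (hB ⟨E.rev d, by rw [E.parent_rev, SimpleGraph.Dart.edge_symm], rfl⟩)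
    cases ht : E.tail (E.rev d) with
    | inl w => exact ⟨_, w, ht, E.parent_rev d, h'.1 w ht⟩
    | inr x =>
      rw [Function.iterate_succ_apply] at hm
      have hp := E.parent_straight x d ht
      obtain ⟨s, w, h1, h2, h3⟩ := ih (h'.2 x ht) (by rwa [hp]) hm
      exact ⟨s, w, h1, by rw [h2, hp], h3⟩

theorem RibbonArcs.reached_direction (R : E.RibbonArcs c s₁ s₂ A b) {r : ℕ} {s g : Fin k}
    {v : Fin n} (hs : E.tail s = Sum.inl v) (h : Reached s₁ s₂ A b d₀ r s)
    (hB : E.edgeVerts (E.parent s).edge ⊆ E.ball (Sum.inr c) r) (hg : E.parent g = E.parent s) :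
    Reached s₁ s₂ A b d₀ r g := by
  obtain ⟨s', v', h1, h2, h3⟩ := E.exists_start g
  have hss : s' = s := by
    refine E.start_unique (v := v) ?_ hs (h2.trans hg)
    rw [h1, ← E.parent_fst _ _ h1, ← E.parent_fst _ _ hs, h2, hg]
  subst hss
  clear hg h2
  induction h3 with
  | refl _ => exact h
  | @step d x h' hx _ ih =>
    refine (R.reached_ahead ih (hB ⟨E.rev d, ?_, rfl⟩)).2 x hx
    rw [E.parent_rev, SimpleGraph.Dart.edge_symm, h'.parent_eq]

/-- The search runs to one end of the edge, turns, runs through the whole edge to the other end and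
turns again, so it meets both darts of each segment. -/
theorem RibbonArcs.reached_edge (R : E.RibbonArcs c s₁ s₂ A b) {r : ℕ} {d g : Fin k}
    (h : Reached s₁ s₂ A b d₀ r d)
    (hB : E.edgeVerts (E.parent d).edge ⊆ E.ball (Sum.inr c) r)
    (hg : (E.parent g).edge = (E.parent d).edge) : Reached s₁ s₂ A b d₀ r g := by
  obtain ⟨s, v, h1, h2, h3⟩ := R.reached_end h hB
  have hB' : E.edgeVerts (E.parent s).edge ⊆ E.ball (Sum.inr c) r := by
    rwa [h2, SimpleGraph.Dart.edge_symm]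
  rcases SimpleGraph.dart_edge_eq_iff _ _ |>.1 hg with he | he
  · obtain ⟨s', v', h1', h2', h3'⟩ := R.reached_end h3 hB'
    rw [h2, SimpleGraph.Dart.symm_symm] at h2'
    exact R.reached_direction h1' h3' (by rwa [h2']) (he.trans h2'.symm)
  · exact R.reached_direction h1 h3 hB' (he.trans h2.symm)

/-- At a vertex the search may enter any incident edge, and an edge inside the ball brings it to the
next vertex of the walk without raising the level. -/
theorem RibbonArcs.reached_walk (R : E.RibbonArcs c s₁ s₂ A b) (h₀ : E.tail d₀ = Sum.inr c) {r : ℕ}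
    {u v : Fin n} (p : E.graph.Walk u v)
    (hB : ∀ e ∈ p.edges, E.edgeVerts e ⊆ E.ball (Sum.inr c) r) {d : Fin k}
    (hd : E.tail d = Sum.inl u) (h : Reached s₁ s₂ A b d₀ r d) :
    ∀ g, (E.parent g).edge ∈ p.edges → Reached s₁ s₂ A b d₀ r g := by
  induction p generalizing d with
  | nil => intro g hg; simp at hg
  | @cons u w v hadj p ih =>
    obtain ⟨s, ⟨hs1, hs2⟩, -⟩ := E.existsUnique_start ⟨(u, w), hadj⟩
    have hsR := R.reached_vertex h₀ h hd hs1
    have he : (E.parent s).edge = s(u, w) := by rw [hs2]; rfl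
    have hBs : E.edgeVerts (E.parent s).edge ⊆ E.ball (Sum.inr c) r := by
      rw [he]; exact hB _ (by simp)
    obtain ⟨s', v', h1, h2, h3⟩ := R.reached_end hsR hBs
    have hv' : v' = w := by rw [← E.parent_fst _ _ h1, h2, hs2]; rfl
    subst hv'
    intro g hg
    rw [SimpleGraph.Walk.edges_cons, List.mem_cons] at hg
    rcases hg with hg | hg
    · exact R.reached_edge hsR hBs (hg.trans he.symm)
    · exact ih (fun e h => hB e (by simp [h])) h1 h3 g hg

theorem edge_rot_rot (E : EmbeddedGraph (Fin n) (Fin q) (Fin k)) {d : Fin k} {x : Fin q}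
    (h : E.tail d = Sum.inr x) : (E.parent (E.rot (E.rot d))).edge = (E.parent d).edge := by
  rw [E.parent_rot_rot h, SimpleGraph.Dart.edge_symm]

/-- At a crossing, the darts belong alternatingly to two edges. -/
theorem edges_at_crossing (E : EmbeddedGraph (Fin n) (Fin q) (Fin k)) {d : Fin k}
    (h₀ : E.tail d₀ = Sum.inr c) (h : E.tail d = Sum.inr c) :
    ((E.parent d).edge = (E.parent d₀).edge ∧
      (E.parent (E.rot d)).edge = (E.parent (E.rot d₀)).edge) ∨
    ((E.parent d).edge = (E.parent (E.rot d₀)).edge ∧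
      (E.parent (E.rot d)).edge = (E.parent d₀).edge) := by
  obtain ⟨i, -, rfl⟩ := ((E.tail_eq_iff _ _).1 (h₀.trans h.symm)).exists_pow_eq'
  clear h
  induction i with
  | zero => exact .inl ⟨rfl, rfl⟩
  | succ i ih =>
    have ht : E.tail ((E.rot ^ i) d₀) = Sum.inr c := by
      rw [← h₀]
      exact (E.tail_eq_iff _ _).2 (Equiv.Perm.sameCycle_pow_left.2 (.refl _ _))
    rw [pow_succ', Equiv.Perm.mul_apply, E.edge_rot_rot ht]
    rcases ih with ⟨h1, h2⟩ | ⟨h1, h2⟩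
    · exact .inr ⟨h2, h1⟩
    · exact .inl ⟨h2, h1⟩

theorem RibbonArcs.of_ribbon (R : E.RibbonArcs c s₁ s₂ A b) (h₀ : E.tail d₀ = Sum.inr c) {r : ℕ}
    {u v : Fin n} (p : E.graph.Walk u v) (hp : E.IsRibbon c p)
    (hB : ∀ e ∈ p.edges, E.edgeVerts e ⊆ E.ball (Sum.inr c) r) :
    E.edgeVerts (E.parent d₀).edge ⊆ E.ball (Sum.inr c) r ∧
    E.edgeVerts (E.parent (E.rot d₀)).edge ⊆ E.ball (Sum.inr c) r ∧
    Reached s₁ s₂ A b d₀ r (E.rot d₀) := by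
  have key : ∀ {u v : Fin n} (p : E.graph.Walk u v),
      (∀ e ∈ p.edges, E.edgeVerts e ⊆ E.ball (Sum.inr c) r) →
      p.edges.head? = some (E.parent d₀).edge →
      p.edges.getLast? = some (E.parent (E.rot d₀)).edge →
      E.edgeVerts (E.parent d₀).edge ⊆ E.ball (Sum.inr c) r ∧
      E.edgeVerts (E.parent (E.rot d₀)).edge ⊆ E.ball (Sum.inr c) r ∧
      Reached s₁ s₂ A b d₀ r (E.rot d₀) := by
    intro u v p hB h1 h2
    have m1 := List.mem_of_head? h1
    have m2 := List.mem_of_getLast? h2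
    refine ⟨hB _ m1, hB _ m2, ?_⟩
    cases p with
    | nil => simp at h1
    | @cons _ w _ hadj p =>
      obtain ⟨s, ⟨hs1, hs2⟩, -⟩ := E.existsUnique_start ⟨(u, w), hadj⟩
      refine R.reached_walk h₀ _ hB hs1 ?_ _ m2
      refine R.reached_edge ⟨0, Nat.zero_le _, .src⟩ (hB _ m1) ?_
      rw [SimpleGraph.Walk.edges_cons, List.head?_cons, Option.some.injEq] at h1
      rw [hs2, ← h1]
      rfl
  obtain ⟨-, d, hd, h1, h2⟩ := hp
  rcases E.edges_at_crossing h₀ hd with ⟨e1, e2⟩ | ⟨e1, e2⟩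
  · rw [e1] at h1
    rw [e2] at h2
    exact key p hB h1 h2
  · rw [e1] at h1
    rw [e2] at h2
    -- The ribbon begins with the edge of `rot d₀`, so its reverse is used.
    refine key p.reverse (by simpa using hB) ?_ ?_
    · rw [SimpleGraph.Walk.edges_reverse, List.head?_reverse, h2]
    · rw [SimpleGraph.Walk.edges_reverse, List.getLast?_reverse, h1]

end EmbeddedGraph

/-! ## Paths with a given first and last edge -/

namespace SimpleGraph

variable {V : Type*} {H : SimpleGraph V}

theorem Walk.head?_edges_takeUntil [DecidableEq V] {u v w : V} (p : H.Walk u v) (hw : w ∈ p.support)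
    (hne : w ≠ u) : (p.takeUntil w hw).edges.head? = p.edges.head? := by
  have hn : (p.takeUntil w hw).edges ≠ [] := by
    intro h
    rw [Walk.edges_eq_nil] at h
    exact hne h.eq.symm
  conv_rhs => rw [← p.take_spec hw, Walk.edges_append, List.head?_append_of_ne_nil _ hn]

/-- In a connected graph, some path begins with a given edge and ends in a given vertex. -/
theorem exists_path_head {a b z : V} (hab : H.Adj a b) (h : H.Reachable a z) :
    ∃ (u : V) (p : H.Walk u z), p.IsPath ∧ p.edges.head? = some s(a, b) := by
  classical
  obtain ⟨p, hp⟩ := h.exists_isPath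
  by_cases hb : b ∈ p.support
  · refine ⟨a, .cons hab (p.dropUntil b hb), ?_, by simp⟩
    rw [Walk.cons_isPath_iff]
    refine ⟨hp.dropUntil hb, fun ha => ?_⟩
    have h2 := hp.support_nodup
    rw [← p.take_spec hb, Walk.support_append, List.nodup_append] at h2
    have ht : a ∈ (p.dropUntil b hb).support.tail := by
      rw [Walk.mem_support_iff] at ha
      exact ha.resolve_left hab.ne
    exact h2.2.2 a (Walk.start_mem_support _) a ht rfl
  · refine ⟨b, .cons hab.symm p, ?_, by simp [Sym2.eq_swap]⟩
    rw [Walk.cons_isPath_iff]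
    exact ⟨hp, hb⟩

/-- In a connected graph, some path begins with a given edge and ends with another. -/
theorem exists_path_head_getLast {a b c d : V} (hab : H.Adj a b) (hcd : H.Adj c d)
    (h : H.Reachable a c) : ∃ (u v : V) (p : H.Walk u v), p.IsPath ∧
      p.edges.head? = some s(a, b) ∧ p.edges.getLast? = some s(c, d) := by
  classical
  by_cases he : s(a, b) = s(c, d)
  · exact ⟨a, b, .cons hab .nil, by simp [hab.ne], by simp, by simp [he]⟩
  obtain ⟨u, p, hp, hh⟩ := exists_path_head hab h
  by_cases hd : d ∈ p.support
  · by_cases hu : d = u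
    -- If `d` is the start of the path, its first edge joins `d` to some `x`; the path x, d, c then
    -- has the required first and last edges.
    · subst hu
      cases p with
      | nil => simp at hh
      | @cons _ x _ hadj p =>
        rw [Walk.edges_cons, List.head?_cons, Option.some.injEq] at hh
        have hxc : x ≠ c := by
          rintro rfl
          exact he (hh.symm.trans Sym2.eq_swap)
        refine ⟨x, c, .cons hadj.symm (.cons hcd.symm .nil), ?_, ?_, ?_⟩
        · simp [Walk.cons_isPath_iff, hcd.ne.symm, hadj.ne.symm, hxc]
        · rw [← hh]; simp [Sym2.eq_swap]
        · simp [Sym2.eq_swap]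
    -- If `d` is a later vertex of the path, the path is cut at `d`, which keeps its first edge, and
    -- closed with the step to `c`.
    · refine ⟨u, c, (p.takeUntil d hd).concat hcd.symm, ?_, ?_, ?_⟩
      · exact (hp.takeUntil hd).concat (Walk.endpoint_notMem_support_takeUntil hp hd hcd.ne) _
      · rw [Walk.edges_concat, List.concat_eq_append, List.head?_append_of_ne_nil,
          p.head?_edges_takeUntil hd hu, hh]
        intro h0
        rw [Walk.edges_eq_nil] at h0
        exact hu h0.eq.symm
      · simp [Walk.edges_concat, Sym2.eq_swap]
  · refine ⟨u, d, p.concat hcd, hp.concat hd _, ?_, ?_⟩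
    · rw [Walk.edges_concat, List.concat_eq_append, List.head?_append_of_ne_nil, hh]
      intro h0
      simp [h0] at hh
    · simp [Walk.edges_concat]

end SimpleGraph

/-! ### From reached darts back to ribbons, and the radius of a crossing -/

namespace EmbeddedGraph

open RAM (Deriv)

variable {n q k : ℕ} {E : EmbeddedGraph (Fin n) (Fin q) (Fin k)} {s₁ s₂ A b : ℕ → ℕ} {d₀ : Fin k}
  {c : Fin q}

/-- The subgraph of `G` formed by the edges inside `B`. -/
def insideGraph (E : EmbeddedGraph (Fin n) (Fin q) (Fin k)) (B : Set (Fin n ⊕ Fin q)) :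
    SimpleGraph (Fin n) where
  Adj u v := E.graph.Adj u v ∧ E.edgeVerts s(u, v) ⊆ B
  symm := ⟨fun u v h => ⟨h.1.symm, by rw [Sym2.eq_swap]; exact h.2⟩⟩
  loopless := ⟨fun u h => h.1.ne rfl⟩

theorem insideGraph_adj_parent {B : Set (Fin n ⊕ Fin q)} (a : E.graph.Dart)
    (h : E.edgeVerts a.edge ⊆ B) : (E.insideGraph B).Adj a.fst a.snd :=
  ⟨a.adj, h⟩

/-- What a search at level `r` reaches has been entered from a vertex connected inside the ball. -/
theorem RibbonArcs.reached_sound (R : E.RibbonArcs c s₁ s₂ A b)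
    {r : ℕ} (hB : E.edgeVerts (E.parent d₀).edge ⊆ E.ball (Sum.inr c) r) {r' x : ℕ}
    (h : Deriv s₁ s₂ A b d₀ r' x) (hr : r' ≤ r) :
    ∃ d : Fin k, x = d ∧ ∃ s v, E.tail s = Sum.inl v ∧
      (E.insideGraph (E.ball (Sum.inr c) r)).Reachable (E.parent d₀).fst v ∧
      E.OnWalk (E.ball (Sum.inr c) r) s d := by
  induction h with
  | src =>
    -- The search starts in the middle of an edge; this is where the whole first edge has to lie in
    -- the ball.
    obtain ⟨s, v, h1, h2, h3⟩ := E.exists_start d₀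
    refine ⟨d₀, rfl, s, v, h1, ?_, h3.upgrade fun g hg => hB ⟨g, by rw [hg, h2], rfl⟩⟩
    rw [← h2, E.parent_fst _ _ h1]
  | @left r' x h ih =>
    obtain ⟨d, rfl, s, v, h1, h2, h3⟩ := ih ((le_max_left _ _).trans hr)
    have hb := (le_max_right _ _).trans hr
    cases ht : E.tail d with
    | inr y => exact ⟨d, R.s₁_crossing d y ht, s, v, h1, h2, h3⟩
    | inl w =>
      rw [R.s₁_vertex d w ht] at hb ⊢
      obtain rfl := h3.eq_of_tail ht
      rw [h1, Sum.inl.injEq] at ht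
      subst ht
      exact ⟨_, rfl, _, v, by rw [E.tail_rot, h1], h2, .refl (R.mem_ball_iff.2 hb)⟩
  | @right r' x h ih =>
    obtain ⟨d, rfl, s, v, h1, h2, h3⟩ := ih (by omega)
    have hb := (le_max_right _ _).trans hr
    cases ht : E.tail (E.rev d) with
    | inr y =>
      rw [R.s₂_crossing d y ht] at hb ⊢
      refine ⟨_, rfl, s, v, h1, h2, h3.step ht ?_⟩
      have := R.mem_ball_iff.2 hb
      rwa [E.tail_rot, E.tail_rot, ht] at this
    | inl w =>
      rw [R.s₂_vertex d w ht] at hb ⊢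
      have hw := R.mem_ball_iff.2 hb
      refine ⟨_, rfl, _, w, ht, h2.trans ?_, .refl hw⟩
      rw [ht] at hw
      -- On arrival at the vertex `w`, the whole edge has been traversed inside the ball, so it is
      -- an edge of `insideGraph`.
      have hadj := insideGraph_adj_parent _ (h3.edgeVerts_subset h1 ht hw)
      have e1 := E.parent_fst _ _ h1
      have e2 := E.parent_fst _ _ ht
      rw [E.parent_rev, h3.parent_eq] at e2
      rw [e1] at hadj
      have e3 : (E.parent s).snd = w := e2
      rw [e3] at hadj
      exact hadj.reachable

theorem exists_ribbon {B : Set (Fin n ⊕ Fin q)} (h₀ : E.tail d₀ = Sum.inr c)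
    (h1 : E.edgeVerts (E.parent d₀).edge ⊆ B) (h2 : E.edgeVerts (E.parent (E.rot d₀)).edge ⊆ B)
    (h : (E.insideGraph B).Reachable (E.parent d₀).fst (E.parent (E.rot d₀)).fst) :
    ∃ (u v : Fin n) (p : E.graph.Walk u v), E.IsRibbon c p ∧ ∀ e ∈ p.edges, E.edgeVerts e ⊆ B := by
  obtain ⟨u, v, p, hp, hh, hl⟩ := SimpleGraph.exists_path_head_getLast
    (insideGraph_adj_parent _ h1) (insideGraph_adj_parent _ h2) h
  have hle : E.insideGraph B ≤ E.graph := fun u v h => h.1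
  refine ⟨u, v, p.mapLe hle, ⟨hp.mapLe hle, d₀, h₀, ?_, ?_⟩, ?_⟩
  · rw [SimpleGraph.Walk.edges_mapLe_eq_edges, hh]; rfl
  · rw [SimpleGraph.Walk.edges_mapLe_eq_edges, hl]; rfl
  · intro e he
    rw [SimpleGraph.Walk.edges_mapLe_eq_edges] at he
    have := p.edges_subset_edgeSet he
    induction e with
    | _ u v => exact this.2

/-- The result of the search for ribbons. -/
theorem RibbonArcs.exists_ribbon_iff (R : E.RibbonArcs c s₁ s₂ A b) (h₀ : E.tail d₀ = Sum.inr c)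
    (r : ℕ) : (∃ (u v : Fin n) (p : E.graph.Walk u v), E.IsRibbon c p ∧
      ∀ e ∈ p.edges, E.edgeVerts e ⊆ E.ball (Sum.inr c) r) ↔
    E.edgeVerts (E.parent d₀).edge ⊆ E.ball (Sum.inr c) r ∧
    E.edgeVerts (E.parent (E.rot d₀)).edge ⊆ E.ball (Sum.inr c) r ∧
    Reached s₁ s₂ A b d₀ r (E.rot d₀) := by
  constructor
  · rintro ⟨u, v, p, hp, hB⟩
    exact R.of_ribbon h₀ p hp hB
  · rintro ⟨h1, h2, r', hr, h⟩
    obtain ⟨d, hd, s, v, hs, hv, hw⟩ := R.reached_sound h1 h hr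
    obtain rfl := Fin.ext hd
    refine exists_ribbon h₀ h1 h2 ?_
    rwa [hw.parent_eq, E.parent_fst _ _ hs]

/-- The ball of this radius contains everything, and `G` is connected. Thus the infimum that defines
μ(c) is over a nonempty set. -/
theorem exists_ribbon_ball (E : EmbeddedGraph (Fin n) (Fin q) (Fin k)) (c : Fin q) :
    ∃ (u v : Fin n) (p : E.graph.Walk u v), E.IsRibbon c p ∧
      ∀ e ∈ p.edges, E.edgeVerts e ⊆ E.ball (Sum.inr c) (n + q + k) := by
  obtain ⟨d₀, h₀⟩ := E.exists_dart c
  have hB : ∀ e, E.edgeVerts e ⊆ E.ball (Sum.inr c) (n + q + k) := fun e z _ => E.faceDist_le _ _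
  refine exists_ribbon h₀ (hB _) (hB _) ?_
  have : E.insideGraph (E.ball (Sum.inr c) (n + q + k)) = E.graph := by
    ext u v
    exact ⟨fun h => h.1, fun h => ⟨h, hB _⟩⟩
  rw [this]
  exact E.connected.preconnected _ _

theorem crossingRadius_le_iff (E : EmbeddedGraph (Fin n) (Fin q) (Fin k)) (c : Fin q) (r : ℕ) :
    E.crossingRadius c ≤ r ↔ ∃ (u v : Fin n) (p : E.graph.Walk u v), E.IsRibbon c p ∧
      ∀ e ∈ p.edges, E.edgeVerts e ⊆ E.ball (Sum.inr c) r := by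
  constructor
  · intro h
    obtain ⟨u, v, p, hp, hB⟩ := Nat.sInf_mem (s := {r | ∃ (u v : Fin n) (p : E.graph.Walk u v),
      E.IsRibbon c p ∧ ∀ e ∈ p.edges, E.edgeVerts e ⊆ E.ball (Sum.inr c) r})
      ⟨_, E.exists_ribbon_ball c⟩
    exact ⟨u, v, p, hp, fun e he z hz => (hB e he hz).trans h⟩
  · exact fun h => Nat.sInf_le h

/-- A ribbon contains an end of one of the crossing edges, and this is a vertex other than the
crossing. -/
theorem crossingRadius_pos (E : EmbeddedGraph (Fin n) (Fin q) (Fin k)) (c : Fin q) :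
    0 < E.crossingRadius c := by
  by_contra h0
  obtain ⟨u, v, p, hp, hB⟩ := (E.crossingRadius_le_iff c 0).1 (by omega)
  obtain ⟨-, d, hd, hh, -⟩ := hp
  obtain ⟨s, w, h1, h2, -⟩ := E.exists_start d
  have := hB _ (List.mem_of_head? hh) ⟨s, by rw [h2], rfl⟩
  have h3 := E.faceDist_pos (a := Sum.inr c) (b := E.tail s) (by rw [h1]; simp)
  have h4 : E.faceDist (Sum.inl (Sum.inr c)) (Sum.inl (E.tail s)) ≤ 0 := this
  omega

theorem ribbonRadius_eq (E : EmbeddedGraph (Fin n) (Fin q) (Fin k)) :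
    E.ribbonRadius = Finset.univ.sup E.crossingRadius + 1 := by
  rw [ribbonRadius, add_comm]
  congr 1
  refine le_antisymm (Finset.sup_le fun z _ => ?_) (Finset.sup_le fun c _ => ?_)
  · cases z with
    | inl v => exact Nat.zero_le _
    | inr c => exact Finset.le_sup (f := E.crossingRadius) (Finset.mem_univ c)
  · exact Finset.le_sup (f := E.vertexRadius) (Finset.mem_univ (Sum.inr c))

end EmbeddedGraph

namespace EmbeddedGraph

open RAM

/-! ## The program -/

variable {n q k : ℕ}

/-- The input is in the memory, and the machine words are long enough. -/
structure InputIn (E : EmbeddedGraph (Fin n) (Fin q) (Fin k)) (W : ℕ) (s : State) : Prop where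
  reg_n : s.reg 0 = n
  reg_q : s.reg 1 = q
  reg_k : s.reg 2 = k
  tail_inl : ∀ (d : Fin k) (v : Fin n), E.tail d = Sum.inl v → s.arr 0 d = v
  tail_inr : ∀ (d : Fin k) (x : Fin q), E.tail d = Sum.inr x → s.arr 0 d = n + x
  rot : ∀ d : Fin k, s.arr 1 d = E.rot d
  rev : ∀ d : Fin k, s.arr 2 d = E.rev d
  word : 6 * (n + q + k) + 100 < W

variable {E : EmbeddedGraph (Fin n) (Fin q) (Fin k)} {W : ℕ}

theorem InputIn.congr {s s' : State} (I : E.InputIn W s) (h0 : s'.reg 0 = s.reg 0)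
    (h1 : s'.reg 1 = s.reg 1) (h2 : s'.reg 2 = s.reg 2) (a0 : s'.arr 0 = s.arr 0)
    (a1 : s'.arr 1 = s.arr 1) (a2 : s'.arr 2 = s.arr 2) : E.InputIn W s' where
  reg_n := h0.trans I.reg_n
  reg_q := h1.trans I.reg_q
  reg_k := h2.trans I.reg_k
  tail_inl := by rw [a0]; exact I.tail_inl
  tail_inr := by rw [a0]; exact I.tail_inr
  rot := by rw [a1]; exact I.rot
  rev := by rw [a2]; exact I.rev
  word := I.word

theorem InputIn.tail_lt {s : State} (I : E.InputIn W s) (d : Fin k) : s.arr 0 d < n + q := by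
  cases h : E.tail d with
  | inl v => rw [I.tail_inl d v h]; omega
  | inr x => rw [I.tail_inr d x h]; omega

theorem InputIn.tail_eq {s : State} (I : E.InputIn W s) {d d' : Fin k}
    (h : s.arr 0 d = s.arr 0 d') : E.tail d = E.tail d' := by
  cases h1 : E.tail d with
  | inl v =>
    rw [I.tail_inl d v h1] at h
    cases h2 : E.tail d' with
    | inl w => rw [I.tail_inl d' w h2] at h; rw [Fin.ext h]
    | inr y => rw [I.tail_inr d' y h2] at h; omega
  | inr x =>
    rw [I.tail_inr d x h1] at h
    cases h2 : E.tail d' with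
    | inl w => rw [I.tail_inl d' w h2] at h; omega
    | inr y => rw [I.tail_inr d' y h2] at h; rw [Fin.ext (Nat.add_left_cancel h)]

/-- Writing the arcs of the radial graph, and one dart for each vertex of the planarization. -/
def radialBody : Prog :=
  .seq (.store 10 (.reg 7) (.load 1 (.reg 7))) <|
  .seq (.store 10 (.add (.reg 2) (.reg 7)) (.add (.reg 2) (.load 1 (.load 2 (.reg 7))))) <|
  .seq (.store 11 (.reg 7) (.add (.reg 2) (.reg 7))) <|
  .seq (.store 11 (.add (.reg 2) (.reg 7)) (.reg 7)) <|
  .seq (.store 12 (.reg 7) (.const 1))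
    (.store 17 (.load 0 (.reg 7)) (.reg 7))

/-- The arcs at vertices, for the search for ribbons. -/
def turnBody : Prog :=
  -- Nonzero exactly for numbers below `n`, that is, for vertices of `G`.
  .branch (.sub (.reg 0) (.load 0 (.reg 7)))
    (.store 14 (.reg 7) (.load 1 (.reg 7))) (.store 14 (.reg 7) (.reg 7))

/-- The arcs along edges, for the search for ribbons. -/
def aheadBody : Prog :=
  .branch (.sub (.reg 0) (.load 0 (.load 2 (.reg 7))))
    (.store 15 (.reg 7) (.load 2 (.reg 7)))
    (.store 15 (.reg 7) (.load 1 (.load 1 (.load 2 (.reg 7)))))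

theorem tot_radial {s : State} (I : E.InputIn W s) (hA : ∀ x, s.arr 12 x = 0) :
    Tot W (.forUpto 7 2 radialBody) s ((k + 1) * 42) fun s' =>
      (∀ d : Fin k, s'.arr 10 d = E.rot d ∧ s'.arr 10 (k + d) = k + E.rot (E.rev d) ∧
        s'.arr 11 d = k + d ∧ s'.arr 11 (k + d) = d ∧ s'.arr 12 d = 1 ∧
        ∃ d', E.tail d' = E.tail d ∧ s'.arr 17 (s.arr 0 d) = d') ∧ ∀ x, k ≤ x → s'.arr 12 x = 0 := by
  have hk := I.reg_k
  have hW := I.word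
  refine (Tot.forUpto (B := radialBody.bound) (I := fun j s' =>
    (∀ d : Fin k, (d : ℕ) < j → s'.arr 10 d = E.rot d ∧ s'.arr 10 (k + d) = k + E.rot (E.rev d) ∧
        s'.arr 11 d = k + d ∧ s'.arr 11 (k + d) = d ∧ s'.arr 12 d = 1 ∧
        ∃ d', E.tail d' = E.tail d ∧ s'.arr 17 (s.arr 0 d) = d') ∧ ∀ x, k ≤ x → s'.arr 12 x = 0)
    (by simp) (by simp [radialBody, Prog.writesReg])
    (by simp [radialBody, Prog.writesReg]) (by omega) (by simpa using fun x _ => hA x) ?_).mono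
    (by rw [hk]; exact Nat.mul_le_mul_left _ (by decide)) (fun s' h => ?_)
  swap
  · rw [hk] at h; exact ⟨fun d => h.1 d d.isLt, h.2⟩
  intro j t ha hj hjk ⟨h1, h2⟩
  rw [hk] at hjk
  have It : E.InputIn W t := I.congr
    (ha.reg _ (by simp [radialBody, Prog.writesReg])) (ha.reg _ (by simp [radialBody, Prog.writesReg]))
    (ha.reg _ (by simp [radialBody, Prog.writesReg])) (ha.arr _ (by simp [radialBody, Prog.writesArr]))
    (ha.arr _ (by simp [radialBody, Prog.writesArr])) (ha.arr _ (by simp [radialBody, Prog.writesArr]))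
  have ht0 : t.arr 0 = s.arr 0 := ha.arr _ (by simp [radialBody, Prog.writesArr])
  obtain ⟨e, rfl⟩ : ∃ e : Fin k, (e : ℕ) = j := ⟨⟨j, hjk⟩, rfl⟩
  have l1 := (E.rot e).isLt
  have l2 := (E.rot (E.rev e)).isLt
  have l3 := (E.rev e).isLt
  have l4 := It.tail_lt e
  refine Tot.of_wp ?_
  simp only [radialBody, wp, Expr.Fits, Expr.eval,
    State.setArr_reg, State.setArr_arr, hj, It.reg_k]
  norm_num only [if_true, if_false, It.rot, It.rev]
  refine ⟨by omega, by omega, by omega, by omega, by omega, by omega, by omega, by omega, by omega,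
    by omega, ⟨by omega, by omega⟩, by omega, ?_, ?_⟩
  · intro d hd
    by_cases hde : d = e
    · subst hde
      refine ⟨?_, ?_, ?_, ?_, ?_, d, rfl, ?_⟩ <;> (simp [ht0, Function.update_apply]; try omega)
    · have hne : (d : ℕ) ≠ e := fun h => hde (Fin.ext h)
      obtain ⟨g1, g2, g3, g4, g5, d', g6, g7⟩ := h1 d (by omega)
      have n1 : (d : ℕ) ≠ k + e := by omega
      have n2 : k + (d : ℕ) ≠ e := by omega
      have n3 : k + (d : ℕ) ≠ k + e := by omega
      refine ⟨by simp [n1, hne, g1], ?_, by simp [n1, hne, g3], ?_, by simp [hne, g5], ?_⟩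
      · simp [n2, hne, g2]
      · simp [n2, hne, g4]
      -- Later darts at the same vertex overwrite its entry in array 17; any of them will do.
      · by_cases ht : E.tail d = E.tail e
        · refine ⟨e, ht.symm, ?_⟩
          have : s.arr 0 d = t.arr 0 e := by
            rw [ht0]
            cases h : E.tail e with
            | inl v => rw [I.tail_inl e v h, I.tail_inl d v (ht.trans h)]
            | inr x => rw [I.tail_inr e x h, I.tail_inr d x (ht.trans h)]
          simp [this]
        · refine ⟨d', g6, ?_⟩
          have : s.arr 0 d ≠ t.arr 0 e := fun h => ht (I.tail_eq (by rw [h, ht0]))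
          simp [this, g7]
  · intro x hx
    have : x ≠ e := by omega
    simp [this, h2 x hx]

theorem tot_turn {s : State} (I : E.InputIn W s) :
    Tot W (.forUpto 7 2 turnBody) s ((k + 1) * 25) fun s' => ∀ d : Fin k,
      (∀ v, E.tail d = Sum.inl v → s'.arr 14 d = E.rot d) ∧
      ∀ x, E.tail d = Sum.inr x → s'.arr 14 d = d := by
  have hk := I.reg_k
  have hW := I.word
  refine (Tot.forUpto (B := turnBody.bound) (I := fun j s' => ∀ d : Fin k, (d : ℕ) < j →
      (∀ v, E.tail d = Sum.inl v → s'.arr 14 d = E.rot d) ∧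
      ∀ x, E.tail d = Sum.inr x → s'.arr 14 d = d)
    (by simp) (by simp [turnBody, Prog.writesReg])
    (by simp [turnBody, Prog.writesReg]) (by omega) (by simp) ?_).mono
    (by rw [hk]; exact Nat.mul_le_mul_left _ (by decide)) (fun s' h => ?_)
  swap
  · rw [hk] at h; exact fun d => h d d.isLt
  intro j t ha hj hjk h1
  rw [hk] at hjk
  have It : E.InputIn W t := I.congr
    (ha.reg _ (by simp [turnBody, Prog.writesReg])) (ha.reg _ (by simp [turnBody, Prog.writesReg]))
    (ha.reg _ (by simp [turnBody, Prog.writesReg])) (ha.arr _ (by simp [turnBody, Prog.writesArr]))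
    (ha.arr _ (by simp [turnBody, Prog.writesArr])) (ha.arr _ (by simp [turnBody, Prog.writesArr]))
  obtain ⟨e, rfl⟩ : ∃ e : Fin k, (e : ℕ) = j := ⟨⟨j, hjk⟩, rfl⟩
  have l1 := (E.rot e).isLt
  have l4 := It.tail_lt e
  have key : ∀ y : ℕ, (∀ v, E.tail e = Sum.inl v → y = E.rot e) →
      (∀ x, E.tail e = Sum.inr x → y = e) → ∀ d : Fin k, (d : ℕ) < e + 1 →
      (∀ v, E.tail d = Sum.inl v → Function.update (t.arr 14) e y d = E.rot d) ∧
      ∀ x, E.tail d = Sum.inr x → Function.update (t.arr 14) e y d = d := by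
    intro y hy1 hy2 d hd
    by_cases hde : d = e
    · subst hde; simpa using ⟨hy1, hy2⟩
    · have hne : (d : ℕ) ≠ e := fun h => hde (Fin.ext h)
      simpa [hne] using h1 d (by omega)
  refine Tot.of_wp ?_
  simp only [turnBody, wp, Expr.Fits, Expr.eval, State.setReg_arr, State.setArr_arr, hj, It.reg_n,
    if_true, It.rot]
  refine ⟨by omega, fun h => ⟨by omega, by omega, key _ ?_ ?_⟩, fun h => ⟨by omega, by omega, key _ ?_ ?_⟩⟩
  · exact fun v _ => rfl
  · intro x hx; rw [It.tail_inr e x hx] at h; omega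
  · intro v hv; rw [It.tail_inl e v hv] at h; omega
  · exact fun x _ => rfl

theorem tot_ahead {s : State} (I : E.InputIn W s) :
    Tot W (.forUpto 7 2 aheadBody) s ((k + 1) * 30) fun s' => ∀ d : Fin k,
      (∀ v, E.tail (E.rev d) = Sum.inl v → s'.arr 15 d = E.rev d) ∧
      ∀ x, E.tail (E.rev d) = Sum.inr x → s'.arr 15 d = E.rot (E.rot (E.rev d)) := by
  have hk := I.reg_k
  have hW := I.word
  refine (Tot.forUpto (B := aheadBody.bound) (I := fun j s' => ∀ d : Fin k, (d : ℕ) < j →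
      (∀ v, E.tail (E.rev d) = Sum.inl v → s'.arr 15 d = E.rev d) ∧
      ∀ x, E.tail (E.rev d) = Sum.inr x → s'.arr 15 d = E.rot (E.rot (E.rev d)))
    (by simp) (by simp [aheadBody, Prog.writesReg])
    (by simp [aheadBody, Prog.writesReg]) (by omega) (by simp) ?_).mono
    (by rw [hk]; exact Nat.mul_le_mul_left _ (by decide)) (fun s' h => ?_)
  swap
  · rw [hk] at h; exact fun d => h d d.isLt
  intro j t ha hj hjk h1
  rw [hk] at hjk
  have It : E.InputIn W t := I.congr
    (ha.reg _ (by simp [aheadBody, Prog.writesReg])) (ha.reg _ (by simp [aheadBody, Prog.writesReg]))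
    (ha.reg _ (by simp [aheadBody, Prog.writesReg])) (ha.arr _ (by simp [aheadBody, Prog.writesArr]))
    (ha.arr _ (by simp [aheadBody, Prog.writesArr])) (ha.arr _ (by simp [aheadBody, Prog.writesArr]))
  obtain ⟨e, rfl⟩ : ∃ e : Fin k, (e : ℕ) = j := ⟨⟨j, hjk⟩, rfl⟩
  have l1 := (E.rev e).isLt
  have l2 := (E.rot (E.rev e)).isLt
  have l3 := (E.rot (E.rot (E.rev e))).isLt
  have l4 := It.tail_lt (E.rev e)
  have key : ∀ y : ℕ, (∀ v, E.tail (E.rev e) = Sum.inl v → y = E.rev e) →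
      (∀ x, E.tail (E.rev e) = Sum.inr x → y = E.rot (E.rot (E.rev e))) →
      ∀ d : Fin k, (d : ℕ) < e + 1 →
      (∀ v, E.tail (E.rev d) = Sum.inl v → Function.update (t.arr 15) e y d = E.rev d) ∧
      ∀ x, E.tail (E.rev d) = Sum.inr x →
        Function.update (t.arr 15) e y d = E.rot (E.rot (E.rev d)) := by
    intro y hy1 hy2 d hd
    by_cases hde : d = e
    · subst hde; simpa using ⟨hy1, hy2⟩
    · have hne : (d : ℕ) ≠ e := fun h => hde (Fin.ext h)
      simpa [hne] using h1 d (by omega)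
  refine Tot.of_wp ?_
  simp only [aheadBody, wp, Expr.Fits, Expr.eval, State.setReg_arr, State.setArr_arr, hj, It.reg_n,
    if_true, It.rot, It.rev]
  refine ⟨by omega, fun h => ⟨by omega, by omega, key _ ?_ ?_⟩, fun h => ⟨by omega, by omega, key _ ?_ ?_⟩⟩
  · exact fun v _ => rfl
  · intro x hx; rw [It.tail_inr _ x hx] at h; omega
  · intro v hv; rw [It.tail_inl _ v hv] at h; omega
  · exact fun x _ => rfl

end EmbeddedGraph

/-! ### Walking back along an edge, and the tables shared by all crossings -/

namespace EmbeddedGraph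

open RAM

variable {n q k : ℕ} {E : EmbeddedGraph (Fin n) (Fin q) (Fin k)} {W : ℕ}

/-- Following an edge straight back from the dart in register `8`, with the maximal face-distance
collected in register `6`. -/
def backProg : Prog :=
  -- Nonzero exactly for numbers at least `n`, that is, as long as the dart starts at a crossing.
  .loop (.sub (.add (.load 0 (.reg 8)) (.const 1)) (.reg 0))
    (.seq (.assign 8 (.load 2 (.load 1 (.load 1 (.reg 8)))))
      (.assign 6 (.add (.reg 6) (.sub (.load 16 (.reg 8)) (.reg 6)))))

/-- Up to the first vertex of `G` no dart occurs twice, because skipping the repetition would lead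
to that vertex earlier. So there are fewer than `k` steps. -/
theorem exists_back_lt (E : EmbeddedGraph (Fin n) (Fin q) (Fin k)) (d : Fin k) :
    ∃ j < k, ∃ v, E.tail ((fun d => E.rev (E.rot (E.rot d)))^[j] d) = Sum.inl v := by
  classical
  have hinj : Function.Injective fun d : Fin k => E.rev (E.rot (E.rot d)) := fun d d' h =>
    E.rot.injective (E.rot.injective (E.rev.injective h))
  set f := fun d : Fin k => E.rev (E.rot (E.rot d)) with hf
  have hex : ∃ j v, E.tail (f^[j] d) = Sum.inl v := by
    obtain ⟨m, v, hm⟩ := E.arrives (E.rev d)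
    refine ⟨m, v, ?_⟩
    rw [← hm]
    congr 1
    clear hm
    induction m with
    | zero => simp [E.rev_rev]
    | succ m ih => rw [Function.iterate_succ_apply', Function.iterate_succ_apply', ih]
  refine ⟨Nat.find hex, ?_, Nat.find_spec hex⟩
  have hcard := Finset.card_le_card_of_injOn (s := Finset.range (Nat.find hex + 1))
    (t := (Finset.univ : Finset (Fin k))) (fun i => f^[i] d) (by simp) ?_
  · simpa using hcard
  have key : ∀ i i', i < i' → i' ≤ Nat.find hex → f^[i] d ≠ f^[i'] d := by
    intro i i' hii' hi' h
    obtain ⟨v, hv⟩ := Nat.find_spec hex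
    refine Nat.find_min hex (m := Nat.find hex - i' + i) (by omega) ⟨v, ?_⟩
    rw [Function.iterate_add_apply, h, ← Function.iterate_add_apply, Nat.sub_add_cancel hi', hv]
  intro i hi i' hi' h
  simp only [Finset.coe_range, Set.mem_Iio] at hi hi'
  rcases lt_trichotomy i i' with h' | h' | h'
  · exact absurd h (key i i' h' (by omega))
  · exact h'
  · exact absurd h.symm (key i' i h' (by omega))

/-- The computed maximum is described by its upper bounds `r`: in this form, maxima become
conjunctions of conditions on the ball of radius `r`. -/
theorem tot_back {s : State} {c : Fin q} {d : Fin k} {K : ℕ} (I : E.InputIn W s)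
    (hd : s.reg 8 = d) (hK : K < W) (hM : s.reg 6 ≤ K) (hc : E.tail d = Sum.inr c)
    (hdist : ∀ d : Fin k, s.arr 16 d = E.faceDist (Sum.inl (Sum.inr c)) (Sum.inl (E.tail d)))
    (hdK : ∀ d : Fin k, s.arr 16 d ≤ K) :
    Tot W backProg s ((k + 1) * 20) fun s' => s'.reg 6 ≤ K ∧
      ∀ r, s'.reg 6 ≤ r ↔ s.reg 6 ≤ r ∧ E.Back (E.ball (Sum.inr c) r) d := by
  have hW := I.word
  obtain ⟨m, hmk, v, hv⟩ := E.exists_back_lt d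
  refine (Tot.loop (B := 12) (μ := m) (I := fun μ t => ∃ y : Fin k, t.reg 8 = y ∧ t.reg 6 ≤ K ∧
    (∃ v, E.tail ((fun d => E.rev (E.rot (E.rot d)))^[μ] y) = Sum.inl v) ∧
    s.arr 16 y ≤ t.reg 6 ∧ ∀ r, (s.reg 6 ≤ r ∧ E.Back (E.ball (Sum.inr c) r) d) ↔
      (t.reg 6 ≤ r ∧ E.Back (E.ball (Sum.inr c) r) y)) ?_
    ⟨d, hd, hM, ⟨v, hv⟩, by rw [hdist, hc, faceDist_self]; exact Nat.zero_le _, fun r => Iff.rfl⟩).mono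
    (Nat.mul_le_mul (by omega) (by decide)) ?_
  · rintro μ t ha ⟨y, hy, hMt, ⟨v, hv⟩, hyM, hr⟩
    have It : E.InputIn W t := I.congr (ha.reg _ (by simp [Prog.writesReg]))
      (ha.reg _ (by simp [Prog.writesReg])) (ha.reg _ (by simp [Prog.writesReg]))
      (ha.arr _ (by simp [Prog.writesArr])) (ha.arr _ (by simp [Prog.writesArr]))
      (ha.arr _ (by simp [Prog.writesArr]))
    have h16 : t.arr 16 = s.arr 16 := ha.arr _ (by simp [Prog.writesArr])
    have l1 := It.tail_lt y
    have l2 := (E.rot y).isLt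
    have l3 := (E.rot (E.rot y)).isLt
    have l4 := (E.rev (E.rot (E.rot y))).isLt
    have l5 := hdK (E.rev (E.rot (E.rot y)))
    simp only [Expr.Fits, Expr.eval, hy, It.reg_n]
    refine ⟨by omega, fun he => ?_⟩
    cases hty : E.tail y with
    | inl w => rw [It.tail_inl y w hty] at he; omega
    | inr x =>
      cases μ with
      | zero => rw [Function.iterate_zero, id, hty] at hv; exact absurd hv (by simp)
      | succ μ =>
        rw [Function.iterate_succ_apply] at hv
        refine Tot.of_wp (p := (.seq (.assign 8 (.load 2 (.load 1 (.load 1 (.reg 8)))))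
          (.assign 6 (.add (.reg 6) (.sub (.load 16 (.reg 8)) (.reg 6)))))) ?_
        simp only [wp, Expr.Fits, Expr.eval, State.setReg_reg, State.setReg_arr, hy, It.rot, It.rev,
          add_sub_eq_max, h16]
        norm_num only [if_true, if_false]
        refine ⟨by omega, by omega, μ, by omega, _, rfl, by omega, ⟨v, hv⟩, le_max_right _ _,
          fun r => (hr r).trans ?_⟩
        have hx : E.tail y ∈ E.ball (Sum.inr c) r ↔ s.arr 16 y ≤ r := by rw [hdist]; rfl
        have hx' : E.tail (E.rev (E.rot (E.rot y))) ∈ E.ball (Sum.inr c) r ↔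
            s.arr 16 (E.rev (E.rot (E.rot y))) ≤ r := by rw [hdist]; rfl
        rw [back_crossing hty, hx, max_le_iff, ← hx']
        constructor
        · rintro ⟨h1, h2, h3⟩
          exact ⟨⟨h1, h3.tail_mem⟩, h3⟩
        · rintro ⟨⟨h1, h2⟩, h3⟩
          exact ⟨h1, hyM.trans h1, h3⟩
  · rintro t ⟨he, ha, μ, y, hy, hMt, -, hyM, hr⟩
    have It : E.InputIn W t := I.congr (ha.reg _ (by simp [Prog.writesReg]))
      (ha.reg _ (by simp [Prog.writesReg])) (ha.reg _ (by simp [Prog.writesReg]))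
      (ha.arr _ (by simp [Prog.writesArr])) (ha.arr _ (by simp [Prog.writesArr]))
      (ha.arr _ (by simp [Prog.writesArr]))
    refine ⟨hMt, fun r => ?_⟩
    rw [hr]
    simp only [Expr.eval, hy, It.reg_n] at he
    cases hty : E.tail y with
    | inr x => rw [It.tail_inr y x hty] at he; omega
    | inl w =>
      have hx : E.tail y ∈ E.ball (Sum.inr c) r ↔ s.arr 16 y ≤ r := by rw [hdist]; rfl
      rw [back_vertex hty, hx]
      exact ⟨fun h => ⟨h, hyM.trans h⟩, fun h => h.1⟩

/-- The arrays that do not depend on the crossing have been written. -/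
structure Ready (E : EmbeddedGraph (Fin n) (Fin q) (Fin k)) (W : ℕ) (s : State) : Prop
    extends E.InputIn W s where
  reg_K : s.reg 11 = n + q + k + 1
  radial : E.RadialArcs (s.arr 10) (s.arr 11) (s.arr 12) (s.arr 13)
  turn : ∀ d : Fin k, (∀ v, E.tail d = Sum.inl v → s.arr 14 d = E.rot d) ∧
    ∀ x, E.tail d = Sum.inr x → s.arr 14 d = d
  ahead : ∀ d : Fin k, (∀ v, E.tail (E.rev d) = Sum.inl v → s.arr 15 d = E.rev d) ∧
    ∀ x, E.tail (E.rev d) = Sum.inr x → s.arr 15 d = E.rot (E.rot (E.rev d))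
  dart : ∀ c : Fin q, ∃ d : Fin k, E.tail d = Sum.inr c ∧ s.arr 17 (n + c) = d

theorem Ready.congr {s s' : State} (I : E.Ready W s)
    (hr : ∀ r, r = 0 ∨ r = 1 ∨ r = 2 ∨ r = 11 → s'.reg r = s.reg r)
    (ha : ∀ a, a ≤ 2 ∨ (10 ≤ a ∧ a ≤ 15) ∨ a = 17 → s'.arr a = s.arr a) : E.Ready W s' where
  toInputIn := I.toInputIn.congr (hr _ (by simp)) (hr _ (by simp)) (hr _ (by simp)) (ha _ (by simp))
    (ha _ (by simp)) (ha _ (by simp))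
  reg_K := (hr _ (by simp)).trans I.reg_K
  radial := by
    rw [ha 10 (by simp), ha 11 (by simp), ha 12 (by simp), ha 13 (by simp)]; exact I.radial
  turn := by rw [ha 14 (by simp)]; exact I.turn
  ahead := by rw [ha 15 (by simp)]; exact I.ahead
  dart := by rw [ha 17 (by simp)]; exact I.dart

/-- Writing the arrays that do not depend on the crossing. -/
def setupProg : Prog :=
  .seq (.assign 11 (.add (.add (.reg 0) (.reg 1)) (.add (.reg 2) (.const 1)))) <|
  .seq (.forUpto 7 2 radialBody) <| .seq (.forUpto 7 2 turnBody) (.forUpto 7 2 aheadBody)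

/-- Array 13 is never written: its zeros are the lower bounds `b` of the search for distances and
the costs `A` of the search for ribbons. -/
theorem tot_setup {s : State} (I : E.InputIn W s) (h12 : ∀ x, s.arr 12 x = 0)
    (h13 : ∀ x, s.arr 13 x = 0) :
    Tot W setupProg s (110 * (k + 1)) fun s' => E.Ready W s' ∧ s'.reg 5 = s.reg 5 := by
  have hW := I.word
  refine (Tot.seq (T₁ := 8) (T₂ := (k + 1) * 42 + ((k + 1) * 25 + (k + 1) * 30))
    (R := fun s' => s' = s.setReg 11 (n + q + k + 1))
    (Tot.of_wp (p := .assign 11 (.add (.add (.reg 0) (.reg 1)) (.add (.reg 2) (.const 1)))) ?_)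
    ?_).mono (by omega) (fun _ h => h)
  · simp only [wp, Expr.Fits, Expr.eval, I.reg_n, I.reg_q, I.reg_k]
    exact ⟨by omega, by rw [add_assoc (n + q)]⟩
  rintro _ rfl
  set s₁ := s.setReg 11 (n + q + k + 1) with hs₁
  have I₁ : E.InputIn W s₁ := I.congr (by simp [hs₁]) (by simp [hs₁]) (by simp [hs₁]) rfl rfl rfl
  refine Tot.seq (tot_radial I₁ h12).frame ?_
  rintro s₂ ⟨p₂, a₂⟩
  have I₂ : E.InputIn W s₂ := I₁.congr
    (a₂.reg _ (by simp [Prog.forUpto, radialBody, Prog.writesReg]))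
    (a₂.reg _ (by simp [Prog.forUpto, radialBody, Prog.writesReg]))
    (a₂.reg _ (by simp [Prog.forUpto, radialBody, Prog.writesReg]))
    (a₂.arr _ (by simp [Prog.forUpto, radialBody, Prog.writesArr]))
    (a₂.arr _ (by simp [Prog.forUpto, radialBody, Prog.writesArr]))
    (a₂.arr _ (by simp [Prog.forUpto, radialBody, Prog.writesArr]))
  refine Tot.seq (tot_turn I₂).frame ?_
  rintro s₃ ⟨p₃, a₃⟩
  have ra₃ : ∀ r, r ≠ 7 → s₃.reg r = s₂.reg r := fun r hr =>
    a₃.reg _ (by simp [Prog.forUpto, turnBody, Prog.writesReg, hr])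
  have aa₃ : ∀ a, a ≠ 14 → s₃.arr a = s₂.arr a := fun r hr =>
    a₃.arr _ (by simp [Prog.forUpto, turnBody, Prog.writesArr, hr])
  have I₃ : E.InputIn W s₃ := I₂.congr (ra₃ _ (by simp)) (ra₃ _ (by simp)) (ra₃ _ (by simp))
    (aa₃ _ (by simp)) (aa₃ _ (by simp)) (aa₃ _ (by simp))
  refine (tot_ahead I₃).frame.mono le_rfl ?_
  rintro s₄ ⟨p₄, a₄⟩
  have ra₄ : ∀ r, r ≠ 7 → s₄.reg r = s₃.reg r := fun r hr =>
    a₄.reg _ (by simp [Prog.forUpto, aheadBody, Prog.writesReg, hr])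
  have aa₄ : ∀ a, a ≠ 15 → s₄.arr a = s₃.arr a := fun r hr =>
    a₄.arr _ (by simp [Prog.forUpto, aheadBody, Prog.writesArr, hr])
  have r₂ : ∀ r, r ≠ 7 → s₂.reg r = s₁.reg r := fun r hr =>
    a₂.reg _ (by simp [Prog.forUpto, radialBody, Prog.writesReg, hr])
  have h13' : s₂.arr 13 = s.arr 13 := a₂.arr _ (by simp [Prog.forUpto, radialBody, Prog.writesArr])
  refine ⟨⟨I₃.congr (ra₄ _ (by simp)) (ra₄ _ (by simp)) (ra₄ _ (by simp)) (aa₄ _ (by simp))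
    (aa₄ _ (by simp)) (aa₄ _ (by simp)), ?_, ?_, ?_, p₄, ?_⟩, ?_⟩
  · rw [ra₄ _ (by simp), ra₃ _ (by simp), r₂ _ (by simp)]; simp [hs₁]
  · rw [aa₄ 10 (by simp), aa₄ 11 (by simp), aa₄ 12 (by simp), aa₄ 13 (by simp), aa₃ 10 (by simp),
      aa₃ 11 (by simp), aa₃ 12 (by simp), aa₃ 13 (by simp), h13']
    exact ⟨fun d => (p₂.1 d).1, fun d => (p₂.1 d).2.1, fun d => (p₂.1 d).2.2.1,
      fun d => (p₂.1 d).2.2.2.1, fun d => (p₂.1 d).2.2.2.2.1, fun d => p₂.2 _ (by omega), h13⟩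
  · rw [aa₄ 14 (by simp)]; exact p₃
  · intro c
    obtain ⟨d, hd⟩ := E.exists_dart c
    obtain ⟨d', h1, h2⟩ := (p₂.1 d).2.2.2.2.2
    rw [I₁.tail_inr d c hd] at h2
    exact ⟨d', h1.trans hd, by rw [aa₄ 17 (by simp), aa₃ 17 (by simp), h2]⟩
  · rw [ra₄ _ (by simp), ra₃ _ (by simp), r₂ _ (by simp)]; simp [hs₁]

end EmbeddedGraph

namespace RAM

theorem searchProg_writesReg {a₁ a₂ A b r : ℕ} (h : (searchProg a₁ a₂ A b).writesReg r) :
    12 ≤ r := by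
  simp only [searchProg, clearProg, Prog.forUpto, initProg, stepProg, settleProg, pushProg,
    Prog.writesReg, false_or, or_false] at h
  omega

theorem searchProg_writesArr {a₁ a₂ A b a : ℕ} (h : (searchProg a₁ a₂ A b).writesArr a) :
    3 ≤ a ∧ a ≤ 6 := by
  simp only [searchProg, clearProg, Prog.forUpto, initProg, stepProg, settleProg, pushProg,
    Prog.writesArr, false_or, or_false] at h
  omega

end RAM

/-! ### The radius of a single crossing -/

namespace EmbeddedGraph

open RAM

variable {n q k : ℕ} {E : EmbeddedGraph (Fin n) (Fin q) (Fin k)} {W : ℕ}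

/-- Computing the face-distances from the crossing whose number is in register `3`. -/
def distProg : Prog :=
  .seq (.assign 4 (.load 17 (.add (.reg 0) (.reg 3)))) <|
  .seq (.assign 10 (.add (.reg 2) (.reg 2))) <|
  .seq (searchProg 10 11 12 13)
    (.forUpto 7 2 (.store 16 (.reg 7) (.sub (.load 3 (.reg 7)) (.const 1))))

theorem tot_dist {s : State} {c : Fin q} (I : E.Ready W s) (hc : s.reg 3 = c) :
    Tot W distProg s (1000 * (2 * k + (n + q + k + 1) + 1) + 20 * (k + 1) + 20) fun s' =>
      E.Ready W s' ∧ s'.reg 3 = c ∧ s'.reg 5 = s.reg 5 ∧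
      (∃ d₀ : Fin k, s'.reg 4 = d₀ ∧ E.tail d₀ = Sum.inr c) ∧
      ∀ d : Fin k, s'.arr 16 d = E.faceDist (Sum.inl (Sum.inr c)) (Sum.inl (E.tail d)) := by
  have hW := I.word
  obtain ⟨d₀, hd₀, h17⟩ := I.dart c
  set s₁ := (s.setReg 4 d₀).setReg 10 (k + k) with hs₁
  suffices H : Tot W (.seq (searchProg 10 11 12 13)
      (.forUpto 7 2 (.store 16 (.reg 7) (.sub (.load 3 (.reg 7)) (.const 1))))) s₁
      (1000 * (2 * k + (n + q + k + 1) + 1) + 20 * (k + 1)) fun s' =>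
      E.Ready W s' ∧ s'.reg 3 = c ∧ s'.reg 5 = s.reg 5 ∧
      (∃ d₀ : Fin k, s'.reg 4 = d₀ ∧ E.tail d₀ = Sum.inr c) ∧
      ∀ d : Fin k, s'.arr 16 d = E.faceDist (Sum.inl (Sum.inr c)) (Sum.inl (E.tail d)) by
    have h1 : Tot W (.assign 4 (.load 17 (.add (.reg 0) (.reg 3)))) s 5
        fun s' => s' = s.setReg 4 d₀ := by
      refine Tot.of_wp (p := .assign 4 (.load 17 (.add (.reg 0) (.reg 3)))) ?_
      simp only [wp, Expr.Fits, Expr.eval, I.reg_n, hc, h17]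
      exact ⟨by omega, trivial⟩
    have h2 : Tot W (.assign 10 (.add (.reg 2) (.reg 2))) (s.setReg 4 d₀) 4 fun s' => s' = s₁ := by
      refine Tot.of_wp (p := .assign 10 (.add (.reg 2) (.reg 2))) ?_
      simp only [wp, Expr.Fits, Expr.eval, State.setReg_reg]
      norm_num only [if_false, I.reg_k]
      exact ⟨by omega, hs₁.symm⟩
    refine (Tot.seq h1 (T₂ := 4 + (1000 * (2 * k + (n + q + k + 1) + 1) + 20 * (k + 1))) ?_).mono
      (by omega) (fun _ h => h)
    · rintro _ rfl
      refine Tot.seq h2 ?_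
      rintro _ rfl
      exact H
  have I₁ : E.Ready W s₁ := I.congr
    (by rintro r (rfl | rfl | rfl | rfl) <;> simp [hs₁]) (fun a _ => rfl)
  have R := I₁.radial
  have hx : ∀ x < k + k, (∃ d : Fin k, x = d) ∨ ∃ d : Fin k, x = k + d := by
    intro x hx
    by_cases h : x < k
    · exact .inl ⟨⟨x, h⟩, rfl⟩
    · exact .inr ⟨⟨x - k, by omega⟩, by simp; omega⟩
  have G : GraphIn W (s₁.arr 10) (s₁.arr 11) (s₁.arr 12) (s₁.arr 13) (k + k) (n + q + k + 1)
      10 11 12 13 s₁ :=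
    { reg_N := by simp [hs₁]
      reg_K := I₁.reg_K
      arr₁ := rfl, arr₂ := rfl, arrA := rfl, arrb := rfl
      s₁_lt := by
        intro x h
        rcases hx x h with ⟨d, rfl⟩ | ⟨d, rfl⟩
        · rw [R.s₁_vertex]; omega
        · rw [R.s₁_face]; omega
      s₂_lt := by
        intro x h
        rcases hx x h with ⟨d, rfl⟩ | ⟨d, rfl⟩
        · rw [R.s₂_vertex]; omega
        · rw [R.s₂_face]; omega
      A_le := by
        intro x h
        rcases hx x h with ⟨d, rfl⟩ | ⟨d, rfl⟩
        · rw [R.A_vertex]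
        · rw [R.A_face]; omega
      b_le := fun x _ => by rw [R.b_zero]; omega
      word := by omega
      ha₁ := by omega
      ha₂ := by omega
      haA := by omega
      hab := by omega }
  refine (Tot.seq (Tot.searchProg (src := (d₀ : ℕ)) G (by simp [hs₁]) (by omega)).frame
    (T₂ := (k + 1) * 18) ?_).mono (by rw [← two_mul]; omega) (fun _ h => h)
  rintro s₂ ⟨⟨p1, p2, p3⟩, ag⟩
  -- All face-distances are below the number of levels, so every vertex is reached. Completeness and
  -- soundness of the search give the two inequalities.
  have hval : ∀ d : Fin k,
      s₂.arr 3 d - 1 = E.faceDist (Sum.inl (Sum.inr c)) (Sum.inl (E.tail d)) := by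
    intro d
    have h1 := R.deriv_faceDist (d₀ := d₀) d
    rw [hd₀] at h1
    have h2 := E.faceDist_le (Sum.inr c) (E.tail d)
    obtain ⟨h3, h4, h5⟩ := p3 _ _ h1 (by omega)
    have h6 := R.faceDist_le_of_deriv (p2 _ h3 h4)
    rw [hd₀] at h6
    omega
  have r₂ : ∀ r, r < 12 → s₂.reg r = s₁.reg r := fun r hr =>
    ag.reg r fun h => by have := searchProg_writesReg h; omega
  have I₂ : E.Ready W s₂ := I₁.congr (fun r hr => r₂ r (by omega))
    (fun a ha => ag.arr a fun h => by have := searchProg_writesArr h; omega)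
  have hk := I₂.reg_k
  refine ((Tot.forUpto (B := 6) (I := fun j t => ∀ d : Fin k, (d : ℕ) < j → t.arr 16 d =
      E.faceDist (Sum.inl (Sum.inr c)) (Sum.inl (E.tail d)))
    (by simp) (by simp [Prog.writesReg]) (by simp [Prog.writesReg]) (by omega) (by simp)
    ?_).frame).mono (by rw [hk]) ?_
  · intro j t ha hj hjk h
    rw [hk] at hjk
    have h3 : t.arr 3 = s₂.arr 3 := ha.arr _ (by simp [Prog.writesArr])
    have := p1 j (by omega)
    refine Tot.of_wp (p := .store 16 (.reg 7) (.sub (.load 3 (.reg 7)) (.const 1))) ?_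
    simp only [wp, Expr.Fits, Expr.eval, State.setReg_arr, State.setArr_arr, if_true, hj, h3]
    refine ⟨by omega, by omega, fun d hd => ?_⟩
    by_cases hdj : (d : ℕ) = j
    · rw [← hdj, Function.update_self, hval]
    · rw [Function.update_of_ne hdj]; exact h d (by omega)
  · rintro s₃ ⟨h16, ag₃⟩
    rw [hk] at h16
    have r₃ : ∀ r, r ≠ 7 → s₃.reg r = s₂.reg r := fun r hr =>
      ag₃.reg r (by simp [Prog.forUpto, Prog.writesReg, hr])
    refine ⟨I₂.congr (fun r hr => r₃ r (by omega)) (fun a ha => ag₃.arr a ?_), ?_, ?_,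
      ⟨d₀, ?_, hd₀⟩, fun d => h16 d d.isLt⟩
    · simp [Prog.forUpto, Prog.writesArr]; omega
    · rw [r₃ _ (by simp), r₂ _ (by simp)]; simp [hs₁, hc]
    · rw [r₃ _ (by simp), r₂ _ (by simp)]; simp [hs₁]
    · rw [r₃ _ (by simp), r₂ _ (by simp)]; simp [hs₁]

/-- Computing the level at which the search for ribbons reaches the second edge. -/
def reachProg : Prog :=
  .seq (.assign 10 (.reg 2)) <|
  .seq (searchProg 14 15 13 16)
    (.assign 6 (.sub (.load 3 (.load 1 (.reg 4))) (.const 1)))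

theorem tot_reach {s : State} {c : Fin q} {d₀ : Fin k} (I : E.Ready W s) (h4 : s.reg 4 = d₀)
    (hd₀ : E.tail d₀ = Sum.inr c)
    (hdist : ∀ d : Fin k, s.arr 16 d = E.faceDist (Sum.inl (Sum.inr c)) (Sum.inl (E.tail d))) :
    Tot W reachProg s (1000 * (k + (n + q + k + 1) + 1) + 10) fun s' =>
      E.Ready W s' ∧ s'.reg 3 = s.reg 3 ∧ s'.reg 5 = s.reg 5 ∧ s'.reg 4 = d₀ ∧
      s'.arr 16 = s.arr 16 ∧ s'.reg 6 ≤ n + q + k + 1 ∧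
      ∃ s₁ s₂ A b, E.RibbonArcs c s₁ s₂ A b ∧
        ∀ r, s'.reg 6 ≤ r ↔ Reached s₁ s₂ A b d₀ r (E.rot d₀) := by
  have hW := I.word
  have h1 : Tot W (.assign 10 (.reg 2)) s 2 fun s' => s' = s.setReg 10 k := by
    refine Tot.of_wp (p := .assign 10 (.reg 2)) ?_
    simp only [wp, Expr.Fits, Expr.eval, I.reg_k]
    exact ⟨by omega, trivial⟩
  refine (Tot.seq h1 (T₂ := 1000 * (k + (n + q + k + 1) + 1) + 6) ?_).mono (by omega)
    (fun _ h => h)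
  rintro _ rfl
  set t := s.setReg 10 k with ht
  have It : E.Ready W t := I.congr
    (by rintro r (rfl | rfl | rfl | rfl) <;> simp [ht]) (fun a _ => rfl)
  have R : E.RibbonArcs c (t.arr 14) (t.arr 15) (t.arr 13) (t.arr 16) :=
    { s₁_vertex := fun d => (It.turn d).1
      s₁_crossing := fun d => (It.turn d).2
      s₂_vertex := fun d => (It.ahead d).1
      s₂_crossing := fun d => (It.ahead d).2
      A_zero := It.radial.b_zero
      b_eq := hdist }
  have G : GraphIn W (t.arr 14) (t.arr 15) (t.arr 13) (t.arr 16) k (n + q + k + 1) 14 15 13 16 t :=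
    { reg_N := by simp [ht]
      reg_K := It.reg_K
      arr₁ := rfl, arr₂ := rfl, arrA := rfl, arrb := rfl
      s₁_lt := by
        intro x hx
        have h := It.turn ⟨x, hx⟩
        cases h' : E.tail ⟨x, hx⟩ with
        | inl v => have := h.1 v h'; simp only at this; omega
        | inr y => have := h.2 y h'; simp only at this; omega
      s₂_lt := by
        intro x hx
        have h := It.ahead ⟨x, hx⟩
        cases h' : E.tail (E.rev ⟨x, hx⟩) with
        | inl v => have := h.1 v h'; simp only at this; omega
        | inr y => have := h.2 y h'; simp only at this; omega
      A_le := fun x _ => by rw [R.A_zero]; omega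
      b_le := fun x hx => by
        have h1 := R.b_eq ⟨x, hx⟩
        have h2 := E.faceDist_le (Sum.inr c) (E.tail ⟨x, hx⟩)
        simp only at h1
        omega
      word := by omega
      ha₁ := by omega
      ha₂ := by omega
      haA := by omega
      hab := by omega }
  refine (Tot.seq (Tot.searchProg (src := (d₀ : ℕ)) G (by simp [ht, h4]) d₀.isLt).frame
    (T₂ := 6) ?_).mono le_rfl (fun _ h => h)
  rintro u ⟨⟨p1, p2, p3⟩, ag⟩
  have r₂ : ∀ r, r < 12 → u.reg r = t.reg r := fun r hr =>
    ag.reg r fun h => by have := searchProg_writesReg h; omega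
  have a₂ : ∀ a, a < 3 ∨ 6 < a → u.arr a = t.arr a := fun a ha =>
    ag.arr a fun h => by have := searchProg_writesArr h; omega
  have Iu : E.Ready W u := It.congr (fun r hr => r₂ r (by omega)) (fun a ha => a₂ a (by omega))
  have hu4 : u.reg 4 = d₀ := by rw [r₂ _ (by simp)]; simp [ht, h4]
  have hle := p1 (E.rot d₀) (E.rot d₀).isLt
  have hreach : ∀ r, u.arr 3 (E.rot d₀) - 1 ≤ r ↔
      Reached (t.arr 14) (t.arr 15) (t.arr 13) (t.arr 16) d₀ r (E.rot d₀) := by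
    -- Some ribbon lies in the ball of radius `n + q + k`, so the second edge is reached and the
    -- subtraction of 1 is not truncated.
    obtain ⟨r', hr', hD⟩ := ((R.exists_ribbon_iff hd₀ _).1 (E.exists_ribbon_ball c)).2.2
    obtain ⟨h3, h5, h6⟩ := p3 _ _ hD (by omega)
    intro r
    constructor
    · exact fun h => ⟨_, h, p2 _ h3 h5⟩
    · rintro ⟨r'', hr'', hD'⟩
      by_cases hlt : r'' < n + q + k + 1
      · have := (p3 _ _ hD' hlt).2.2
        omega
      -- Such a level is at least the number of levels, which no stored key exceeds.
      · omega
  refine Tot.of_wp (p := .assign 6 (.sub (.load 3 (.load 1 (.reg 4))) (.const 1))) ?_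
  have l1 := (E.rot d₀).isLt
  simp only [wp, Expr.Fits, Expr.eval, hu4, Iu.rot]
  refine ⟨by omega, Iu.congr ?_ (fun a _ => rfl), ?_, ?_, ?_, ?_, ?_, _, _, _, _, R, ?_⟩
  · rintro r (rfl | rfl | rfl | rfl) <;> simp
  · simp [r₂, ht]
  · simp [r₂, ht]
  · simp [hu4]
  · rw [State.setReg_arr, a₂ _ (by simp)]; rfl
  · simp; omega
  · simpa using hreach

/-- The rest `p` of the program is part of the statement, so that four such walks can be chained;
`r₀` collects the conditions obtained so far. -/
theorem tot_assign_back {s : State} {c : Fin q} {d₀ d : Fin k} {e : Expr} {r₀ : ℕ → Prop}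
    (I : E.Ready W s) (h4 : s.reg 4 = d₀) (hd : E.tail d = Sum.inr c)
    (hdist : ∀ d : Fin k, s.arr 16 d = E.faceDist (Sum.inl (Sum.inr c)) (Sum.inl (E.tail d)))
    (hM : s.reg 6 ≤ n + q + k + 1) (hr₀ : ∀ r, s.reg 6 ≤ r ↔ r₀ r)
    (he : e.Fits W s) (he' : e.eval s = d) {p : Prog} {T : ℕ} {Q : State → Prop}
    (H : ∀ s', E.Ready W s' → s'.reg 4 = d₀ → s'.reg 3 = s.reg 3 → s'.reg 5 = s.reg 5 →
      (∀ d : Fin k, s'.arr 16 d = E.faceDist (Sum.inl (Sum.inr c)) (Sum.inl (E.tail d))) →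
      s'.reg 6 ≤ n + q + k + 1 →
      (∀ r, s'.reg 6 ≤ r ↔ r₀ r ∧ E.Back (E.ball (Sum.inr c) r) d) → Tot W p s' T Q) :
    Tot W (.seq (.assign 8 e) (.seq backProg p)) s (1 + e.cost + ((k + 1) * 20 + T)) Q := by
  have hW := I.word
  have h1 : Tot W (.assign 8 e) s (1 + e.cost) fun s' => s' = s.setReg 8 d :=
    Tot.of_wp (p := .assign 8 e) ⟨he, by rw [he']⟩
  refine Tot.seq h1 ?_
  rintro _ rfl
  have I' : E.InputIn W (s.setReg 8 d) :=
    I.toInputIn.congr (by simp) (by simp) (by simp) rfl rfl rfl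
  refine Tot.seq (tot_back (K := n + q + k + 1) I' (by simp) (by omega) (by simpa using hM) hd hdist
    (fun d => ?_)).frame ?_
  · have := E.faceDist_le (Sum.inr c) (E.tail d)
    rw [State.setReg_arr, hdist]; omega
  · rintro s' ⟨⟨h1, h2⟩, ag⟩
    have hr : ∀ r, r ≠ 8 → r ≠ 6 → s'.reg r = s.reg r := fun r h8 h6 =>
      (ag.reg r (by simp [backProg, Prog.writesReg, h8, h6])).trans (by simp [h8])
    have ha : ∀ a, s'.arr a = s.arr a := fun a => ag.arr a (by simp [backProg, Prog.writesArr])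
    refine H s' (I.congr (fun r h => hr r (by omega) (by omega)) (fun a _ => ha a))
      (by rw [hr _ (by simp) (by simp), h4]) (hr _ (by simp) (by simp)) (hr _ (by simp) (by simp))
      (by rw [ha]; exact hdist) h1 (fun r => ?_)
    rw [h2, ← hr₀]
    simp

end EmbeddedGraph

/-! ### The maximum over all crossings -/

namespace EmbeddedGraph

open RAM

variable {n q k : ℕ} {E : EmbeddedGraph (Fin n) (Fin q) (Fin k)} {W : ℕ}

/-- Taking the maximum of the level found and the face-distances of the two edges, and raising
register `5` to it. -/
def edgesProg : Prog :=
  .seq (.assign 8 (.reg 4)) <| .seq backProg <|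
  .seq (.assign 8 (.load 1 (.reg 4))) <| .seq backProg <|
  .seq (.assign 8 (.load 1 (.load 1 (.reg 4)))) <| .seq backProg <|
  .seq (.assign 8 (.load 1 (.load 1 (.load 1 (.reg 4))))) <| .seq backProg
    (.assign 5 (.add (.reg 5) (.sub (.reg 6) (.reg 5))))

theorem tot_edges {s : State} {c : Fin q} {d₀ : Fin k} (I : E.Ready W s) (h4 : s.reg 4 = d₀)
    (hd₀ : E.tail d₀ = Sum.inr c)
    (hdist : ∀ d : Fin k, s.arr 16 d = E.faceDist (Sum.inl (Sum.inr c)) (Sum.inl (E.tail d)))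
    (hM : s.reg 6 ≤ n + q + k + 1) (h5 : s.reg 5 ≤ n + q + k + 1) {s₁ s₂ A b : ℕ → ℕ}
    (R : E.RibbonArcs c s₁ s₂ A b)
    (hr : ∀ r, s.reg 6 ≤ r ↔ Reached s₁ s₂ A b d₀ r (E.rot d₀)) :
    Tot W edgesProg s (80 * (k + 1) + 20) fun s' => E.Ready W s' ∧ s'.reg 3 = s.reg 3 ∧
      s'.reg 5 ≤ n + q + k + 1 ∧ ∀ r, s'.reg 5 ≤ r ↔ s.reg 5 ≤ r ∧ E.crossingRadius c ≤ r := by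
  have hW := I.word
  have l0 := d₀.isLt
  have l1 := (E.rot d₀).isLt
  have l2 := (E.rot (E.rot d₀)).isLt
  have l3 := (E.rot (E.rot (E.rot d₀))).isLt
  have t1 : E.tail (E.rot d₀) = Sum.inr c := by rw [E.tail_rot, hd₀]
  have t2 : E.tail (E.rot (E.rot d₀)) = Sum.inr c := by rw [E.tail_rot, t1]
  have t3 : E.tail (E.rot (E.rot (E.rot d₀))) = Sum.inr c := by rw [E.tail_rot, t2]
  refine (tot_assign_back (d := d₀) (e := .reg 4) (T := 78 + 60 * k) I h4 hd₀ hdist hM hr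
    (by simp only [Expr.Fits]; omega) h4 ?_).mono (by simp only [Expr.cost]; omega) (fun _ h => h)
  intro u Iu u4 u3 u5 ud uM ur
  refine (tot_assign_back (d := E.rot d₀) (T := 55 + 40 * k) Iu u4 t1 ud uM ur
    (by simp only [Expr.Fits, Expr.eval, u4, Iu.rot]; omega)
    (by simp only [Expr.eval, u4, Iu.rot]) ?_).mono (by simp only [Expr.cost]; omega) (fun _ h => h)
  intro v Iv v4 v3 v5 vd vM vr
  refine (tot_assign_back (d := E.rot (E.rot d₀)) (T := 31 + 20 * k) Iv v4 t2 vd vM vr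
    (by simp only [Expr.Fits, Expr.eval, v4, Iv.rot]; omega)
    (by simp only [Expr.eval, v4, Iv.rot]) ?_).mono (by simp only [Expr.cost]; omega) (fun _ h => h)
  intro w Iw w4 w3 w5 wd wM wr
  refine (tot_assign_back (d := E.rot (E.rot (E.rot d₀))) (T := 6) Iw w4 t3 wd wM wr
    (by simp only [Expr.Fits, Expr.eval, w4, Iw.rot]; omega)
    (by simp only [Expr.eval, w4, Iw.rot]) ?_).mono (by simp only [Expr.cost]; omega) (fun _ h => h)
  intro z Iz z4 z3 z5 zd zM zr
  refine Tot.of_wp (p := .assign 5 (.add (.reg 5) (.sub (.reg 6) (.reg 5)))) ?_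
  have e5 : z.reg 5 = s.reg 5 := by rw [z5, w5, v5, u5]
  simp only [wp, Expr.Fits, Expr.eval, add_sub_eq_max, e5]
  refine ⟨by omega, Iz.congr (by rintro r (rfl | rfl | rfl | rfl) <;> simp) (fun a _ => rfl),
    by simp [z3, w3, v3, u3], by simp; omega, fun r => ?_⟩
  -- The four backward walks express that the two edges lie in the ball; with the level of `rot d₀`
  -- this is the criterion for a ribbon.
  rw [State.setReg_reg, if_pos rfl, max_le_iff, zr, crossingRadius_le_iff, R.exists_ribbon_iff hd₀,
    edgeVerts_subset_iff hd₀, edgeVerts_subset_iff t1]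
  tauto

/-- Raising register `5` to the radius of the crossing in register `3`. -/
def crossingProg : Prog := .seq distProg (.seq reachProg edgesProg)

theorem tot_crossing {s : State} {c : Fin q} (I : E.Ready W s) (hc : s.reg 3 = c)
    (h5 : s.reg 5 ≤ n + q + k + 1) :
    Tot W crossingProg s (6000 * k + 3000 * (n + q) + 5000) fun s' => E.Ready W s' ∧ s'.reg 3 = c ∧
      s'.reg 5 ≤ n + q + k + 1 ∧ ∀ r, s'.reg 5 ≤ r ↔ s.reg 5 ≤ r ∧ E.crossingRadius c ≤ r := by
  refine (Tot.seq (tot_dist I hc) (T₂ := 1000 * (k + (n + q + k + 1) + 1) + 10 +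
    (80 * (k + 1) + 20)) ?_).mono (by omega) (fun _ h => h)
  rintro u ⟨Iu, u3, u5, ⟨d₀, u4, hd₀⟩, ud⟩
  refine Tot.seq (tot_reach Iu u4 hd₀ ud) ?_
  rintro v ⟨Iv, v3, v5, v4, v16, v6, s₁, s₂, A, b, R, hr⟩
  refine (tot_edges Iv v4 hd₀ (by rw [v16]; exact ud) v6 (by omega) R hr).mono le_rfl ?_
  rintro w ⟨Iw, w3, w5, wr⟩
  exact ⟨Iw, by rw [w3, v3, u3], w5, by rw [← u5, ← v5]; exact wr⟩

/-- The computation of the ribbon radius, if there are crossings. -/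
def mainProg : Prog :=
  .seq setupProg (.seq (.forUpto 3 1 crossingProg) (.assign 0 (.add (.reg 5) (.const 1))))

theorem not_crossingProg_writesReg {r : ℕ} (hr : r = 1 ∨ r = 3) : ¬ crossingProg.writesReg r := by
  rintro (h | h | h)
  · rcases h with h | h | h | h
    · simp only [Prog.writesReg] at h; omega
    · simp only [Prog.writesReg] at h; omega
    · have := searchProg_writesReg h; omega
    · simp only [Prog.forUpto, Prog.writesReg, false_or] at h; omega
  · rcases h with h | h | h
    · simp only [Prog.writesReg] at h; omega
    · have := searchProg_writesReg h; omega
    · simp only [Prog.writesReg] at h; omega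
  · simp only [edgesProg, backProg, Prog.writesReg] at h; omega

theorem tot_main {s : State} (I : E.InputIn W s) (h12 : ∀ x, s.arr 12 x = 0)
    (h13 : ∀ x, s.arr 13 x = 0) (h5 : s.reg 5 = 0) :
    Tot W mainProg s (110 * (k + 1) + (q + 1) * (6000 * k + 3000 * (n + q) + 5012) + 4)
      fun s' => s'.reg 0 = E.ribbonRadius := by
  have hW := I.word
  refine (Tot.seq (tot_setup I h12 h13) (T₂ := (q + 1) * (6000 * k + 3000 * (n + q) + 5012) + 4)
    ?_).mono (by omega) (fun _ h => h)
  rintro u ⟨Iu, u5⟩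
  have hq := Iu.reg_q
  refine Tot.seq ((Tot.forUpto (W := W) (i := 3) (N := 1) (p := crossingProg)
    (B := 6000 * k + 3000 * (n + q) + 5000) (I := fun j t => E.Ready W t ∧
      t.reg 5 ≤ n + q + k + 1 ∧
      ∀ r, t.reg 5 ≤ r ↔ ∀ c : Fin q, (c : ℕ) < j → E.crossingRadius c ≤ r)
    (by simp) (not_crossingProg_writesReg (by simp)) (not_crossingProg_writesReg (by simp))
    (by omega) ⟨Iu.congr (by rintro r (rfl | rfl | rfl | rfl) <;> simp) (fun a _ => rfl),
      by simp [u5, h5], by simp [u5, h5]⟩ ?_).mono (T' := (q + 1) * (6000 * k + 3000 * (n + q) + 5012))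
      (by rw [hq]) (fun _ h => h)) ?_
  · rintro j t - hj hjq ⟨It, t5, tr⟩
    rw [hq] at hjq
    refine (tot_crossing (c := ⟨j, hjq⟩) It hj t5).mono le_rfl ?_
    rintro v ⟨Iv, v3, v5, vr⟩
    refine ⟨Iv.congr (by rintro r (rfl | rfl | rfl | rfl) <;> simp) (fun a _ => rfl),
      by simpa using v5, fun r => ?_⟩
    rw [State.setReg_reg, if_neg (by simp), vr, tr]
    constructor
    · rintro ⟨h1, h2⟩ c hc
      rcases Nat.lt_succ_iff_lt_or_eq.1 hc with h | h
      · exact h1 c h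
      · rwa [show c = ⟨j, hjq⟩ from Fin.ext h]
    · exact fun h => ⟨fun c hc => h c (by omega), h _ (Nat.lt_succ_self j)⟩
  · rintro v ⟨Iv, v5, vr⟩
    rw [hq] at vr
    refine Tot.of_wp (p := .assign 0 (.add (.reg 5) (.const 1))) ?_
    simp only [wp, Expr.Fits, Expr.eval]
    refine ⟨by omega, ?_⟩
    rw [State.setReg_reg, if_pos rfl, ribbonRadius_eq]
    congr 1
    refine le_antisymm ((vr _).2 fun c _ => Finset.le_sup (Finset.mem_univ c))
      (Finset.sup_le fun c _ => (vr _).1 le_rfl c c.isLt)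

theorem inputIn_input (E : EmbeddedGraph (Fin n) (Fin q) (Fin k))
    (hW : 6 * (n + q + k) + 100 < W) : E.InputIn W E.input where
  reg_n := rfl
  reg_q := rfl
  reg_k := rfl
  tail_inl d v h := by simp [input, RAM.ofFin, h]; rfl
  tail_inr d x h := by simp [input, RAM.ofFin, h]; rfl
  rot d := by simp [input, RAM.ofFin]
  rev d := by simp [input, RAM.ofFin]
  word := hW

theorem two_le_ribbonRadius (E : EmbeddedGraph (Fin n) (Fin q) (Fin k)) (hq : 0 < q) :
    2 ≤ E.ribbonRadius := by
  have h1 := E.crossingRadius_pos ⟨0, hq⟩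
  have h2 := Finset.le_sup (f := E.crossingRadius) (Finset.mem_univ ⟨0, hq⟩)
  rw [ribbonRadius_eq]
  omega

end EmbeddedGraph

/-! ### The program and its resources -/

open RAM in
theorem mainTheorem10 :
    ∃ (P : RAM.Prog) (C : ℕ),
      ∀ (n q k : ℕ) (E : EmbeddedGraph (Fin n) (Fin q) (Fin k)),
        ∃ (s : RAM.State) (t : ℕ),
          RAM.Exec ((n + q + 1) ^ C) P E.input s t ∧
          s.reg 0 = E.ribbonRadius ∧
          (t : ℝ) ≤ C * (1 + q * (n + q) * Real.logb 2 E.ribbonRadius) := by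
  -- A single constant serves as the exponent of the word bound and as the factor of the running
  -- time.
  obtain ⟨C, hC⟩ : ∃ C : ℕ, C = 1000000 := ⟨_, rfl⟩
  refine ⟨.branch (.reg 1) EmbeddedGraph.mainProg (.assign 0 (.const 1)), C, fun n q k E => ?_⟩
  have hn : 0 < n := Fin.pos_iff_nonempty.2 E.connected.nonempty
  rcases Nat.eq_zero_or_pos q with rfl | hq
  · have hW : 1 < (n + 0 + 1) ^ C := Nat.one_lt_pow (by omega) (by omega)
    refine ⟨_, _, .branch_false _ _ _ _ _ _ ?_ rfl (.assign _ _ _ hW), ?_, ?_⟩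
    · exact lt_trans Nat.zero_lt_one hW
    · rw [E.ribbonRadius_eq]
      simp [Expr.eval]
    · simp only [Expr.cost]
      norm_num [hC]
  · have hk := E.card_darts_le
    have hW : 6 * (n + q + k) + 100 < (n + q + 1) ^ C := by
      -- The linear bound on `k` makes the left side linear in `n + q`; since `n` and `q` are
      -- positive, the base `n + q + 1` is at least 3.
      calc 6 * (n + q + k) + 100 < 3 ^ 7 * (n + q + 1) := by omega
        _ ≤ (n + q + 1) ^ 7 * (n + q + 1) :=
          Nat.mul_le_mul_right _ (Nat.pow_le_pow_left (by omega) 7)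
        _ = (n + q + 1) ^ 8 := (pow_succ _ 7).symm
        _ ≤ (n + q + 1) ^ C := Nat.pow_le_pow_right (by omega) (by omega)
    obtain ⟨s, t, h1, h2, h3⟩ := EmbeddedGraph.tot_main (E.inputIn_input hW) (fun _ => rfl)
      (fun _ => rfl) rfl
    refine ⟨s, _, .branch_true _ _ _ _ _ _ ?_ ?_ h1, h3, ?_⟩
    · exact lt_of_le_of_lt (show q ≤ _ by omega) hW
    · exact hq.ne'
    · have ht : 1 + (Expr.reg 1).cost + t ≤ C * (q * (n + q)) := by
        -- Here `q + 1 ≤ 2 * q`, and the second factor is linear in `n + q` by the bound on `k`.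
        have h4 : (q + 1) * (6000 * k + 3000 * (n + q) + 5012) ≤
            2 * q * (140000 * (n + q)) := Nat.mul_le_mul (by omega) (by omega)
        have h5 : n + q ≤ q * (n + q) := Nat.le_mul_of_pos_left _ hq
        have h6 : 2 * q * (140000 * (n + q)) = 280000 * (q * (n + q)) := by ring
        simp only [Expr.cost, hC]
        omega
      -- The running time is already O(q(n + q)); of the logarithm only this lower bound is used.
      have hlog : 1 ≤ Real.logb 2 E.ribbonRadius := by
        rw [Real.le_logb_iff_rpow_le (by norm_num)
          (by exact_mod_cast (E.two_le_ribbonRadius hq).trans' (by norm_num)), Real.rpow_one]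
        exact_mod_cast E.two_le_ribbonRadius hq
      have hp : (0 : ℝ) ≤ q * (n + q) := by positivity
      calc ((1 + (Expr.reg 1).cost + t : ℕ) : ℝ) ≤ ((C * (q * (n + q)) : ℕ) : ℝ) :=
            Nat.cast_le.2 ht
        _ = C * (q * (n + q) * 1) := by push_cast; ring
        _ ≤ C * (1 + q * (n + q) * Real.logb 2 E.ribbonRadius) := by
          refine mul_le_mul_of_nonneg_left ?_ (Nat.cast_nonneg C)
          have := mul_le_mul_of_nonneg_left hlog hp
          linarith
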